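/- Let $\mathbf{k}$ be a field of characteristic $0$, let $n\ge 1$ and $0\le p\le n-1$, and let $V=\mathbf{k}^n$ be the space of linear combinations of the coordinate functions $z_1,\dots,z_n$ on $\mathbb{A}^n$, so that $GL_n=GL(V)$. Let $z_1^*,\dots,z_n^*$ be the dual coordinates, spanning $V^*$, and let $$J=\{(z,z^*)\in\mathbb{A}^n\times\check{\mathbb{A}}^n \;:\; \textstyle\sum_\nu z_\nu z_\nu^*=1\}$$ be the Jouanolou torsor, an affine variety with the projection $(z,z^*)\mapsto z$ onto $\mathbb{A}^n-0$. Let $$A_{[n]}^p=\Gamma\bigl(J,\Omega^p_{J/(\mathbb{A}^n-0)}\bigr)=\Lambda^p_{R}\,\Omega_{R/\mathbf{k}[z_1,\dots,z_n]},\qquad R=\mathbf{k}[z_1,\dots,z_n,z_1^*,\dots,z_n^*]/\bigl(\textstyle\sum_\nu z_\nu z^*_\nu-1\bigr),$$ be the space of global relative differential $p$-forms (the $p$-th graded piece of the Jouanolou model of $R\Gamma(\mathbb{A}^n-0,\mathcal{O})$), with its natural action of $GL_n$. For a dominant weight $\alpha=(\alpha_1\ge\dots\ge\alpha_n)\in\mathbb{Z}^n$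 let $\Sigma^\alpha(V)$ be the irreducible rational representation of $GL_n$ of highest weight $\alpha$; concretely, the space of functions on $GL_n(\mathbf{k})$ spanned by the right translates of $\prod_{i=1}^n\Delta_i^{\alpha_i-\alpha_{i+1}}$, where $\Delta_i$ is the leading principal $i\times i$ minor and $\alpha_{n+1}=0$. **Theorem.** (a) As a $GL_n$-module, $A_{[n]}^p$ has simple spectrum: it is a direct sum of representations $\Sigma^\alpha(V)$, and each $\Sigma^\alpha(V)$ enters into it no more than once, that is, $\dim_{\mathbf{k}}\operatorname{Hom}_{GL_n}(\Sigma^\alpha(V),A_{[n]}^p)\le 1$ for every dominant $\alpha$. (b) More precisely, $\Sigma^\alpha(V)$ enters into $A_{[n]}^p$ if and only if $$\alpha_1\ge 0\ge\alpha_2\ge 0\ge\cdots\ge 0\ge\alpha_{n-p}\ge -1\ge\alpha_{n-p+1}\ge -1\ge\cdots\ge -1\ge\alpha_n,$$ where between the consecutive entries $\alpha_i$ and $\alpha_{i+1}$ there stands $0$ for $1\le i\le n-1-p$ and $-1$ for $n-p\le i\le n-1$ (for $p=n-1$ the chain reads $\alpha_1\ge -1\ge\alpha_2\ge -1\ge\cdots\ge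 -1\ge\alpha_n$; for $n=1$ there is no condition). Consequently $A_{[n]}^p\cong\bigoplus_\alpha\Sigma^\alpha(V)$, the sum over all $\alpha\in\mathbb{Z}^n$ with these inequalities. -/

import Mathlib

open scoped KaehlerDifferential DirectSum

noncomputable section

namespace Jouanolou

/-! ### Functoriality of relative differential forms for semilinear automorphisms -/

section Semilinear

variable {S R : Type*} [CommRing S] [CommRing R] [Algebra S R]

/-- The `R`-module `M` with scalars acting through the ring homomorphism `σ : R → R`. -/
def Twist (_σ : R →+* R) (M : Type*) : Type _ := M

instance (σ : R →+* R) (M : Type*) [AddCommGroup M] : AddCommGroup (Twist σ M) :=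
  inferInstanceAs (AddCommGroup M)

instance (σ : R →+* R) (M : Type*) [AddCommGroup M] [Module R M] : Module R (Twist σ M) :=
  Module.compHom M σ

instance (σ : R →+* R) (M : Type*) [AddCommGroup M] [Module R M] : Module S (Twist σ M) :=
  Module.compHom M (σ.comp (algebraMap S R))

theorem Twist.smul_def (σ : R →+* R) {M : Type*} [AddCommGroup M] [Module R M] (r : R)
    (m : M) : (r • (show Twist σ M from m)) = (show Twist σ M from (σ r • m)) := rfl

theorem Twist.base_smul_def (σ : R →+* R) {M : Type*} [AddCommGroup M] [Module R M] (s : S)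
    (m : M) : (s • (show Twist σ M from m)) = (show Twist σ M from (σ (algebraMap S R s) • m)) :=
  rfl

instance (σ : R →+* R) (M : Type*) [AddCommGroup M] [Module R M] :
    IsScalarTower S R (Twist σ M) where
  smul_assoc s r m := by
    change σ (s • r) • (show M from m) = σ (algebraMap S R s) • σ r • (show M from m)
    rw [Algebra.smul_def, map_mul, mul_smul]

/-- An `R`-linear map into the twisted module, seen as a `σ`-semilinear map. -/
def Twist.toSemilinear {σ : R →+* R} {M N : Type*} [AddCommGroup M] [Module R M]
    [AddCommGroup N] [Module R N] (f : M →ₗ[R] Twist σ N) : M →ₛₗ[σ] N where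
  toFun := f
  map_add' := f.map_add
  map_smul' := f.map_smul

/-- A `σ`-semilinear map, seen as an `R`-linear map into the twisted module. -/
def Twist.ofSemilinear {σ : R →+* R} {M N : Type*} [AddCommGroup M] [Module R M]
    [AddCommGroup N] [Module R N] (f : M →ₛₗ[σ] N) : M →ₗ[R] Twist σ N where
  toFun := f
  map_add' := f.map_add
  map_smul' := f.map_smulₛₗ

/-- The derivation `b ↦ dσ(b)` of `R` over `S`, with values in the relative differentials twisted
by `σ`, for an endomorphism `σ` of `R` that restricts to an endomorphism `τ` of the base ring. -/
def twistedD (τ : S →+* S) (σ : R →+* R)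
    (h : ∀ s, σ (algebraMap S R s) = algebraMap S R (τ s)) :
    Derivation S R (Twist σ Ω[R⁄S]) :=
  Derivation.mk'
    { toFun := fun b => (KaehlerDifferential.D S R (σ b) : Ω[R⁄S])
      map_add' := fun a b => by
        rw [map_add, map_add]; rfl
      map_smul' := fun s b => by
        change KaehlerDifferential.D S R (σ (s • b)) =
          σ (algebraMap S R s) • KaehlerDifferential.D S R (σ b)
        rw [Algebra.smul_def, map_mul, h, Derivation.leibniz, Derivation.map_algebraMap,
          smul_zero, add_zero] }
    (fun a b => by
      change KaehlerDifferential.D S R (σ (a * b)) =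
        σ a • KaehlerDifferential.D S R (σ b) + σ b • KaehlerDifferential.D S R (σ a)
      rw [map_mul, Derivation.leibniz])

/-- The map `b db' ↦ σ(b) dσ(b')` on relative differentials `Ω[R⁄S]` induced by an endomorphism
`σ` of `R` that restricts to an endomorphism `τ` of the base ring `S`. -/
def kaehlerMap (τ : S →+* S) (σ : R →+* R)
    (h : ∀ s, σ (algebraMap S R s) = algebraMap S R (τ s)) : Ω[R⁄S] →ₛₗ[σ] Ω[R⁄S] :=
  Twist.toSemilinear (twistedD τ σ h).liftKaehlerDifferential

theorem kaehlerMap_D (τ : S →+* S) (σ : R →+* R)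
    (h : ∀ s, σ (algebraMap S R s) = algebraMap S R (τ s)) (b : R) :
    kaehlerMap τ σ h (KaehlerDifferential.D S R b) = KaehlerDifferential.D S R (σ b) :=
  (twistedD τ σ h).liftKaehlerDifferential_comp_D b

/-- The alternating map `(ω₁, …, ω_p) ↦ φ(ω₁) ∧ ⋯ ∧ φ(ω_p)` with values in the twisted exterior
power, for a `σ`-semilinear endomorphism `φ` of an `R`-module. -/
def twistedιMulti {σ : R →+* R} {M : Type*} [AddCommGroup M] [Module R M] (p : ℕ)
    (φ : M →ₛₗ[σ] M) : M [⋀^Fin p]→ₗ[R] Twist σ (⋀[R]^p M) where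
  toFun := fun m => (exteriorPower.ιMulti R p (fun i => φ (m i)) : ⋀[R]^p M)
  map_update_add' := fun m i x y => by
    have e : ∀ z, (fun j => φ (Function.update m i z j)) =
        Function.update (fun j => φ (m j)) i (φ z) := fun z => by
      funext j; by_cases hj : j = i
      · subst hj; simp
      · simp [hj]
    simp only [e, map_add]
    exact (exteriorPower.ιMulti R p).map_update_add _ _ _ _
  map_update_smul' := fun m i c x => by
    have e : ∀ z, (fun j => φ (Function.update m i z j)) =
        Function.update (fun j => φ (m j)) i (φ z) := fun z => by
      funext j; by_cases hj : j = i
      · subst hj; simp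
      · simp [hj]
    simp only [e, map_smulₛₗ]
    exact (exteriorPower.ιMulti R p).map_update_smul _ _ _ _
  map_eq_zero_of_eq' := fun m i j hm hij =>
    (exteriorPower.ιMulti R p).map_eq_zero_of_eq _ (by simp [hm]) hij

/-- The map `ω₁ ∧ ⋯ ∧ ω_p ↦ φ(ω₁) ∧ ⋯ ∧ φ(ω_p)` on exterior powers induced by a `σ`-semilinear
endomorphism `φ` of an `R`-module. -/
def exteriorMap {σ : R →+* R} {M : Type*} [AddCommGroup M] [Module R M] (p : ℕ)
    (φ : M →ₛₗ[σ] M) : ⋀[R]^p M →ₛₗ[σ] ⋀[R]^p M :=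
  Twist.toSemilinear (exteriorPower.alternatingMapLinearEquiv (twistedιMulti p φ))

theorem exteriorMap_ιMulti {σ : R →+* R} {M : Type*} [AddCommGroup M] [Module R M] (p : ℕ)
    (φ : M →ₛₗ[σ] M) (m : Fin p → M) :
    exteriorMap p φ (exteriorPower.ιMulti R p m) =
      exteriorPower.ιMulti R p (fun i => φ (m i)) :=
  exteriorPower.alternatingMapLinearEquiv_apply_ιMulti (twistedιMulti p φ) m

/-- The map `b db₁ ∧ ⋯ ∧ db_p ↦ σ(b) dσ(b₁) ∧ ⋯ ∧ dσ(b_p)` on relative `p`-forms. -/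
def formsMap (p : ℕ) (τ : S →+* S) (σ : R →+* R)
    (h : ∀ s, σ (algebraMap S R s) = algebraMap S R (τ s)) :
    ⋀[R]^p Ω[R⁄S] →ₛₗ[σ] ⋀[R]^p Ω[R⁄S] :=
  exteriorMap p (kaehlerMap τ σ h)

theorem formsMap_ιMulti_D (p : ℕ) (τ : S →+* S) (σ : R →+* R)
    (h : ∀ s, σ (algebraMap S R s) = algebraMap S R (τ s)) (b : Fin p → R) :
    formsMap p τ σ h (exteriorPower.ιMulti R p (fun i => KaehlerDifferential.D S R (b i))) =
      exteriorPower.ιMulti R p (fun i => KaehlerDifferential.D S R (σ (b i))) := by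
  rw [formsMap, exteriorMap_ιMulti]
  simp only [kaehlerMap_D]

/-- Induction on relative `p`-forms: they are spanned by the forms `db₁ ∧ ⋯ ∧ db_p`. -/
theorem forms_induction {p : ℕ} {P : ⋀[R]^p Ω[R⁄S] → Prop} (zero : P 0)
    (add : ∀ x y, P x → P y → P (x + y)) (smul : ∀ (r : R) x, P x → P (r • x))
    (d : ∀ b : Fin p → R,
      P (exteriorPower.ιMulti R p (fun i => KaehlerDifferential.D S R (b i))))
    (x : ⋀[R]^p Ω[R⁄S]) : P x := by
  have hx := (exteriorPower.ιMulti_span_of_span R p _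
    (KaehlerDifferential.span_range_derivation S R)).ge (Submodule.mem_top (x := x))
  induction hx using Submodule.span_induction with
  | mem y hy =>
    obtain ⟨m, hm, rfl⟩ := hy
    choose b hb using fun i => hm (Set.mem_range_self i)
    obtain rfl : (fun i => KaehlerDifferential.D S R (b i)) = m := funext hb
    exact d b
  | zero => exact zero
  | add y z _ _ hy hz => exact add y z hy hz
  | smul r y _ hy => exact smul r y hy

end Semilinear

/-! ### The Jouanolou torsor and its relative differential forms -/

section Torsor

open MvPolynomial

variable (k : Type*) [Field k] (n : ℕ)

/-- The ring `k[z] = k[z₁, …, zₙ]` of functions on the affine space. -/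
abbrev BaseRing : Type _ := MvPolynomial (Fin n) k

/-- The ring `k[z, z*] = k[z₁, …, zₙ][z*₁, …, z*ₙ]`. -/
abbrev BigRing : Type _ := MvPolynomial (Fin n) (BaseRing k n)

/-- The element `zz* - 1 = ∑ z_ν z*_ν - 1` of `k[z, z*]`. -/
def equation : BigRing k n := ∑ i, C (X i) * X i - 1

/-- The ring `k[z, z*] / (zz* - 1)` of functions on the Jouanolou torsor `J`, the affine variety of
pairs `(z, z*)` with `zz* = 1`. It is an algebra over `k[z]` through the projection `(z, z*) ↦ z`,
whose image is the punctured affine space. -/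
abbrev TorsorRing : Type _ := BigRing k n ⧸ Ideal.span {equation k n}

/-- The space `A^p` of global relative differential `p`-forms on `J` over the (punctured) affine
space. -/
abbrev Forms (p : ℕ) : Type _ := ⋀[TorsorRing k n]^p Ω[TorsorRing k n⁄BaseRing k n]

variable {k n}

/-- The action of `g` on `k[z]`: the `z_i` form the standard basis of `V = kⁿ`. -/
def actBase (g : GL (Fin n) k) : BaseRing k n →ₐ[k] BaseRing k n :=
  aeval fun i => ∑ j, C (g.1 j i) * X j

/-- The action of `g` on `k[z, z*]`: the `z_i` form the standard basis of `V = kⁿ` and the `z*_i`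
form the dual basis of `V*`. -/
def actBig (g : GL (Fin n) k) : BigRing k n →+* BigRing k n :=
  eval₂Hom (C.comp (actBase g).toRingHom) fun i => ∑ j, C (C ((g⁻¹).1 i j)) * X j

theorem actBase_X (g : GL (Fin n) k) (i : Fin n) :
    actBase g (X i) = ∑ j, C (g.1 j i) * X j := by simp [actBase]

theorem actBig_C (g : GL (Fin n) k) (s : BaseRing k n) :
    actBig g (C s) = C (actBase g s) := by simp [actBig]

theorem actBig_X (g : GL (Fin n) k) (i : Fin n) :
    actBig g (X i) = ∑ j, C (C ((g⁻¹).1 i j)) * X j := by simp [actBig]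

theorem actBase_one : actBase (1 : GL (Fin n) k) = AlgHom.id k _ := by
  ext1 i
  simp [actBase_X, Matrix.one_apply]

theorem actBase_mul (g h : GL (Fin n) k) : actBase (g * h) = (actBase g).comp (actBase h) := by
  ext1 i
  simp only [actBase_X, AlgHom.comp_apply, map_sum, map_mul, algHom_C, Finset.mul_sum,
    Units.val_mul, Matrix.mul_apply, Finset.sum_mul]
  rw [Finset.sum_comm]
  refine Finset.sum_congr rfl fun j _ => Finset.sum_congr rfl fun l _ => ?_
  simp only [algebraMap_eq]
  ring

theorem actBig_one : actBig (1 : GL (Fin n) k) = RingHom.id _ := by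
  refine MvPolynomial.ringHom_ext (fun s => ?_) fun i => ?_
  · simp [actBig_C, actBase_one]
  · simp [actBig_X, Matrix.one_apply]

theorem actBig_mul (g h : GL (Fin n) k) : actBig (g * h) = (actBig g).comp (actBig h) := by
  refine MvPolynomial.ringHom_ext (fun s => ?_) fun i => ?_
  · simp [actBig_C, actBase_mul]
  · simp only [actBig_X, RingHom.comp_apply, map_sum, map_mul, actBig_C, mul_inv_rev,
      Units.val_mul, Matrix.mul_apply, Finset.sum_mul, Finset.mul_sum, algHom_C]
    rw [Finset.sum_comm]
    refine Finset.sum_congr rfl fun j _ => Finset.sum_congr rfl fun l _ => ?_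
    simp only [algebraMap_eq]
    ring

/-- The pairing `zz*` is invariant. -/
theorem actBig_equation (g : GL (Fin n) k) : actBig g (equation k n) = equation k n := by
  have hg : ∀ a b, ∑ i, g.1 a i * (g⁻¹).1 i b = if a = b then 1 else 0 := fun a b => by
    rw [← Matrix.mul_apply, ← Units.val_mul, mul_inv_cancel, Units.val_one, Matrix.one_apply]
  have key : ∑ i, actBig g (C (X i) * X i) = ∑ i, (C (X i) * X i : BigRing k n) := by
    calc ∑ i, actBig g (C (X i) * X i)
        = ∑ i, ∑ a, ∑ b, C (C (g.1 a i * (g⁻¹).1 i b)) * (C (X a) * X b : BigRing k n) := by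
          refine Finset.sum_congr rfl fun i _ => ?_
          rw [map_mul, actBig_C, actBase_X, actBig_X, map_sum, Finset.sum_mul_sum]
          refine Finset.sum_congr rfl fun a _ => Finset.sum_congr rfl fun b _ => ?_
          simp only [map_mul]
          ring
      _ = ∑ a, ∑ b, C (C (∑ i, g.1 a i * (g⁻¹).1 i b)) * (C (X a) * X b : BigRing k n) := by
          rw [Finset.sum_comm]
          refine Finset.sum_congr rfl fun a _ => ?_
          rw [Finset.sum_comm]
          refine Finset.sum_congr rfl fun b _ => ?_
          rw [map_sum, map_sum, Finset.sum_mul]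
      _ = _ := by
          simp only [hg]
          simp
  simp only [equation, map_sub, map_sum, map_one] at key ⊢
  rw [key]

/-- The action of `g` on the ring of functions on the Jouanolou torsor. -/
def actTorsor (g : GL (Fin n) k) : TorsorRing k n →+* TorsorRing k n :=
  Ideal.quotientMap _ (actBig g) (by
    rw [Ideal.span_singleton_le_iff_mem, Ideal.mem_comap, actBig_equation]
    exact Ideal.subset_span rfl)

theorem actTorsor_mk (g : GL (Fin n) k) (x : BigRing k n) :
    actTorsor g (Ideal.Quotient.mk _ x) = Ideal.Quotient.mk _ (actBig g x) :=
  Ideal.quotientMap_mk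

theorem actTorsor_algebraMap (g : GL (Fin n) k) (s : BaseRing k n) :
    actTorsor g (algebraMap _ (TorsorRing k n) s) = algebraMap _ _ (actBase g s) := by
  change actTorsor g (Ideal.Quotient.mk _ (C s)) = Ideal.Quotient.mk _ (C (actBase g s))
  rw [actTorsor_mk, actBig_C]

theorem actTorsor_scalar (g : GL (Fin n) k) (c : k) :
    actTorsor g (algebraMap k (TorsorRing k n) c) = algebraMap k _ c := by
  rw [IsScalarTower.algebraMap_apply k (BaseRing k n) (TorsorRing k n), actTorsor_algebraMap,
    AlgHom.commutes]

theorem actTorsor_one (x : TorsorRing k n) : actTorsor 1 x = x := by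
  obtain ⟨x, rfl⟩ := Ideal.Quotient.mk_surjective x
  rw [actTorsor_mk, actBig_one, RingHom.id_apply]

theorem actTorsor_mul (g h : GL (Fin n) k) (x : TorsorRing k n) :
    actTorsor (g * h) x = actTorsor g (actTorsor h x) := by
  obtain ⟨x, rfl⟩ := Ideal.Quotient.mk_surjective x
  rw [actTorsor_mk, actTorsor_mk, actTorsor_mk, actBig_mul, RingHom.comp_apply]

/-- The action of `g` on relative `p`-forms: `b db₁ ∧ ⋯ ∧ db_p ↦ g(b) dg(b₁) ∧ ⋯ ∧ dg(b_p)`. -/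
def actForms (p : ℕ) (g : GL (Fin n) k) : Forms k n p →ₛₗ[actTorsor g] Forms k n p :=
  formsMap (S := BaseRing k n) (R := TorsorRing k n) p (actBase g).toRingHom (actTorsor g)
    (actTorsor_algebraMap g)

theorem actForms_ιMulti (p : ℕ) (g : GL (Fin n) k) (c : Fin p → TorsorRing k n) :
    actForms p g (exteriorPower.ιMulti _ p
        (fun i => KaehlerDifferential.D (BaseRing k n) (TorsorRing k n) (c i))) =
      exteriorPower.ιMulti _ p
        (fun i => KaehlerDifferential.D (BaseRing k n) (TorsorRing k n) (actTorsor g (c i))) :=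
  formsMap_ιMulti_D (S := BaseRing k n) (R := TorsorRing k n) p _ _ (actTorsor_algebraMap g) c

variable (k n) in
/-- The representation of `GLₙ` on the space `A^p` of relative `p`-forms on the Jouanolou
torsor. -/
def formsRep (p : ℕ) : Representation k (GL (Fin n) k) (Forms k n p) where
  toFun g :=
    { toFun := actForms p g
      map_add' := map_add _
      map_smul' := fun c x => by
        rw [← algebraMap_smul (TorsorRing k n) c x, map_smulₛₗ, actTorsor_scalar,
          algebraMap_smul, RingHom.id_apply] }
  map_one' := by
    ext1 x
    change actForms p 1 x = x
    induction x using forms_induction with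
    | zero => exact map_zero _
    | add x y hx hy => rw [map_add, hx, hy]
    | smul r x hx => rw [map_smulₛₗ, hx, actTorsor_one]
    | d b => simp only [actForms_ιMulti, actTorsor_one]
  map_mul' g h := by
    ext1 x
    change actForms p (g * h) x = actForms p g (actForms p h x)
    induction x using forms_induction with
    | zero => simp only [map_zero]
    | add x y hx hy => simp only [map_add, hx, hy]
    | smul r x hx => simp only [map_smulₛₗ, hx, actTorsor_mul]
    | d b => simp only [actForms_ιMulti, actTorsor_mul]

end Torsor

/-! ### Highest weights and the representations `Σ^α(V)` -/

section HighestWeight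

variable {k : Type*} [Field k] {n : ℕ}

/-- A representation of the group `GLₙ(k)` is algebraic (rational) if it is finite-dimensional and
its matrix coefficients are polynomials in the entries of `g` and `det(g)⁻¹`. -/
def IsRational {W : Type*} [AddCommGroup W] [Module k W]
    (ρ : Representation k (GL (Fin n) k) W) : Prop :=
  Module.Finite k W ∧ ∀ (w : W) (φ : Module.Dual k W),
    ∃ (P : MvPolynomial (Fin n × Fin n) k) (m : ℕ), ∀ g : GL (Fin n) k,
      φ (ρ g w) * g.1.det ^ m = MvPolynomial.eval (fun ij => g.1 ij.1 ij.2) P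

/-- `ρ` is an irreducible rational representation of `GLₙ` of highest weight `α`: it contains a
nonzero vector on which each upper triangular matrix `b` acts by the scalar `∏ b_ii ^ α_i`. -/
def IsIrreducibleOfHighestWeight {W : Type*} [AddCommGroup W] [Module k W]
    (ρ : Representation k (GL (Fin n) k) W) (α : Fin n → ℤ) : Prop :=
  ρ.IsIrreducible ∧ IsRational ρ ∧
    ∃ w : W, w ≠ 0 ∧ ∀ b : GL (Fin n) k, b.1.BlockTriangular id →
      ρ b w = (∏ i, b.1 i i ^ α i) • w

variable (k n) in
/-- The representation of `GLₙ(k)` on functions on `GLₙ(k)` by right translations. -/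
def functionsRep : Representation k (GL (Fin n) k) (GL (Fin n) k → k) where
  toFun g := LinearMap.funLeft k k (fun x => x * g)
  map_one' := by ext; simp
  map_mul' g h := by ext; simp [LinearMap.funLeft_apply, mul_assoc]

/-- The leading principal `m × m` minor of a matrix. -/
def leadingMinor (x : Matrix (Fin n) (Fin n) k) (m : ℕ) (hm : m ≤ n) : k :=
  (x.submatrix (Fin.castLE hm) (Fin.castLE hm)).det

/-- The function `∏ᵢ Δᵢ(x) ^ (αᵢ - αᵢ₊₁)` on `GLₙ(k)` (indices from `1` to `n`, and `αₙ₊₁ = 0`), where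
`Δᵢ` is the leading principal `i × i` minor. For dominant `α` only the exponent of `Δₙ = det` can be
negative, so that it is a regular function. -/
def highestWeightFunction (α : Fin n → ℤ) (x : GL (Fin n) k) : k :=
  ∏ i : Fin n, leadingMinor x.1 (i + 1) i.isLt ^
    (α i - if h : (i : ℕ) + 1 < n then α ⟨i + 1, h⟩ else 0)

variable (k) in
/-- The irreducible representation `Σ^α(V)` of `GLₙ = GL(V)`, `V = kⁿ`, of highest weight `α`, for a
dominant `α`: the space of functions on `GLₙ(k)` spanned by the right translates of
`∏ᵢ Δᵢ ^ (αᵢ - αᵢ₊₁)`. -/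
def schurSub (α : Fin n → ℤ) : Subrepresentation (functionsRep k n) where
  toSubmodule := Submodule.span k
    (Set.range fun g => functionsRep k n g (highestWeightFunction α))
  apply_mem_toSubmodule g v hv := by
    induction hv using Submodule.span_induction with
    | mem y hy =>
      obtain ⟨h, rfl⟩ := hy
      refine Submodule.subset_span ⟨g * h, ?_⟩
      change functionsRep k n (g * h) _ = functionsRep k n g (functionsRep k n h _)
      rw [map_mul]; rfl
    | zero => rw [map_zero]; exact zero_mem _
    | add y z _ _ hy hz => rw [map_add]; exact add_mem hy hz
    | smul r y _ hy => rw [map_smul]; exact Submodule.smul_mem _ r hy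

variable (k) in
/-- The underlying space of `Σ^α(V)`. -/
abbrev Schur (α : Fin n → ℤ) : Type _ := (schurSub k α).toSubmodule

variable (k) in
/-- The action of `GLₙ` on `Σ^α(V)`. -/
def schurRep (α : Fin n → ℤ) : Representation k (GL (Fin n) k) (Schur k α) :=
  (schurSub k α).toRepresentation

end HighestWeight

/-- The inequalities `α₁ ≥ 0 ≥ α₂ ≥ 0 ≥ ⋯ ≥ 0 ≥ αₙ₋ₚ ≥ -1 ≥ αₙ₋ₚ₊₁ ≥ -1 ≥ ⋯ ≥ -1 ≥ αₙ`: between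
consecutive entries stand `n - 1 - p` zeros followed by `p` entries `-1`. -/
def Interlaces {n : ℕ} (p : ℕ) (α : Fin n → ℤ) : Prop :=
  ∀ (i : ℕ) (hi : i + 1 < n),
    (if i + 1 < n - p then (0 : ℤ) else -1) ≤ α ⟨i, by omega⟩ ∧
      α ⟨i + 1, hi⟩ ≤ (if i + 1 < n - p then (0 : ℤ) else -1)

end Jouanolou

end

/-!
The space of relative `p`-forms is identified with a space of regular functions on `GLₙ(k)`, and
the question becomes the branching rule for the stabilizer of a point of the Jouanolou torsor.

*Forms as functions.* The group `GLₙ` acts transitively on the torsor `J`, a point of which is the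
first row of an invertible matrix `x` together with the first column of `x⁻¹`. The relative vector
fields `∂/∂z*ᵢ - zᵢ ∑ⱼ z*ⱼ ∂/∂z*ⱼ` embed the module of relative differentials as a direct summand
into a free module (`Frame`, `torsorFrame`), so that a form is determined by its contractions with
them. The contraction of a `p`-form, at the point given by `x`, with the last `p` columns of `x⁻¹`
is a function `formFun` of `x`. It is equivariant for right translations, regular, injective on
forms, and transforms under left translations by the lower triangular matrices that fix the base
point through a character, with exponents `0` and `-1`.

*Branching.* Let `f ≠ 0` be a regular function of weight `α` under right translations by upper
triangular matrices and of weight `β` under these left translations. The matrices `columnGL v` meet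
the two-sided orbits of the two groups in a dense set, and so do the matrices `rowGL w`. On either
family `f` is a monomial, with exponents `β j - α (j + 1)` and `α j - β j`. Since `f` is regular, the
exponents are nonnegative: `α` and `β` interlace (`interlaces_of_isStabilizerSemiinvariant`), and
this is the chain of inequalities of the theorem. Moreover `f` is determined by its value at
`columnGL 1`, so that highest weight vectors of the same weight are proportional
(`hasSimpleSpectrum_formsRep`). In the other direction, the products of powers of `z₁` and `z*ₙ` with
one of two explicit forms are highest weight vectors of all the weights that satisfy the
inequalities (`exists_highestWeight_of_interlaces`).

*Complete reducibility.* A space of regular functions that is stable under right translations by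
upper triangular matrices contains a highest weight vector (`exists_isHighestWeight`). As `Σ^α(V)` is
generated by its highest weight vector, the only one up to scalars, it is irreducible
(`schurRep_isIrreducible`). Let now `φ` be a functional on polynomials that vanishes on all two-sided
translates of the functions `∏ᵢ Δᵢ ^ (αᵢ - αᵢ₊₁)`. The polynomials `a ↦ φ ((∑ aᵢⱼ xᵢⱼ) ^ d)` attached
to such functionals form a space stable under two-sided translations. If it were nonzero, it would
contain one of the functions `∏ᵢ Δᵢ ^ (αᵢ - αᵢ₊₁)`, and the corresponding `φ` would take a positive
value on that function. This is the Peter–Weyl theorem `IsRegular.mem_translateSpan`. Hence the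
regular functions are a sum of left translates of the `Σ^α(V)`, and the space of forms, which embeds
into them, is semisimple, with one summand `Σ^α(V)` for each weight `α` of a highest weight vector
(`HasSimpleSpectrum.equiv_directSum`).
-/

noncomputable section

namespace Jouanolou

/-! ### Regular functions on `GLₙ(k)` -/

section Regular

open MvPolynomial

variable {k : Type*} [Field k] {n : ℕ}

/-- The polynomial `P` in the entries of an `n × n` matrix, evaluated at the matrix `x`. -/
def evalAt (x : Matrix (Fin n) (Fin n) k) : MvPolynomial (Fin n × Fin n) k →+* k :=
  eval fun ij => x ij.1 ij.2

@[simp] theorem evalAt_X (x : Matrix (Fin n) (Fin n) k) (ij : Fin n × Fin n) :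
    evalAt x (X ij) = x ij.1 ij.2 := by simp [evalAt]

@[simp] theorem evalAt_C (x : Matrix (Fin n) (Fin n) k) (c : k) : evalAt x (C c) = c := by
  simp [evalAt]

/-- A function on `GLₙ(k)` is regular if it is a polynomial in the entries divided by a power of
the determinant. -/
def IsRegular (f : GL (Fin n) k → k) : Prop :=
  ∃ (P : MvPolynomial (Fin n × Fin n) k) (m : ℕ), ∀ x, f x * x.1.det ^ m = evalAt x.1 P

/-- The determinant, as a polynomial in the entries. -/
def detPoly (k : Type*) [Field k] (n : ℕ) : MvPolynomial (Fin n × Fin n) k :=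
  (Matrix.mvPolynomialX (Fin n) (Fin n) k).det

theorem evalAt_detPoly (x : Matrix (Fin n) (Fin n) k) : evalAt x (detPoly k n) = x.det := by
  rw [detPoly, RingHom.map_det]
  congr 1
  ext i j
  simp [Matrix.mvPolynomialX]

theorem IsRegular.exists_ge {f : GL (Fin n) k → k} (hf : IsRegular f) :
    ∃ m₀ : ℕ, ∀ m, m₀ ≤ m → ∃ P : MvPolynomial (Fin n × Fin n) k,
      ∀ x, f x * x.1.det ^ m = evalAt x.1 P := by
  obtain ⟨P, m₀, h⟩ := hf
  refine ⟨m₀, fun m hm => ⟨P * detPoly k n ^ (m - m₀), fun x => ?_⟩⟩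
  rw [map_mul, map_pow, evalAt_detPoly, ← h, mul_assoc, ← pow_add, Nat.add_sub_cancel' hm]

theorem isRegular_evalAt (P : MvPolynomial (Fin n × Fin n) k) :
    IsRegular fun x : GL (Fin n) k => evalAt x.1 P := ⟨P, 0, fun x => by simp⟩

theorem isRegular_const (c : k) : IsRegular fun _ : GL (Fin n) k => c := ⟨C c, 0, by simp⟩

theorem IsRegular.add {f g : GL (Fin n) k → k} (hf : IsRegular f) (hg : IsRegular g) :
    IsRegular (f + g) := by
  obtain ⟨a, ha⟩ := hf.exists_ge
  obtain ⟨b, hb⟩ := hg.exists_ge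
  obtain ⟨P, hP⟩ := ha (a + b) (by omega)
  obtain ⟨Q, hQ⟩ := hb (a + b) (by omega)
  exact ⟨P + Q, a + b, fun x => by rw [map_add, ← hP, ← hQ, Pi.add_apply, add_mul]⟩

theorem IsRegular.mul {f g : GL (Fin n) k → k} (hf : IsRegular f) (hg : IsRegular g) :
    IsRegular (f * g) := by
  obtain ⟨P, a, hP⟩ := hf
  obtain ⟨Q, b, hQ⟩ := hg
  exact ⟨P * Q, a + b, fun x => by rw [map_mul, ← hP, ← hQ, Pi.mul_apply, pow_add]; ring⟩

theorem IsRegular.sum {ι : Type*} (s : Finset ι) {f : ι → GL (Fin n) k → k}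
    (hf : ∀ i ∈ s, IsRegular (f i)) : IsRegular (∑ i ∈ s, f i) := by
  classical
  induction s using Finset.induction_on with
  | empty => exact isRegular_const 0
  | insert a s ha ih =>
    rw [Finset.sum_insert ha]
    exact (hf a (by simp)).add (ih fun i hi => hf i (by simp [hi]))

theorem IsRegular.prod {ι : Type*} (s : Finset ι) {f : ι → GL (Fin n) k → k}
    (hf : ∀ i ∈ s, IsRegular (f i)) : IsRegular (∏ i ∈ s, f i) := by
  classical
  induction s using Finset.induction_on with
  | empty => exact isRegular_const 1
  | insert a s ha ih =>
    rw [Finset.prod_insert ha]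
    exact (hf a (by simp)).mul (ih fun i hi => hf i (by simp [hi]))

theorem isRegular_det_zpow (m : ℤ) : IsRegular fun x : GL (Fin n) k => x.1.det ^ m := by
  obtain ⟨a, rfl | rfl⟩ := m.eq_nat_or_neg
  · exact ⟨detPoly k n ^ a, 0, fun x => by simp [evalAt_detPoly]⟩
  · refine ⟨1, a, fun x => ?_⟩
    have : x.1.det ≠ 0 := x.det_ne_zero
    simp [this]

theorem isRegular_entry (i j : Fin n) : IsRegular fun x : GL (Fin n) k => x.1 i j := by
  simpa using isRegular_evalAt (X (i, j) : MvPolynomial (Fin n × Fin n) k)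

theorem isRegular_inv_entry (i j : Fin n) : IsRegular fun x : GL (Fin n) k => (x⁻¹).1 i j := by
  have h : (fun x : GL (Fin n) k => (x⁻¹).1 i j) =
      (fun x => x.1.det ^ (-1 : ℤ)) * fun x => x.1.adjugate i j := by
    funext x
    simp [Matrix.coe_units_inv, Matrix.inv_def]
  rw [h]
  refine (isRegular_det_zpow _).mul ⟨(Matrix.mvPolynomialX (Fin n) (Fin n) k).adjugate i j, 0,
    fun x => ?_⟩
  have e : x.1 = (evalAt x.1).mapMatrix (Matrix.mvPolynomialX (Fin n) (Fin n) k) := by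
    ext i j
    simp [Matrix.mvPolynomialX]
  have h2 := congrFun₂ (RingHom.map_adjugate (evalAt x.1)
    (Matrix.mvPolynomialX (Fin n) (Fin n) k)) i j
  rw [← e] at h2
  simpa using h2.symm

/-- The polynomial `P` along the line `a + s b`. -/
theorem exists_eval_line {σ : Type*} (P : MvPolynomial σ k) (a b : σ → k) :
    ∃ p : Polynomial k, ∀ s, p.eval s = eval (fun i => a i + s * b i) P := by
  refine ⟨aeval (fun i => Polynomial.C (a i) + Polynomial.X * Polynomial.C (b i)) P, fun s => ?_⟩
  rw [← Polynomial.coe_evalRingHom, aeval_def, MvPolynomial.hom_eval₂]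
  have : (Polynomial.evalRingHom s).comp (algebraMap k (Polynomial k)) = RingHom.id k := by
    ext c; simp
  rw [this]
  change eval _ P = _
  congr 2
  funext i
  simp [mul_comm s]

theorem finite_det_add_smul_one (x : Matrix (Fin n) (Fin n) k) :
    {s : k | (x + s • (1 : Matrix (Fin n) (Fin n) k)).det = 0}.Finite := by
  refine ((-x).charpoly.rootSet_finite k).subset fun s hs => ?_
  rw [Polynomial.mem_rootSet]
  refine ⟨(Matrix.charpoly_monic _).ne_zero, ?_⟩
  rw [Polynomial.coe_aeval_eq_eval, Matrix.eval_charpoly, ← hs]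
  congr 1
  ext i j
  by_cases h : i = j <;> simp [h, add_comm]

variable [CharZero k]

theorem eq_zero_of_finite_ne_zero {p : Polynomial k} (h : {s | p.eval s ≠ 0}.Finite) : p = 0 := by
  refine Polynomial.eq_zero_of_infinite_isRoot p ?_
  have := h.infinite_compl
  refine this.mono fun s hs => ?_
  simpa using hs

/-- A polynomial is determined by its values on a set of matrices that contains `x + s` for almost
all `s`, whatever `x`. -/
theorem eq_zero_of_evalAt_eq_zero {P : MvPolynomial (Fin n × Fin n) k}
    (h : ∀ x : Matrix (Fin n) (Fin n) k,
      {s : k | evalAt (x + s • (1 : Matrix (Fin n) (Fin n) k)) P ≠ 0}.Finite) : P = 0 := by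
  refine MvPolynomial.funext fun a => ?_
  obtain ⟨p, hp⟩ := exists_eval_line P a fun ij => (1 : Matrix (Fin n) (Fin n) k) ij.1 ij.2
  have hp0 : p = 0 := eq_zero_of_finite_ne_zero <| by
    refine (h fun i j => a (i, j)).subset fun s hs => ?_
    rw [Set.mem_ofPred_eq, hp] at hs
    exact hs
  have := hp 0
  simpa [hp0] using this.symm

theorem eq_zero_of_evalAt_GL {P : MvPolynomial (Fin n × Fin n) k}
    (h : ∀ x : GL (Fin n) k, evalAt x.1 P = 0) : P = 0 :=
  eq_zero_of_evalAt_eq_zero fun x => (finite_det_add_smul_one x).subset fun s hs => by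
    by_contra h0
    exact hs (h (Matrix.GeneralLinearGroup.mkOfDetNeZero _ h0))

/-! ### The big cell -/

/-- The product of a lower triangular and an upper triangular invertible matrix. -/
def HasLU {n : ℕ} (x : Matrix (Fin n) (Fin n) k) : Prop :=
  ∃ l u : Matrix (Fin n) (Fin n) k, l.BlockTriangular OrderDual.toDual ∧ u.BlockTriangular id ∧
    l.det ≠ 0 ∧ u.det ≠ 0 ∧ x = l * u

omit [CharZero k] in
/-- One step of Gaussian elimination: if the upper left block has an LU decomposition, so does the
whole invertible matrix. -/
theorem hasLU_of_castSucc {x : Matrix (Fin (n + 1)) (Fin (n + 1)) k} (hx : x.det ≠ 0)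
    (h : HasLU (x.submatrix Fin.castSucc Fin.castSucc)) : HasLU x := by
  obtain ⟨l, u, hl, hu, dl, du, e⟩ := h
  have il : IsUnit l.det := isUnit_iff_ne_zero.2 dl
  have iu : IsUnit u.det := isUnit_iff_ne_zero.2 du
  set c : Fin n → k := fun j => x (Fin.last n) j.castSucc
  set b : Fin n → k := fun i => x i.castSucc (Fin.last n)
  set c' := Matrix.vecMul c u⁻¹ with hc'
  set b' := Matrix.mulVec l⁻¹ b with hb'
  let L : Matrix (Fin (n + 1)) (Fin (n + 1)) k :=
    Fin.snoc (α := fun _ => Fin (n + 1) → k) (fun i => Fin.snoc (α := fun _ => k) (l i) 0)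
      (Fin.snoc (α := fun _ => k) c' 1)
  let U : Matrix (Fin (n + 1)) (Fin (n + 1)) k :=
    Fin.snoc (α := fun _ => Fin (n + 1) → k) (fun i => Fin.snoc (α := fun _ => k) (u i) (b' i))
      (Fin.snoc (α := fun _ => k) 0 (x (Fin.last n) (Fin.last n) - ∑ i, c' i * b' i))
  have hL : L.BlockTriangular OrderDual.toDual := by
    intro i j
    refine Fin.lastCases ?_ (fun i => ?_) i <;> refine Fin.lastCases ?_ (fun j => ?_) j
    · simp
    · simp [(Fin.castSucc_lt_last j).not_gt]
    · simp [L]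
    · intro hij
      have : l i j = 0 := hl (by simpa using hij)
      simpa [L] using this
  have hU : U.BlockTriangular id := by
    intro i j
    refine Fin.lastCases ?_ (fun i => ?_) i <;> refine Fin.lastCases ?_ (fun j => ?_) j
    · simp
    · simp [U]
    · simp [(Fin.castSucc_lt_last i).not_gt]
    · intro hij
      have : u i j = 0 := hu (by simpa using hij)
      simpa [U] using this
  have hLU : x = L * U := by
    have e1 : ∀ i j, x (Fin.castSucc i) (Fin.castSucc j) = ∑ m, l i m * u m j := fun i j => by
      rw [← Matrix.mul_apply, ← e]; rfl
    have e2 : ∀ j, c j = ∑ m, c' m * u m j := fun j => by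
      change c j = Matrix.vecMul c' u j
      rw [hc', Matrix.vecMul_vecMul, Matrix.nonsing_inv_mul _ iu, Matrix.vecMul_one]
    have e3 : ∀ i, b i = ∑ m, l i m * b' m := fun i => by
      change b i = Matrix.mulVec l b' i
      rw [hb', Matrix.mulVec_mulVec, Matrix.mul_nonsing_inv _ il, Matrix.one_mulVec]
    ext i j
    rw [Matrix.mul_apply, Fin.sum_univ_castSucc]
    refine Fin.lastCases ?_ (fun i => ?_) i <;> refine Fin.lastCases ?_ (fun j => ?_) j
    · simp [L, U]
    · simpa [L, U] using e2 j
    · simpa [L, U] using e3 i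
    · simpa [L, U] using e1 i j
  have hd : L.det * U.det ≠ 0 := by rwa [← Matrix.det_mul, ← hLU]
  exact ⟨L, U, hL, hU, left_ne_zero_of_mul hd, right_ne_zero_of_mul hd, hLU⟩

omit [CharZero k] in
/-- Every matrix lies in the big cell after adding almost any scalar. -/
theorem finite_not_hasLU : ∀ {n : ℕ} (x : Matrix (Fin n) (Fin n) k),
    {s : k | ¬ HasLU (x + s • (1 : Matrix (Fin n) (Fin n) k))}.Finite
  | 0, x => by
    convert Set.finite_empty
    refine Set.eq_empty_of_forall_notMem fun s hs => hs ⟨1, 1, ?_⟩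
    simp only [Matrix.det_one, ne_eq, one_ne_zero, not_false_eq_true, true_and]
    exact ⟨fun i => i.elim0, fun i => i.elim0, Subsingleton.elim _ _⟩
  | n + 1, x => by
    refine ((finite_not_hasLU (x.submatrix Fin.castSucc Fin.castSucc)).union
      (finite_det_add_smul_one x)).subset fun s hs => ?_
    by_contra hc
    simp only [Set.mem_union, Set.mem_ofPred_eq, not_or, not_not] at hc
    refine hs (hasLU_of_castSucc hc.2 ?_)
    convert hc.1
    ext i j
    simp [Matrix.one_apply]

/-- The big cell is dense: a regular function that vanishes on it is zero. -/
theorem IsRegular.eq_zero_of_bigCell {f : GL (Fin n) k → k} (hf : IsRegular f)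
    (h : ∀ l u : GL (Fin n) k, l.1.BlockTriangular OrderDual.toDual → u.1.BlockTriangular id →
      f (l * u) = 0) : f = 0 := by
  obtain ⟨P, m, hP⟩ := hf
  have hP0 : P = 0 := eq_zero_of_evalAt_eq_zero fun x => (finite_not_hasLU x).subset fun s hs hc => by
    obtain ⟨l, u, hl, hu, dl, du, e⟩ := hc
    refine hs ?_
    have := hP (Matrix.GeneralLinearGroup.mkOfDetNeZero l dl *
      Matrix.GeneralLinearGroup.mkOfDetNeZero u du)
    rw [h _ _ hl hu, zero_mul] at this
    rw [e, this]
    rfl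
  funext x
  have := hP x
  rw [hP0, map_zero] at this
  exact (mul_eq_zero.1 this).resolve_right (pow_ne_zero _ x.det_ne_zero)

end Regular

/-! ### The functions `∏ᵢ Δᵢ ^ (αᵢ - αᵢ₊₁)` -/

section HighestWeightFunction

variable {k : Type*} [Field k] {n : ℕ}

theorem GL_diag_ne_zero_of_upper (b : GL (Fin n) k) (hb : b.1.BlockTriangular id) (i : Fin n) :
    b.1 i i ≠ 0 := by
  have h := b.det_ne_zero
  rw [Matrix.det_of_isUpperTriangular hb] at h
  exact Finset.prod_ne_zero_iff.1 h i (Finset.mem_univ i)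

theorem GL_diag_ne_zero_of_lower (b : GL (Fin n) k) (hb : b.1.BlockTriangular OrderDual.toDual)
    (i : Fin n) : b.1 i i ≠ 0 := by
  have h := b.det_ne_zero
  rw [Matrix.det_of_isLowerTriangular _ hb] at h
  exact Finset.prod_ne_zero_iff.1 h i (Finset.mem_univ i)

theorem leadingMinor_upper (b : Matrix (Fin n) (Fin n) k) (hb : b.BlockTriangular id)
    (m : ℕ) (hm : m ≤ n) : leadingMinor b m hm = ∏ i : Fin m, b (Fin.castLE hm i) (Fin.castLE hm i) :=
  Matrix.det_of_isUpperTriangular (M := b.submatrix (Fin.castLE hm) (Fin.castLE hm))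
    fun i j hij => hb (by simpa using hij)

theorem leadingMinor_lower (b : Matrix (Fin n) (Fin n) k)
    (hb : b.BlockTriangular OrderDual.toDual) (m : ℕ) (hm : m ≤ n) :
    leadingMinor b m hm = ∏ i : Fin m, b (Fin.castLE hm i) (Fin.castLE hm i) :=
  Matrix.det_of_isLowerTriangular (b.submatrix (Fin.castLE hm) (Fin.castLE hm))
    fun i j hij => hb (by simpa using hij)

theorem leadingMinor_mul_upper (x b : Matrix (Fin n) (Fin n) k) (hb : b.BlockTriangular id)
    (m : ℕ) (hm : m ≤ n) :
    leadingMinor (x * b) m hm = leadingMinor x m hm * leadingMinor b m hm := by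
  rw [leadingMinor, leadingMinor, leadingMinor, ← Matrix.det_mul]
  congr 1
  ext i j
  rw [Matrix.submatrix_apply, Matrix.mul_apply, Matrix.mul_apply]
  refine (Fintype.sum_of_injective (Fin.castLE hm) (Fin.castLE_injective hm) _ _ (fun l hl => ?_)
    fun l => rfl).symm
  rw [hb (i := l) (j := Fin.castLE hm j), mul_zero]
  by_contra hc
  simp only [id, not_lt] at hc
  exact hl ⟨⟨l, lt_of_le_of_lt (Fin.le_def.1 hc) j.2⟩, rfl⟩

theorem leadingMinor_lower_mul (b x : Matrix (Fin n) (Fin n) k)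
    (hb : b.BlockTriangular OrderDual.toDual) (m : ℕ) (hm : m ≤ n) :
    leadingMinor (b * x) m hm = leadingMinor b m hm * leadingMinor x m hm := by
  rw [leadingMinor, leadingMinor, leadingMinor, ← Matrix.det_mul]
  congr 1
  ext i j
  rw [Matrix.submatrix_apply, Matrix.mul_apply, Matrix.mul_apply]
  refine (Fintype.sum_of_injective (Fin.castLE hm) (Fin.castLE_injective hm) _ _ (fun l hl => ?_)
    fun l => rfl).symm
  rw [hb (i := Fin.castLE hm i) (j := l), zero_mul]
  by_contra hc
  simp only [OrderDual.toDual_lt_toDual, not_lt] at hc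
  exact hl ⟨⟨l, lt_of_le_of_lt (Fin.le_def.1 hc) i.2⟩, rfl⟩

/-- The exponent `αᵢ - αᵢ₊₁` of `Δᵢ`, where `αₙ₊₁ = 0`. -/
def weightStep (α : Fin n → ℤ) (i : Fin n) : ℤ :=
  α i - if h : (i : ℕ) + 1 < n then α ⟨i + 1, h⟩ else 0

theorem sum_weightStep (α : Fin n → ℤ) (j : Fin n) :
    ∑ i, (if j ≤ i then weightStep α i else 0) = α j := by
  let a : ℕ → ℤ := fun i => if h : i < n then α ⟨i, h⟩ else 0
  let d : ℕ → ℤ := fun i => if (j : ℕ) ≤ i then a i - a (i + 1) else 0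
  have h0 : ∀ i : Fin n, a i = α i := fun i => dif_pos i.2
  have h1 : ∀ i : Fin n, (if j ≤ i then weightStep α i else 0) = d i := fun i => by
    change _ = if (j : ℕ) ≤ i then a i - a (i + 1) else 0
    rw [h0]
    rfl
  rw [Finset.sum_congr rfl fun i _ => h1 i, Fin.sum_univ_eq_sum_range d, ← Finset.sum_filter]
  have h2 : (Finset.range n).filter (fun i => (j : ℕ) ≤ i) = Finset.Ico (j : ℕ) n := by
    ext i; simp [and_comm]
  rw [h2, Finset.sum_congr rfl fun i _ => (neg_sub (a (i + 1)) (a i)).symm,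
    Finset.sum_neg_distrib, Finset.sum_Ico_sub _ j.2.le, h0]
  simp [a]

theorem prod_prod_zpow_weightStep (α : Fin n → ℤ) (t : Fin n → k) (ht : ∀ i, t i ≠ 0) :
    ∏ i : Fin n, (∏ j : Fin (i + 1), t (Fin.castLE i.isLt j)) ^ weightStep α i =
      ∏ j, t j ^ α j := by
  have h1 : ∀ i : Fin n, ∏ j : Fin (i + 1), t (Fin.castLE i.isLt j) =
      ∏ j, if j ≤ i then t j else 1 := fun i => by
    refine Fintype.prod_of_injective (Fin.castLE i.isLt) (Fin.castLE_injective _) _ _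
      (fun j hj => if_neg fun hc => hj ⟨⟨j, Nat.lt_succ_of_le hc⟩, rfl⟩) fun j => ?_
    rw [if_pos]
    exact Nat.le_of_lt_succ j.2
  simp only [h1, ← Finset.prod_zpow]
  rw [Finset.prod_comm]
  refine Finset.prod_congr rfl fun j _ => ?_
  rw [← sum_weightStep α j]
  have h2 : ∀ s : Finset (Fin n), ∏ i ∈ s, (if j ≤ i then t j else 1) ^ weightStep α i =
      t j ^ ∑ i ∈ s, (if j ≤ i then weightStep α i else 0) := fun s => by
    induction s using Finset.induction_on with
    | empty => simp
    | insert a s ha ih =>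
      rw [Finset.prod_insert ha, Finset.sum_insert ha, zpow_add₀ (ht j), ih]
      split_ifs <;> simp
  exact h2 _

theorem highestWeightFunction_eq (α : Fin n → ℤ) (x : GL (Fin n) k) :
    highestWeightFunction α x =
      ∏ i : Fin n, leadingMinor x.1 (i + 1) i.isLt ^ weightStep α i := rfl

theorem highestWeightFunction_mul_upper (α : Fin n → ℤ) (x b : GL (Fin n) k)
    (hb : b.1.BlockTriangular id) :
    highestWeightFunction α (x * b) = (∏ i, b.1 i i ^ α i) * highestWeightFunction α x := by
  simp only [highestWeightFunction_eq, Units.val_mul, leadingMinor_mul_upper _ _ hb, mul_zpow,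
    Finset.prod_mul_distrib, leadingMinor_upper _ hb]
  rw [prod_prod_zpow_weightStep α (fun i => b.1 i i) (GL_diag_ne_zero_of_upper b hb), mul_comm]

theorem highestWeightFunction_lower_mul (α : Fin n → ℤ) (b x : GL (Fin n) k)
    (hb : b.1.BlockTriangular OrderDual.toDual) :
    highestWeightFunction α (b * x) = (∏ i, b.1 i i ^ α i) * highestWeightFunction α x := by
  simp only [highestWeightFunction_eq, Units.val_mul, leadingMinor_lower_mul _ _ hb, mul_zpow,
    Finset.prod_mul_distrib, leadingMinor_lower _ hb]
  rw [prod_prod_zpow_weightStep α (fun i => b.1 i i) (GL_diag_ne_zero_of_lower b hb)]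

theorem highestWeightFunction_one (α : Fin n → ℤ) :
    highestWeightFunction α (1 : GL (Fin n) k) = 1 := by
  have h : ∀ m (hm : m ≤ n), leadingMinor (1 : Matrix (Fin n) (Fin n) k) m hm = 1 := fun m hm => by
    rw [leadingMinor_upper _ Matrix.blockTriangular_one]
    simp
  simp [highestWeightFunction_eq, h]

/-- The leading principal minor, as a polynomial with integer coefficients. -/
def minorPoly (n m : ℕ) (hm : m ≤ n) : MvPolynomial (Fin n × Fin n) ℤ :=
  ((Matrix.mvPolynomialX (Fin n) (Fin n) ℤ).submatrix (Fin.castLE hm) (Fin.castLE hm)).det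

theorem evalAt_minorPoly (x : Matrix (Fin n) (Fin n) k) (m : ℕ) (hm : m ≤ n) :
    evalAt x (MvPolynomial.map (Int.castRingHom k) (minorPoly n m hm)) = leadingMinor x m hm := by
  rw [minorPoly, RingHom.map_det, RingHom.map_det, leadingMinor]
  congr 1
  ext i j
  simp [Matrix.mvPolynomialX]

theorem isRegular_leadingMinor (m : ℕ) (hm : m ≤ n) :
    IsRegular fun x : GL (Fin n) k => leadingMinor x.1 m hm := by
  simpa only [evalAt_minorPoly] using isRegular_evalAt (n := n)
    (MvPolynomial.map (Int.castRingHom k) (minorPoly n m hm))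

theorem leadingMinor_self (x : Matrix (Fin n) (Fin n) k) : leadingMinor x n le_rfl = x.det := rfl

theorem weightStep_nonneg {α : Fin n → ℤ} (hα : Antitone α) (i : Fin n) (hi : (i : ℕ) + 1 < n) :
    0 ≤ weightStep α i := by
  rw [weightStep, dif_pos hi, sub_nonneg]
  exact hα (Fin.le_def.2 (Nat.le_succ _))

theorem isRegular_highestWeightFunction {α : Fin n → ℤ} (hα : Antitone α) :
    IsRegular (highestWeightFunction α : GL (Fin n) k → k) := by
  have h : (highestWeightFunction α : GL (Fin n) k → k) =
      ∏ i : Fin n, fun x => leadingMinor x.1 (i + 1) i.isLt ^ weightStep α i := by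
    funext x
    simp [highestWeightFunction_eq]
  rw [h]
  refine IsRegular.prod _ fun i _ => ?_
  by_cases hi : (i : ℕ) + 1 < n
  · obtain ⟨a, ha⟩ := Int.eq_ofNat_of_zero_le (weightStep_nonneg hα i hi)
    obtain ⟨P, m, hP⟩ := isRegular_leadingMinor (k := k) ((i : ℕ) + 1) i.isLt
    refine ⟨P ^ a, m * a, fun x => ?_⟩
    simp only [ha, zpow_natCast, map_pow, ← hP, mul_pow, pow_mul]
  · have hn : (i : ℕ) + 1 = n := le_antisymm i.isLt (not_lt.1 hi)
    convert isRegular_det_zpow (k := k) (n := n) (weightStep α i) using 3 with x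
    rw [← leadingMinor_self]
    congr

/-- For nonnegative dominant `α`, the function `∏ᵢ Δᵢ ^ (αᵢ - αᵢ₊₁)` as a polynomial with integer
coefficients. -/
def highestWeightPoly (α : Fin n → ℤ) : MvPolynomial (Fin n × Fin n) ℤ :=
  ∏ i : Fin n, minorPoly n (i + 1) i.isLt ^ (weightStep α i).toNat

theorem evalAt_highestWeightPoly {α : Fin n → ℤ} (hα : Antitone α) (h0 : ∀ i, 0 ≤ α i)
    (x : GL (Fin n) k) :
    evalAt x.1 (MvPolynomial.map (Int.castRingHom k) (highestWeightPoly α)) =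
      highestWeightFunction α x := by
  rw [highestWeightPoly, map_prod, map_prod, highestWeightFunction_eq]
  refine Finset.prod_congr rfl fun i _ => ?_
  rw [map_pow, map_pow, evalAt_minorPoly, ← zpow_natCast, Int.toNat_of_nonneg]
  by_cases hi : (i : ℕ) + 1 < n
  · exact weightStep_nonneg hα i hi
  · rw [weightStep, dif_neg hi, sub_zero]
    exact h0 i

theorem highestWeightFunction_add_const (α : Fin n → ℤ) (m : ℤ) (x : GL (Fin n) k) :
    highestWeightFunction (fun i => α i + m) x = x.1.det ^ m * highestWeightFunction α x := by
  rcases Nat.eq_zero_or_pos n with rfl | hn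
  · simp [highestWeightFunction_eq]
  set l : Fin n := ⟨n - 1, by omega⟩
  have h : ∀ i : Fin n, weightStep (fun i => α i + m) i =
      weightStep α i + if i = l then m else 0 := fun i => by
    simp only [weightStep, Fin.ext_iff, l]
    split_ifs <;> omega
  have hd : ∀ i : Fin n, leadingMinor x.1 (i + 1) i.isLt ^ weightStep (fun i => α i + m) i =
      (if i = l then x.1.det ^ m else 1) * leadingMinor x.1 (i + 1) i.isLt ^ weightStep α i :=
    fun i => by
    rw [h]
    split_ifs with hi
    · have e : leadingMinor x.1 (i + 1) i.isLt = x.1.det := by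
        have : (i : ℕ) + 1 = n := by rw [hi]; simp [l]; omega
        rw [← leadingMinor_self]
        congr
      rw [e, zpow_add₀ x.det_ne_zero, mul_comm]
    · simp
  simp only [highestWeightFunction_eq, hd, Finset.prod_mul_distrib]
  simp

end HighestWeightFunction

/-! ### Existence of highest weight vectors -/

section HighestWeightVectors

open MvPolynomial

variable {k : Type*} [Field k] {n : ℕ}

/-- The right translate `x ↦ P(xg)` of a polynomial in the entries of a matrix. -/
def rightTranslate (g : Matrix (Fin n) (Fin n) k) :
    MvPolynomial (Fin n × Fin n) k →ₐ[k] MvPolynomial (Fin n × Fin n) k :=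
  aeval fun ij => ∑ l, X (ij.1, l) * C (g l ij.2)

theorem evalAt_rightTranslate (x g : Matrix (Fin n) (Fin n) k)
    (P : MvPolynomial (Fin n × Fin n) k) : evalAt x (rightTranslate g P) = evalAt (x * g) P := by
  have : (evalAt x).comp (rightTranslate g).toRingHom = evalAt (x * g) := by
    refine MvPolynomial.ringHom_ext (fun c => ?_) fun ij => ?_
    · simp [rightTranslate]
    · simp [rightTranslate, Matrix.mul_apply]
  exact RingHom.congr_fun this P

/-- The weight of a monomial for the right action of the diagonal matrices: its degrees in the
columns. -/
def colWeight : (Fin n × Fin n →₀ ℕ) →+ (Fin n →₀ ℕ) :=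
  Finsupp.weight fun ij => Finsupp.single ij.2 1

/-- The height `∑ j λ_j` of a weight. Right translation by upper triangular matrices does not
increase it. -/
def height : (Fin n →₀ ℕ) →+ ℕ := Finsupp.weight fun j : Fin n => (j : ℕ)

theorem colWeight_single (ij : Fin n × Fin n) :
    colWeight (Finsupp.single ij 1) = Finsupp.single ij.2 1 := by
  simp [colWeight, Finsupp.weight_single]

theorem height_single (j : Fin n) : height (Finsupp.single j 1) = (j : ℕ) := by
  simp [height, Finsupp.weight_single]

/-- The polynomials all of whose monomials have height less than `h`. -/
def heightLT (k : Type*) [Field k] (n h : ℕ) : Submodule k (MvPolynomial (Fin n × Fin n) k) where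
  carrier := {Q | ∀ m, coeff m Q ≠ 0 → height (colWeight m) < h}
  zero_mem' m hm := by simp at hm
  add_mem' {P Q} hP hQ m hm := by
    by_cases h0 : coeff m P = 0
    · exact hQ m (by simpa [h0] using hm)
    · exact hP m h0
  smul_mem' c Q hQ m hm := hQ m (by simp at hm; exact hm.2)

theorem heightLT_mul {a b : ℕ} {P Q : MvPolynomial (Fin n × Fin n) k}
    (hP : P ∈ heightLT k n (a + 1)) (hQ : Q ∈ heightLT k n b) : P * Q ∈ heightLT k n (a + b) := by
  classical
  intro m hm
  rw [coeff_mul] at hm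
  obtain ⟨⟨u, v⟩, huv, h⟩ := Finset.exists_ne_zero_of_sum_ne_zero hm
  have h1 := hP u (left_ne_zero_of_mul h)
  have h2 := hQ v (right_ne_zero_of_mul h)
  rw [← Finset.HasAntidiagonal.mem_antidiagonal.1 huv, map_add, map_add]
  simp only at h1 h2 ⊢
  omega

theorem monomial_mem_heightLT {m : Fin n × Fin n →₀ ℕ} {c : k} {h : ℕ}
    (hm : height (colWeight m) < h) : monomial m c ∈ heightLT k n h := by
  classical
  intro m' hm'
  rw [coeff_monomial] at hm'
  split_ifs at hm' with e
  · rwa [← e]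
  · exact absurd rfl hm'

theorem heightLT_mono {a b : ℕ} (h : a ≤ b) : heightLT k n a ≤ heightLT k n b :=
  fun _ hQ m hm => (hQ m hm).trans_le h

/-- An upper triangular matrix multiplies a monomial by its weight, up to monomials of smaller
height. -/
theorem rightTranslate_monomial_sub_mem (g : Matrix (Fin n) (Fin n) k)
    (hg : g.BlockTriangular id) (m : Fin n × Fin n →₀ ℕ) :
    rightTranslate g (monomial m 1) - C (∏ j, g j j ^ colWeight m j) * monomial m 1 ∈
      heightLT k n (height (colWeight m)) := by
  -- the claim is multiplicative, so that it suffices to check it for the variables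
  have key : ∀ m₁ m₂ : Fin n × Fin n →₀ ℕ,
      rightTranslate g (monomial m₁ 1) - C (∏ j, g j j ^ colWeight m₁ j) * monomial m₁ 1 ∈
        heightLT k n (height (colWeight m₁)) →
      rightTranslate g (monomial m₂ 1) - C (∏ j, g j j ^ colWeight m₂ j) * monomial m₂ 1 ∈
        heightLT k n (height (colWeight m₂)) →
      rightTranslate g (monomial (m₁ + m₂) 1) -
          C (∏ j, g j j ^ colWeight (m₁ + m₂) j) * monomial (m₁ + m₂) 1 ∈
        heightLT k n (height (colWeight (m₁ + m₂))) := fun m₁ m₂ h₁ h₂ => by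
    set c₁ := ∏ j, g j j ^ colWeight m₁ j
    set c₂ := ∏ j, g j j ^ colWeight m₂ j
    set A : MvPolynomial (Fin n × Fin n) k := monomial m₁ 1
    set B : MvPolynomial (Fin n × Fin n) k := monomial m₂ 1
    have hA : C c₁ * A ∈ heightLT k n (height (colWeight m₁) + 1) := by
      rw [C_mul']
      exact Submodule.smul_mem _ _ (monomial_mem_heightLT (Nat.lt_succ_self _))
    have hB : rightTranslate g B ∈ heightLT k n (height (colWeight m₂) + 1) := by
      rw [← sub_add_cancel (rightTranslate g B) (C c₂ * B)]
      refine add_mem (heightLT_mono (Nat.le_succ _) h₂) ?_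
      rw [C_mul']
      exact Submodule.smul_mem _ _ (monomial_mem_heightLT (Nat.lt_succ_self _))
    have hAB : (monomial (m₁ + m₂) 1 : MvPolynomial (Fin n × Fin n) k) = A * B := by
      rw [monomial_mul, one_mul]
    have hc : ∏ j, g j j ^ colWeight (m₁ + m₂) j = c₁ * c₂ := by
      simp only [map_add, Finsupp.add_apply, pow_add, Finset.prod_mul_distrib, c₁, c₂]
    rw [hAB, hc, map_mul, map_mul, map_add, map_add]
    have e : rightTranslate g A * rightTranslate g B - C c₁ * C c₂ * (A * B) =
        rightTranslate g B * (rightTranslate g A - C c₁ * A) +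
          C c₁ * A * (rightTranslate g B - C c₂ * B) := by ring
    rw [e]
    refine add_mem ?_ (heightLT_mul hA h₂)
    rw [add_comm]
    exact heightLT_mul hB h₁
  induction m using Finsupp.induction_linear with
  | zero => simp
  | add m₁ m₂ h₁ h₂ => exact key m₁ m₂ h₁ h₂
  | single ij e =>
    induction e with
    | zero => simp
    | succ e ih =>
      rw [Finsupp.single_add]
      refine key _ _ ih ?_
      have h1 : rightTranslate g (monomial (Finsupp.single ij 1) 1) =
          ∑ l, X (ij.1, l) * C (g l ij.2) := by
        rw [← X, rightTranslate, aeval_X]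
      have h2 : ∏ j, g j j ^ colWeight (Finsupp.single ij 1) j = g ij.2 ij.2 := by
        classical
        rw [colWeight_single, Finset.prod_eq_single ij.2]
        · simp
        · intro j _ hj
          simp [hj.symm]
        · simp
      rw [h1, h2, ← X, ← Finset.sum_erase_add _ _ (Finset.mem_univ ij.2), mul_comm (C _),
        add_sub_cancel_right]
      refine Submodule.sum_mem _ fun l hl => ?_
      have hl' : l ≠ ij.2 := Finset.ne_of_mem_erase hl
      rcases lt_or_gt_of_ne hl' with h | h
      · rw [mul_comm, C_mul']
        refine Submodule.smul_mem _ _ (monomial_mem_heightLT ?_)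
        rw [colWeight_single, colWeight_single, height_single, height_single]
        exact h
      · rw [hg h, C_0, mul_zero]
        exact zero_mem _

theorem rightTranslate_diagonal_monomial (t : Fin n → k) (m : Fin n × Fin n →₀ ℕ) :
    rightTranslate (Matrix.diagonal t) (monomial m 1) =
      C (∏ j, t j ^ colWeight m j) * monomial m 1 := by
  have h0 : rightTranslate (Matrix.diagonal t) =
      aeval fun ij => C (t ij.2) * (X ij : MvPolynomial (Fin n × Fin n) k) := by
    ext1 ij
    rw [rightTranslate, aeval_X, aeval_X, Finset.sum_eq_single ij.2]
    · simp [mul_comm]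
    · intro l _ hl
      simp [hl]
    · simp
  rw [h0, aeval_monomial, map_one, one_mul, monomial_eq (s := m), C_1, one_mul]
  simp only [mul_pow]
  rw [Finsupp.prod_mul]
  congr 1
  induction m using Finsupp.induction_linear with
  | zero => simp
  | add m₁ m₂ h₁ h₂ =>
    classical
    rw [Finsupp.prod_add_index' (by simp) (by simp [pow_add]), h₁, h₂, ← C_mul,
      ← Finset.prod_mul_distrib]
    simp [pow_add]
  | single ij e =>
    classical
    rw [Finsupp.prod_single_index (by simp), colWeight, Finsupp.weight_single,
      Finset.prod_eq_single ij.2]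
    · simp
    · intro j _ hj
      simp [hj.symm]
    · simp

variable [CharZero k]

/-- A subspace stable under the diagonal matrices contains the weight components of its
elements. -/
theorem weightComponent_mem (W : Submodule k (MvPolynomial (Fin n × Fin n) k))
    (hW : ∀ t : Fin n → k, (∀ i, t i ≠ 0) → ∀ Q ∈ W, rightTranslate (Matrix.diagonal t) Q ∈ W)
    {Q : MvPolynomial (Fin n × Fin n) k} (hQ : Q ∈ W) (d : Fin n →₀ ℕ) :
    weightedHomogeneousComponent (fun ij => Finsupp.single ij.2 1) d Q ∈ W := by
  classical
  by_contra hd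
  obtain ⟨φ, hφ, hφW⟩ := Submodule.exists_le_ker_of_notMem hd
  let Ψ : MvPolynomial (Fin n) k :=
    ∑ m ∈ Q.support, monomial (colWeight m) (coeff m Q * φ (monomial m 1))
  have hΨ : Ψ = 0 := by
    refine funext_set (fun _ : Fin n => {x : k | x ≠ 0})
      (fun _ => (Set.finite_singleton (0 : k)).infinite_compl) fun t ht => ?_
    have ht' : ∀ i, t i ≠ 0 := fun i => ht i (Set.mem_univ i)
    have h1 : φ (rightTranslate (Matrix.diagonal t) Q) = 0 := hφW (hW t ht' Q hQ)
    rw [map_zero, ← h1]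
    conv_rhs => rw [Q.as_sum]
    simp only [Ψ, map_sum]
    refine Finset.sum_congr rfl fun m _ => ?_
    have h2 : (monomial m (coeff m Q) : MvPolynomial (Fin n × Fin n) k) =
        coeff m Q • monomial m 1 := by rw [smul_monomial, smul_eq_mul, mul_one]
    rw [h2, map_smul, rightTranslate_diagonal_monomial, C_mul', map_smul, map_smul, eval_monomial,
      smul_eq_mul, smul_eq_mul, Finsupp.prod_fintype _ _ (by simp)]
    ring
  refine hφ ?_
  have h3 := congrArg (coeff d) hΨ
  rw [coeff_zero, coeff_sum] at h3
  simp only [coeff_monomial] at h3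
  rw [weightedHomogeneousComponent_apply, map_sum, ← h3, Finset.sum_filter]
  refine Finset.sum_congr rfl fun m _ => ?_
  have h2 : (monomial m (coeff m Q) : MvPolynomial (Fin n × Fin n) k) =
      coeff m Q • monomial m 1 := by rw [smul_monomial, smul_eq_mul, mul_one]
  rw [h2, map_smul, smul_eq_mul]
  rfl

/-- A nonzero space of polynomials stable under right translation by upper triangular matrices
contains a highest weight vector: a weight vector of minimal height. -/
theorem exists_highestWeight_poly (W : Submodule k (MvPolynomial (Fin n × Fin n) k))
    (hW : ∀ b : GL (Fin n) k, b.1.BlockTriangular id → ∀ Q ∈ W, rightTranslate b.1 Q ∈ W)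
    (h0 : W ≠ ⊥) : ∃ Q ∈ W, Q ≠ 0 ∧ ∃ d : Fin n → ℕ, ∀ b : GL (Fin n) k,
      b.1.BlockTriangular id → rightTranslate b.1 Q = (∏ i, b.1 i i ^ d i) • Q := by
  classical
  have hcomp : ∀ Q ∈ W, ∀ d,
      weightedHomogeneousComponent (fun ij => Finsupp.single ij.2 1) d Q ∈ W := fun Q hQ d =>
    weightComponent_mem W (fun t ht => hW (Matrix.GeneralLinearGroup.mkOfDetNeZero
      (Matrix.diagonal t) (by simpa [Finset.prod_eq_zero_iff] using ht))
      (Matrix.blockTriangular_diagonal t)) hQ d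
  -- every nonzero monomial of an element of `W` gives a weight vector in `W`
  have hwv : ∀ Q ∈ W, ∀ m, coeff m Q ≠ 0 → ∃ Q' ∈ W, Q' ≠ 0 ∧
      IsWeightedHomogeneous (fun ij : Fin n × Fin n => Finsupp.single ij.2 1) Q' (colWeight m) :=
    fun Q hQ m hm => ⟨_, hcomp Q hQ (colWeight m), fun hz => hm (by
      have := congrArg (coeff m) hz
      rwa [coeff_weightedHomogeneousComponent, if_pos (by rfl), coeff_zero] at this),
      weightedHomogeneousComponent_isWeightedHomogeneous _ _⟩
  have hex : ∃ h, ∃ Q ∈ W, Q ≠ 0 ∧ ∃ d,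
      IsWeightedHomogeneous (fun ij : Fin n × Fin n => Finsupp.single ij.2 1) Q d ∧
        height d = h := by
    obtain ⟨Q, hQ, hQ0⟩ := Submodule.exists_mem_ne_zero_of_ne_bot h0
    obtain ⟨m, hm⟩ := MvPolynomial.exists_coeff_ne_zero hQ0
    obtain ⟨Q', h1, h2, h3⟩ := hwv Q hQ m hm
    exact ⟨_, Q', h1, h2, _, h3, rfl⟩
  obtain ⟨Q, hQ, hQ0, d, hd, hh⟩ := Nat.find_spec hex
  refine ⟨Q, hQ, hQ0, d, fun b hb => ?_⟩
  have hlow : rightTranslate b.1 Q - (∏ i, b.1 i i ^ d i) • Q ∈ heightLT k n (height d) := by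
    rw [Q.as_sum, map_sum, Finset.smul_sum, ← Finset.sum_sub_distrib]
    refine Submodule.sum_mem _ fun m hm => ?_
    have hmd : colWeight m = d := hd (mem_support_iff.1 hm)
    have h2 : (monomial m (coeff m Q) : MvPolynomial (Fin n × Fin n) k) =
        coeff m Q • monomial m 1 := by rw [smul_monomial, smul_eq_mul, mul_one]
    have h3 := rightTranslate_monomial_sub_mem b.1 hb m
    rw [C_mul'] at h3
    rw [h2, map_smul, smul_comm, ← smul_sub, ← hmd]
    exact Submodule.smul_mem _ _ h3
  -- a nonzero difference would lead to a weight vector of smaller height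
  by_contra hne
  obtain ⟨m, hm⟩ := MvPolynomial.exists_coeff_ne_zero (sub_ne_zero.2 hne)
  obtain ⟨Q', h1, h2, h3⟩ := hwv _ (sub_mem (hW b hb Q hQ) (Submodule.smul_mem _ _ hQ)) m hm
  refine Nat.find_min hex ?_ ⟨Q', h1, h2, _, h3, rfl⟩
  rw [← hh]
  exact hlow m hm

/-- A highest weight vector of weight `α`: each upper triangular matrix `b` acts on it by the scalar
`∏ b_ii ^ α_i`. The zero vector is allowed. -/
def IsHighestWeight {W : Type*} [AddCommGroup W] [Module k W]
    (ρ : Representation k (GL (Fin n) k) W) (α : Fin n → ℤ) (w : W) : Prop :=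
  ∀ b : GL (Fin n) k, b.1.BlockTriangular id → ρ b w = (∏ i, b.1 i i ^ α i) • w

/-- A function on `GLₙ(k)` on which the lower triangular matrices act by left translations through
the character `α`. -/
def IsLeftSemiinvariant (α : Fin n → ℤ) (f : GL (Fin n) k → k) : Prop :=
  ∀ (b x : GL (Fin n) k), b.1.BlockTriangular OrderDual.toDual →
    f (b * x) = (∏ i, b.1 i i ^ α i) * f x

omit [CharZero k] in
theorem isHighestWeight_functionsRep {α : Fin n → ℤ} {f : GL (Fin n) k → k} :
    IsHighestWeight (functionsRep k n) α f ↔ ∀ (x b : GL (Fin n) k), b.1.BlockTriangular id →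
      f (x * b) = (∏ i, b.1 i i ^ α i) * f x :=
  ⟨fun h x b hb => congrFun (h b hb) x, fun h b hb => funext fun x => h x b hb⟩

/-- A space of functions stable under right translations by upper triangular matrices and containing
a nonzero regular function contains a nonzero regular highest weight vector. -/
theorem exists_isHighestWeight (W : Submodule k (GL (Fin n) k → k))
    (hW : ∀ b : GL (Fin n) k, b.1.BlockTriangular id → ∀ f ∈ W, functionsRep k n b f ∈ W)
    {f : GL (Fin n) k → k} (hf : f ∈ W) (hr : IsRegular f) (h0 : f ≠ 0) :
    ∃ f' ∈ W, f' ≠ 0 ∧ IsRegular f' ∧ ∃ α, IsHighestWeight (functionsRep k n) α f' := by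
  obtain ⟨P, m, hP⟩ := hr
  -- multiplication by `det ^ (-m)` brings polynomials into `W`
  let E : MvPolynomial (Fin n × Fin n) k →ₗ[k] (GL (Fin n) k → k) :=
    { toFun := fun Q x => x.1.det ^ (-m : ℤ) * evalAt x.1 Q
      map_add' := fun Q R => by funext x; simp [mul_add]
      map_smul' := fun c Q => by
        funext x
        simp only [← C_mul', map_mul, evalAt_C, RingHom.id_apply, Pi.smul_apply, smul_eq_mul]
        ring }
  have hE : ∀ Q x, E Q x = x.1.det ^ (-m : ℤ) * evalAt x.1 Q := fun _ _ => rfl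
  have hEreg : ∀ Q, IsRegular (E Q) := fun Q =>
    (isRegular_det_zpow (-m : ℤ)).mul (isRegular_evalAt Q)
  have hEt : ∀ (b : GL (Fin n) k) Q, E (rightTranslate b.1 Q) =
      b.1.det ^ (m : ℤ) • functionsRep k n b (E Q) := fun b Q => by
    funext x
    change x.1.det ^ (-m : ℤ) * evalAt x.1 (rightTranslate b.1 Q) =
      b.1.det ^ (m : ℤ) * ((x * b).1.det ^ (-m : ℤ) * evalAt (x * b).1 Q)
    rw [evalAt_rightTranslate, Units.val_mul, Matrix.det_mul, mul_zpow, zpow_neg b.1.det]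
    have := zpow_ne_zero m b.det_ne_zero
    field_simp
  have hEP : E P = f := by
    funext x
    have := pow_ne_zero m x.det_ne_zero
    rw [hE, ← hP, zpow_neg, zpow_natCast]
    field_simp
  obtain ⟨Q, hQ, hQ0, d, hd⟩ := exists_highestWeight_poly (W.comap E)
    (fun b hb Q hQ => by
      rw [Submodule.mem_comap, hEt]
      exact W.smul_mem _ (hW b hb _ hQ))
    (fun hbot => h0 <| by
      have : P ∈ W.comap E := by rwa [Submodule.mem_comap, hEP]
      rw [hbot, Submodule.mem_bot] at this
      rw [← hEP, this, map_zero])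
  refine ⟨E Q, hQ, fun hc => hQ0 <| eq_zero_of_evalAt_GL fun x => ?_, hEreg Q,
    fun i => d i - m, fun b hb => ?_⟩
  · exact (mul_eq_zero.1 (congrFun hc x)).resolve_left (zpow_ne_zero _ x.det_ne_zero)
  · have h1 := hEt b Q
    rw [hd b hb, map_smul] at h1
    have h2 : b.1.det ^ (m : ℤ) ≠ 0 := zpow_ne_zero _ b.det_ne_zero
    rw [← inv_smul_smul₀ h2 (functionsRep k n b (E Q)), ← h1, smul_smul]
    congr 1
    rw [Matrix.det_of_isUpperTriangular hb, ← Finset.prod_zpow, ← Finset.prod_inv_distrib,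
      ← Finset.prod_mul_distrib]
    refine Finset.prod_congr rfl fun i _ => ?_
    rw [zpow_sub₀ (GL_diag_ne_zero_of_upper b hb i), zpow_natCast, zpow_natCast]
    ring

/-- The transpose of an invertible matrix. -/
def transposeGL (x : GL (Fin n) k) : GL (Fin n) k where
  val := x.1.transpose
  inv := (x⁻¹).1.transpose
  val_inv := by rw [← Matrix.transpose_mul, ← Units.val_mul]; simp
  inv_val := by rw [← Matrix.transpose_mul, ← Units.val_mul]; simp

omit [CharZero k] in
theorem transposeGL_mul (x y : GL (Fin n) k) :
    transposeGL (x * y) = transposeGL y * transposeGL x := by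
  ext1
  exact Matrix.transpose_mul _ _

omit [CharZero k] in
theorem transposeGL_transposeGL (x : GL (Fin n) k) : transposeGL (transposeGL x) = x := by
  ext1
  rfl

omit [CharZero k] in
theorem IsRegular.transpose {f : GL (Fin n) k → k} (hf : IsRegular f) :
    IsRegular (f ∘ transposeGL) := by
  obtain ⟨P, m, hP⟩ := hf
  refine ⟨rename Prod.swap P, m, fun x => ?_⟩
  have := hP (transposeGL x)
  rw [Function.comp_apply, ← Matrix.det_transpose]
  refine this.trans ?_
  rw [evalAt, evalAt, eval_rename]
  rfl

/-- The analogue of `exists_isHighestWeight` for left translations. -/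
theorem exists_isLeftSemiinvariant (W : Submodule k (GL (Fin n) k → k))
    (hW : ∀ b : GL (Fin n) k, b.1.BlockTriangular OrderDual.toDual → ∀ f ∈ W,
      (fun x => f (b * x)) ∈ W)
    {f : GL (Fin n) k → k} (hf : f ∈ W) (hr : IsRegular f) (h0 : f ≠ 0) :
    ∃ f' ∈ W, f' ≠ 0 ∧ IsRegular f' ∧ ∃ α, IsLeftSemiinvariant α f' := by
  have hcomp : ∀ g : GL (Fin n) k → k, (g ∘ transposeGL) ∘ transposeGL = g := fun g => by
    funext x
    simp [transposeGL_transposeGL]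
  obtain ⟨f', hf', h0', hr', α, hα⟩ := exists_isHighestWeight
    (W.comap (LinearMap.funLeft k k transposeGL))
    (fun b hb g hg => by
      have := hW (transposeGL b) (fun i j hij => hb hij) _ hg
      rw [Submodule.mem_comap]
      convert this using 1
      funext x
      change g (transposeGL x * b) = g (transposeGL (transposeGL b * x))
      rw [transposeGL_mul, transposeGL_transposeGL])
    (f := f ∘ transposeGL) (by
      rw [Submodule.mem_comap]
      change (f ∘ transposeGL) ∘ transposeGL ∈ W
      rwa [hcomp]) hr.transpose
    (fun hc => h0 <| by rw [← hcomp f, hc]; rfl)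
  refine ⟨f' ∘ transposeGL, hf', fun hc => h0' <| by rw [← hcomp f', hc]; rfl, hr'.transpose, α,
    fun b x hb => ?_⟩
  rw [Function.comp_apply, transposeGL_mul]
  exact isHighestWeight_functionsRep.1 hα _ (transposeGL b) fun i j hij => hb hij

end HighestWeightVectors

/-! ### The representations `Σ^α(V)` -/

section SchurModules

open MvPolynomial

variable {k : Type*} [Field k] {n : ℕ}

theorem IsRegular.smul {f : GL (Fin n) k → k} (hf : IsRegular f) (c : k) : IsRegular (c • f) :=
  (isRegular_const c).mul hf

theorem isRegular_zero : IsRegular (0 : GL (Fin n) k → k) := isRegular_const 0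

theorem IsRegular.sub {f g : GL (Fin n) k → k} (hf : IsRegular f) (hg : IsRegular g) :
    IsRegular (f - g) := by
  have := hf.add (hg.smul (-1))
  rwa [neg_one_smul, ← sub_eq_add_neg] at this

/-- Matrix coefficients: `P(xg)` is a finite sum of products of polynomials in `x` and in `g`. -/
theorem exists_evalAt_mul (P : MvPolynomial (Fin n × Fin n) k) :
    ∃ (ι : Type) (_ : Fintype ι) (a b : ι → MvPolynomial (Fin n × Fin n) k),
      ∀ x g, evalAt (x * g) P = ∑ l, evalAt x (a l) * evalAt g (b l) := by
  induction P using MvPolynomial.induction_on with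
  | C c => exact ⟨Unit, inferInstance, fun _ => C c, fun _ => 1, by simp⟩
  | add p q hp hq =>
    obtain ⟨ι, _, a, b, h⟩ := hp
    obtain ⟨ι', _, a', b', h'⟩ := hq
    exact ⟨ι ⊕ ι', inferInstance, Sum.elim a a', Sum.elim b b', fun x g => by simp [h, h']⟩
  | mul_X p ij hp =>
    obtain ⟨ι, _, a, b, h⟩ := hp
    refine ⟨ι × Fin n, inferInstance, fun l => a l.1 * X (ij.1, l.2),
      fun l => b l.1 * X (l.2, ij.2), fun x g => ?_⟩
    rw [map_mul, h, evalAt_X, Matrix.mul_apply, Finset.sum_mul_sum, Fintype.sum_prod_type]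
    refine Finset.sum_congr rfl fun i _ => Finset.sum_congr rfl fun j _ => ?_
    simp only [map_mul, evalAt_X]
    ring

theorem IsRegular.exists_mul {f : GL (Fin n) k → k} (hf : IsRegular f) :
    ∃ (ι : Type) (_ : Fintype ι) (A : ι → GL (Fin n) k → k)
      (b : ι → MvPolynomial (Fin n × Fin n) k) (m : ℕ), (∀ l, IsRegular (A l)) ∧
      ∀ x g : GL (Fin n) k, f (x * g) * g.1.det ^ m = ∑ l, A l x * evalAt g.1 (b l) := by
  obtain ⟨P, m, hP⟩ := hf
  obtain ⟨ι, _, a, b, h⟩ := exists_evalAt_mul P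
  refine ⟨ι, inferInstance, fun l x => x.1.det ^ (-m : ℤ) * evalAt x.1 (a l), b, m,
    fun l => (isRegular_det_zpow _).mul (isRegular_evalAt _), fun x g => ?_⟩
  have h1 := hP (x * g)
  rw [Units.val_mul, h, Matrix.det_mul, mul_pow] at h1
  have h2 : x.1.det ^ m ≠ 0 := pow_ne_zero _ x.det_ne_zero
  simp only [mul_assoc, ← Finset.mul_sum, ← h1, zpow_neg, zpow_natCast]
  field_simp

theorem IsRegular.rightTranslate {f : GL (Fin n) k → k} (hf : IsRegular f) (g : GL (Fin n) k) :
    IsRegular (functionsRep k n g f) := by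
  obtain ⟨ι, _, A, b, m, hA, h⟩ := hf.exists_mul
  have : functionsRep k n g f = ∑ l, (evalAt g.1 (b l) * (g.1.det ^ m)⁻¹) • A l := by
    funext x
    have h2 : g.1.det ^ m ≠ 0 := pow_ne_zero _ g.det_ne_zero
    rw [Finset.sum_apply]
    change f (x * g) = ∑ l, evalAt g.1 (b l) * (g.1.det ^ m)⁻¹ * A l x
    rw [(eq_mul_inv_iff_mul_eq₀ h2).2 (h x g), Finset.sum_mul]
    exact Finset.sum_congr rfl fun l _ => by ring
  rw [this]
  exact IsRegular.sum _ fun l _ => (hA l).smul _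

theorem IsRegular.leftTranslate {f : GL (Fin n) k → k} (hf : IsRegular f) (g : GL (Fin n) k) :
    IsRegular fun x => f (g * x) := by
  have h := (hf.transpose.rightTranslate (transposeGL g)).transpose
  convert h using 1
  funext x
  change f (g * x) = f (transposeGL (transposeGL x * transposeGL g))
  rw [transposeGL_mul, transposeGL_transposeGL, transposeGL_transposeGL]

theorem highestWeightFunction_mem_schur (α : Fin n → ℤ) :
    highestWeightFunction α ∈ (schurSub k α).toSubmodule :=
  Submodule.subset_span ⟨1, by simp⟩

theorem schur_isLeftSemiinvariant {α : Fin n → ℤ} {f : GL (Fin n) k → k}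
    (hf : f ∈ (schurSub k α).toSubmodule) : IsLeftSemiinvariant α f := by
  intro b x hb
  induction hf using Submodule.span_induction with
  | mem y hy =>
    obtain ⟨g, rfl⟩ := hy
    change highestWeightFunction α (b * x * g) = _ * highestWeightFunction α (x * g)
    rw [mul_assoc, highestWeightFunction_lower_mul _ _ _ hb]
  | zero => simp
  | add y z _ _ hy hz => rw [Pi.add_apply, Pi.add_apply, hy, hz, mul_add]
  | smul c y _ hy => rw [Pi.smul_apply, Pi.smul_apply, hy, smul_eq_mul, smul_eq_mul]; ring

theorem schur_isRegular {α : Fin n → ℤ} (hα : Antitone α) {f : GL (Fin n) k → k}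
    (hf : f ∈ (schurSub k α).toSubmodule) : IsRegular f := by
  induction hf using Submodule.span_induction with
  | mem y hy =>
    obtain ⟨g, rfl⟩ := hy
    exact (isRegular_highestWeightFunction hα).rightTranslate g
  | zero => exact isRegular_zero
  | add y z _ _ hy hz => exact hy.add hz
  | smul c y _ hy => exact hy.smul c

variable (k) in
/-- The highest weight vector of `Σ^α(V)`. -/
def schurVec (α : Fin n → ℤ) : Schur k α :=
  ⟨highestWeightFunction α, highestWeightFunction_mem_schur α⟩

theorem schurVec_ne_zero (α : Fin n → ℤ) : schurVec k α ≠ 0 := fun h => by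
  have := congrFun (congrArg Subtype.val h) 1
  exact one_ne_zero ((highestWeightFunction_one α).symm.trans this)

theorem isHighestWeight_schurVec (α : Fin n → ℤ) :
    IsHighestWeight (schurRep k α) α (schurVec k α) := fun b hb => by
  ext x
  exact highestWeightFunction_mul_upper α x b hb

/-- `Σ^α(V)` is generated by its highest weight vector. -/
theorem schur_span (α : Fin n → ℤ) (w : Schur k α) :
    w ∈ Submodule.span k (Set.range fun g => schurRep k α g (schurVec k α)) := by
  have h : ((Submodule.span k (Set.range fun g => schurRep k α g (schurVec k α))).map
      (schurSub k α).toSubmodule.subtype) = (schurSub k α).toSubmodule := by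
    rw [Submodule.map_span, ← Set.range_comp]
    rfl
  obtain ⟨w', hw', e⟩ := h.ge w.2
  rwa [← Subtype.ext e]

/-- Expanding in the entries of `g` gives `f (x * g) * det g ^ m = ∑ₗ Aₗ(x) bₗ(g)`: the translates of
`f` span a finite-dimensional space, and their coordinates are rational functions of `g`. -/
theorem schurRep_isRational {α : Fin n → ℤ} (hα : Antitone α) : IsRational (schurRep k α) := by
  constructor
  · obtain ⟨ι, _, A, b, m, hA, h⟩ := (isRegular_highestWeightFunction (k := k) hα).exists_mul
    have : (schurSub k α).toSubmodule ≤ Submodule.span k (Set.range A) := by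
      refine Submodule.span_le.2 ?_
      rintro _ ⟨g, rfl⟩
      have e : functionsRep k n g (highestWeightFunction α) =
          ∑ l, (evalAt g.1 (b l) * (g.1.det ^ m)⁻¹) • A l := by
        funext x
        have h2 : g.1.det ^ m ≠ 0 := pow_ne_zero _ g.det_ne_zero
        rw [Finset.sum_apply]
        change highestWeightFunction α (x * g) =
          ∑ l, evalAt g.1 (b l) * (g.1.det ^ m)⁻¹ * A l x
        rw [(eq_mul_inv_iff_mul_eq₀ h2).2 (h x g), Finset.sum_mul]
        exact Finset.sum_congr rfl fun l _ => by ring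
      change functionsRep k n g (highestWeightFunction α) ∈ _
      rw [e]
      exact Submodule.sum_mem _ fun l _ =>
        Submodule.smul_mem _ _ (Submodule.subset_span ⟨l, rfl⟩)
    have : FiniteDimensional k (Submodule.span k (Set.range A)) :=
      FiniteDimensional.span_of_finite k (Set.finite_range A)
    exact Submodule.finiteDimensional_of_le ‹_›
  · intro w φ
    obtain ⟨φ', hφ'⟩ := LinearMap.exists_extend φ
    obtain ⟨ι, _, A, b, m, hA, h⟩ := (schur_isRegular hα w.2).exists_mul
    refine ⟨∑ l, C (φ' (A l)) * b l, m, fun g => ?_⟩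
    have e : g.1.det ^ m • functionsRep k n g w.1 = ∑ l, evalAt g.1 (b l) • A l := by
      funext x
      rw [Finset.sum_apply]
      change g.1.det ^ m * w.1 (x * g) = ∑ l, evalAt g.1 (b l) * A l x
      rw [mul_comm, h]
      exact Finset.sum_congr rfl fun l _ => mul_comm _ _
    have h1 : φ (schurRep k α g w) = φ' (functionsRep k n g w.1) := by
      rw [← hφ']
      rfl
    rw [h1, mul_comm, ← smul_eq_mul, ← map_smul, e, map_sum]
    change _ = evalAt g.1 _
    rw [map_sum]
    refine Finset.sum_congr rfl fun l _ => ?_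
    rw [map_smul, map_mul, evalAt_C, smul_eq_mul, mul_comm]

variable [CharZero k]

/-- If a polynomial takes the value `c s ^ r`, `c ≠ 0`, along a line, then `r ≥ 0`. -/
theorem evalAt_exponent_nonneg (P : MvPolynomial (Fin n × Fin n) k)
    (a b : Matrix (Fin n) (Fin n) k) {c : k} (hc : c ≠ 0) (r : ℤ)
    (h : ∀ s : k, s ≠ 0 → evalAt (a + s • b) P = c * s ^ r) : 0 ≤ r := by
  by_contra hr
  -- otherwise `s ^ (-r)` times the polynomial is `c` for all `s ≠ 0`, hence also for `s = 0`
  obtain ⟨q, hq⟩ := Int.eq_ofNat_of_zero_le (show 0 ≤ -r by omega)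
  have hq0 : q ≠ 0 := by omega
  obtain ⟨p, hp⟩ := exists_eval_line P (fun ij => a ij.1 ij.2) fun ij => b ij.1 ij.2
  have hzero : Polynomial.X ^ q * p - Polynomial.C c = 0 := by
    refine eq_zero_of_finite_ne_zero ((Set.finite_singleton (0 : k)).subset fun s hs => ?_)
    by_contra hs0
    have h2 : p.eval s = evalAt (a + s • b) P := hp s
    refine hs ?_
    rw [Polynomial.eval_sub, Polynomial.eval_mul, Polynomial.eval_pow, Polynomial.eval_X,
      Polynomial.eval_C, h2, h s hs0, ← zpow_natCast s q, ← hq, zpow_neg]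
    have := zpow_ne_zero r hs0
    field_simp
    ring
  have := congrArg (Polynomial.eval 0) hzero
  simp only [Polynomial.eval_sub, Polynomial.eval_mul, Polynomial.eval_pow, Polynomial.eval_X,
    Polynomial.eval_C, Polynomial.eval_zero, zero_pow hq0, zero_mul, zero_sub, neg_eq_zero] at this
  exact hc this

/-- If a regular function takes the value `c s ^ r`, `c ≠ 0`, along a line on which the determinant
is constant, then `r ≥ 0`. -/
theorem IsRegular.exponent_nonneg {f : GL (Fin n) k → k} (hf : IsRegular f)
    (a b : Matrix (Fin n) (Fin n) k) {c d : k} (hc : c ≠ 0) (hd : d ≠ 0) (r : ℤ)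
    (h : ∀ s : k, s ≠ 0 → ∃ x : GL (Fin n) k, x.1 = a + s • b ∧ x.1.det = d ∧ f x = c * s ^ r) :
    0 ≤ r := by
  obtain ⟨P, m, hP⟩ := hf
  refine evalAt_exponent_nonneg P a b (mul_ne_zero hc (pow_ne_zero m hd)) r fun s hs => ?_
  obtain ⟨x, hx, hxd, hfx⟩ := h s hs
  rw [← hx, ← hP, hxd, hfx]
  ring

theorem zpow_two_injective {a b : ℤ} (h : (2 : k) ^ a = 2 ^ b) : a = b := by
  have h2 : ((2 : ℚ) ^ a : ℚ) = 2 ^ b := by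
    have : (((2 : ℚ) ^ a : ℚ) : k) = ((2 : ℚ) ^ b : ℚ) := by push_cast; exact h
    exact_mod_cast this
  exact zpow_right_injective₀ (by norm_num) (by norm_num) h2

/-- The invertible diagonal matrix with the entries `t`. -/
def diagGL (t : Fin n → k) (ht : ∀ i, t i ≠ 0) : GL (Fin n) k :=
  Matrix.GeneralLinearGroup.mkOfDetNeZero (Matrix.diagonal t)
    (by simpa [Finset.prod_eq_zero_iff] using ht)

omit [CharZero k] in
theorem diagGL_val (t : Fin n → k) (ht : ∀ i, t i ≠ 0) :
    (diagGL t ht).1 = Matrix.diagonal t := rfl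

omit [CharZero k] in
theorem ne_zero_of_bigCell {f : GL (Fin n) k → k} [CharZero k] (hr : IsRegular f) (h0 : f ≠ 0)
    {α μ : Fin n → ℤ} (hα : IsHighestWeight (functionsRep k n) α f)
    (hμ : IsLeftSemiinvariant μ f) : f 1 ≠ 0 := fun h1 => h0 <| hr.eq_zero_of_bigCell
  fun l u hl hu => by
    rw [isHighestWeight_functionsRep.1 hα l u hu, ← mul_one l, hμ l 1 hl, h1, mul_zero, mul_zero]

/-- The two weights agree because a diagonal matrix acts in the same way from both sides on the value
at `1`. -/
theorem weight_eq_of_bigCell {f : GL (Fin n) k → k} (hr : IsRegular f) (h0 : f ≠ 0)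
    {α μ : Fin n → ℤ} (hα : IsHighestWeight (functionsRep k n) α f)
    (hμ : IsLeftSemiinvariant μ f) : μ = α := by
  have h1 := ne_zero_of_bigCell hr h0 hα hμ
  funext i
  -- the number `2` is not a root of unity in characteristic `0`
  have ht : ∀ j, Function.update (1 : Fin n → k) i 2 j ≠ 0 := fun j => by
    by_cases h : j = i
    · subst h; simp
    · simp [h]
  set t := diagGL _ ht
  have h2 := hμ t 1 (Matrix.blockTriangular_diagonal _)
  have h3 := isHighestWeight_functionsRep.1 hα 1 t (Matrix.blockTriangular_diagonal _)
  rw [mul_one] at h2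
  rw [one_mul, h2] at h3
  have h4 : ∀ β : Fin n → ℤ, ∏ j, t.1 j j ^ β j = 2 ^ β i := fun β => by
    rw [Finset.prod_eq_single i]
    · simp [t, diagGL_val]
    · intro j _ hj
      simp [t, diagGL_val, hj]
    · simp
  rw [h4, h4] at h3
  exact zpow_two_injective (mul_right_cancel₀ h1 h3)

/-- The weight of a regular function that is semi-invariant on both sides is dominant: moving off
the big cell, in the direction of the simple root number `i`, the function behaves like
`s ^ (αᵢ - αᵢ₊₁)`. -/
theorem antitone_of_bigCell {f : GL (Fin n) k → k} (hr : IsRegular f) (h0 : f ≠ 0)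
    {α : Fin n → ℤ} (hα : IsHighestWeight (functionsRep k n) α f)
    (hμ : IsLeftSemiinvariant α f) : Antitone α := by
  have h1 := ne_zero_of_bigCell hr h0 hα hμ
  obtain _ | n := n
  · exact fun i => i.elim0
  refine Fin.antitone_iff_succ_le.2 fun i => ?_
  rw [← sub_nonneg]
  set p := i.castSucc
  set q := i.succ
  have hpq : p < q := Fin.castSucc_lt_succ
  refine hr.exponent_nonneg
    (Matrix.of fun a b => if a = p then (if b = q then 1 else 0) else if a = q then
      (if b = p then -1 else 0) else (1 : Matrix _ _ k) a b)
    (Matrix.of fun a b => if a = p ∧ b = p then 1 else 0) h1 (one_ne_zero (α := k)) _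
    fun s hs => ?_
  -- in the rows and columns `p`, `q` this is `(s, 1; -1, 0) = (s, 0; -1, s⁻¹) * (1, s⁻¹; 0, 1)`
  set l : Matrix (Fin (n + 1)) (Fin (n + 1)) k :=
    Matrix.of fun a b => if a = p then (if b = p then s else 0) else if a = q then
      (if b = p then -1 else if b = q then s⁻¹ else 0) else (1 : Matrix _ _ k) a b with hl
  have hlow : l.BlockTriangular OrderDual.toDual := by
    intro a b hab
    simp only [OrderDual.toDual_lt_toDual] at hab
    simp only [hl, Matrix.of_apply]
    split_ifs with h1 h2 h3 h4 h5
    · exact absurd (h1.trans h2.symm) hab.ne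
    · rfl
    · rw [h3, h4] at hab
      exact absurd hab hpq.not_gt
    · exact absurd (h3.trans h5.symm) hab.ne
    · rfl
    · exact Matrix.one_apply_ne hab.ne
  have hdiag : ∀ a, l a a = if a = p then s else if a = q then s⁻¹ else 1 := fun a => by
    simp only [hl, Matrix.of_apply]
    split_ifs
    · rfl
    · rfl
    · simp
  have hprod : ∀ β : Fin (n + 1) → ℤ, ∏ a, l a a ^ β a = s ^ (β p - β q) := fun β => by
    rw [Fintype.prod_eq_mul p q hpq.ne, hdiag, hdiag, if_pos rfl, if_neg hpq.ne', if_pos rfl,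
      inv_zpow, zpow_sub₀ hs, div_eq_mul_inv]
    intro a ha
    rw [hdiag, if_neg ha.1, if_neg ha.2, one_zpow]
  have hdet : l.det = 1 := by
    rw [Matrix.det_of_isLowerTriangular _ hlow]
    simpa using hprod 1
  set L : GL (Fin (n + 1)) k := Matrix.GeneralLinearGroup.mkOfDetNeZero l
    (by rw [hdet]; exact one_ne_zero)
  set T : GL (Fin (n + 1)) k := Matrix.GeneralLinearGroup.mkOfDetNeZero
    (Matrix.transvection p q s⁻¹) (by rw [Matrix.det_transvection_of_ne _ _ hpq.ne]; simp)
  have hT : T.1.BlockTriangular id := Matrix.blockTriangular_transvection (b := id) hpq.le s⁻¹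
  refine ⟨L * T, ?_, ?_, ?_⟩
  · change l * Matrix.transvection p q s⁻¹ = _
    ext a b
    by_cases hb : b = q
    · rw [hb, Matrix.mul_transvection_apply_same]
      simp only [hl, Matrix.of_apply, Matrix.add_apply, Matrix.smul_apply]
      split_ifs with h1 <;> simp_all [hpq.ne']
    · rw [Matrix.mul_transvection_apply_of_ne _ _ _ _ hb]
      simp only [hl, Matrix.of_apply, Matrix.add_apply, Matrix.smul_apply]
      split_ifs with h1 <;> simp_all
  · change (l * Matrix.transvection p q s⁻¹).det = 1
    rw [Matrix.det_mul, hdet, Matrix.det_transvection_of_ne _ _ hpq.ne, one_mul]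
  · rw [isHighestWeight_functionsRep.1 hα L T hT, ← mul_one L, hμ L 1 hlow]
    have h2 : ∏ a, T.1 a a ^ α a = 1 := by
      refine Finset.prod_eq_one fun a _ => ?_
      have : T.1 a a = 1 := by
        change Matrix.transvection p q s⁻¹ a a = 1
        have : ¬ (p = a ∧ q = a) := fun h => hpq.ne (h.1.trans h.2.symm)
        simp [Matrix.transvection, this]
      rw [this, one_zpow]
    have h3 : ∏ a, L.1 a a ^ α a = s ^ (α p - α q) := hprod α
    rw [h2, h3, one_mul, mul_comm]

/-- A regular function that is semi-invariant on both sides is a multiple of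
`∏ᵢ Δᵢ ^ (αᵢ - αᵢ₊₁)`. -/
theorem eq_smul_highestWeightFunction {f : GL (Fin n) k → k} (hr : IsRegular f)
    {α : Fin n → ℤ} (ha : Antitone α) (hα : IsHighestWeight (functionsRep k n) α f)
    (hμ : IsLeftSemiinvariant α f) : f = f 1 • highestWeightFunction α := by
  rw [← sub_eq_zero]
  refine (hr.sub ((isRegular_highestWeightFunction ha).smul _)).eq_zero_of_bigCell
    fun l u hl hu => ?_
  rw [Pi.sub_apply, Pi.smul_apply, isHighestWeight_functionsRep.1 hα l u hu,
    highestWeightFunction_mul_upper _ _ _ hu, ← mul_one l, hμ l 1 hl,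
    highestWeightFunction_lower_mul _ _ _ hl, highestWeightFunction_one, smul_eq_mul]
  ring

/-- The only highest weight vectors of `Σ^β(V)` are the multiples of `schurVec k β`. -/
theorem schur_highestWeight {α β : Fin n → ℤ} (hβ : Antitone β) {w : Schur k β} (h0 : w ≠ 0)
    (hw : IsHighestWeight (schurRep k β) α w) :
    α = β ∧ ∃ c : k, c ≠ 0 ∧ w = c • schurVec k β := by
  have hr := schur_isRegular hβ w.2
  have hl := schur_isLeftSemiinvariant w.2
  have h0' : w.1 ≠ 0 := fun h => h0 (Subtype.ext h)
  have hw' : IsHighestWeight (functionsRep k n) α w.1 := fun b hb =>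
    congrArg Subtype.val (hw b hb)
  obtain rfl := weight_eq_of_bigCell hr h0' hw' hl
  exact ⟨rfl, w.1 1, ne_zero_of_bigCell hr h0' hw' hl,
    Subtype.ext (eq_smul_highestWeightFunction hr hβ hw' hl)⟩

/-- Every nonzero subrepresentation contains a highest weight vector, thus the generator
`schurVec k α`. -/
theorem schurRep_isIrreducible {α : Fin n → ℤ} (hα : Antitone α) :
    (schurRep k α).IsIrreducible := by
  have : Nontrivial (Subrepresentation (schurRep k α)) := ⟨⊥, ⊤, fun h => by
    have h1 : schurVec k α ∈ (⊤ : Subrepresentation (schurRep k α)).toSubmodule :=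
      Submodule.mem_top
    rw [← h] at h1
    exact schurVec_ne_zero α ((Submodule.mem_bot k).1 h1)⟩
  refine ⟨fun W => or_iff_not_imp_left.2 fun hW => ?_⟩
  have hW' : W.toSubmodule ≠ ⊥ := fun h => hW (Subrepresentation.toSubmodule_injective h)
  obtain ⟨w, hw, hw0⟩ := Submodule.exists_mem_ne_zero_of_ne_bot hW'
  obtain ⟨_, ⟨f, hf, rfl⟩, hf0, -, β, hβ⟩ := exists_isHighestWeight
    (W.toSubmodule.map (schurSub k α).toSubmodule.subtype)
    (by
      rintro b - _ ⟨f, hf, rfl⟩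
      exact ⟨_, W.apply_mem_toSubmodule b hf, rfl⟩)
    (f := w.1) ⟨w, hw, rfl⟩ (schur_isRegular hα w.2) (fun h => hw0 (Subtype.ext h))
  obtain ⟨rfl, c, hc, rfl⟩ := schur_highestWeight (α := β) hα (w := f)
    (fun h => hf0 (by rw [h, map_zero])) fun b hb => Subtype.ext (hβ b hb)
  have hv : schurVec k β ∈ W.toSubmodule := by
    have := W.toSubmodule.smul_mem c⁻¹ hf
    rwa [inv_smul_smul₀ hc] at this
  refine Subrepresentation.toSubmodule_injective (eq_top_iff.2 fun v _ => ?_)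
  refine Submodule.span_le.2 ?_ (schur_span β v)
  rintro _ ⟨g, rfl⟩
  exact W.apply_mem_toSubmodule g hv

theorem schurRep_isIrreducibleOfHighestWeight {α : Fin n → ℤ} (hα : Antitone α) :
    IsIrreducibleOfHighestWeight (schurRep k α) α :=
  ⟨schurRep_isIrreducible hα, schurRep_isRational hα, schurVec k α, schurVec_ne_zero α,
    isHighestWeight_schurVec α⟩

end SchurModules

/-! ### The Peter–Weyl theorem -/

section PeterWeyl

open MvPolynomial

variable {k : Type*} [Field k] {n : ℕ}

/-- The left translate `x ↦ P(gx)` of a polynomial in the entries of a matrix. -/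
def leftTranslate (g : Matrix (Fin n) (Fin n) k) :
    MvPolynomial (Fin n × Fin n) k →ₐ[k] MvPolynomial (Fin n × Fin n) k :=
  aeval fun ij => ∑ l, C (g ij.1 l) * X (l, ij.2)

theorem evalAt_leftTranslate (x g : Matrix (Fin n) (Fin n) k)
    (P : MvPolynomial (Fin n × Fin n) k) : evalAt x (leftTranslate g P) = evalAt (g * x) P := by
  have : (evalAt x).comp (leftTranslate g).toRingHom = evalAt (g * x) := by
    refine MvPolynomial.ringHom_ext (fun c => ?_) fun ij => ?_
    · simp [leftTranslate]
    · simp [leftTranslate, Matrix.mul_apply]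
  exact RingHom.congr_fun this P

/-- The polynomial `P` as a function on `GLₙ(k)`. -/
def polyFun : MvPolynomial (Fin n × Fin n) k →ₗ[k] (GL (Fin n) k → k) where
  toFun P x := evalAt x.1 P
  map_add' P Q := by funext x; simp
  map_smul' c P := by
    funext x
    rw [← C_mul', map_mul, evalAt_C]
    rfl

theorem polyFun_apply (P : MvPolynomial (Fin n × Fin n) k) (x : GL (Fin n) k) :
    polyFun P x = evalAt x.1 P := rfl

theorem isRegular_polyFun (P : MvPolynomial (Fin n × Fin n) k) :
    IsRegular (polyFun P : GL (Fin n) k → k) := isRegular_evalAt P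

/-- The linear form `∑ a_ij x_ij`. -/
def linForm (a : Matrix (Fin n) (Fin n) k) : MvPolynomial (Fin n × Fin n) k :=
  ∑ ij : Fin n × Fin n, C (a ij.1 ij.2) * X ij

theorem linForm_mul (a g : Matrix (Fin n) (Fin n) k) :
    linForm (a * g) = rightTranslate g.transpose (linForm a) := by
  simp only [linForm, map_sum, map_mul, algHom_C, Fintype.sum_prod_type, rightTranslate, aeval_X,
    Matrix.mul_apply, Finset.sum_mul, Finset.mul_sum, algebraMap_eq]
  refine Finset.sum_congr rfl fun i _ => ?_
  rw [Finset.sum_comm]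
  refine Finset.sum_congr rfl fun j _ => Finset.sum_congr rfl fun l _ => ?_
  simp only [Matrix.transpose_apply]
  ring

theorem linForm_mul' (g a : Matrix (Fin n) (Fin n) k) :
    linForm (g * a) = leftTranslate g.transpose (linForm a) := by
  simp only [linForm, map_sum, map_mul, algHom_C, Fintype.sum_prod_type, leftTranslate, aeval_X,
    Matrix.mul_apply, Finset.sum_mul, Finset.mul_sum, algebraMap_eq]
  calc _ = ∑ i, ∑ l, ∑ j, C (g i l) * C (a l j) * X (i, j) :=
        Finset.sum_congr rfl fun i _ => Finset.sum_comm
    _ = ∑ l, ∑ i, ∑ j, C (g i l) * C (a l j) * X (i, j) := Finset.sum_comm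
    _ = _ := by
      refine Finset.sum_congr rfl fun l _ => ?_
      rw [Finset.sum_comm]
      refine Finset.sum_congr rfl fun j _ => Finset.sum_congr rfl fun i _ => ?_
      simp only [Matrix.transpose_apply]
      ring

/-- The polynomial `a ↦ φ((∑ a_ij x_ij) ^ d)` attached to a functional `φ` on polynomials. -/
def dualPoly (d : ℕ) : Module.Dual k (MvPolynomial (Fin n × Fin n) k) →ₗ[k]
    MvPolynomial (Fin n × Fin n) k :=
  ∑ κ ∈ Finset.piAntidiag (Finset.univ : Finset (Fin n × Fin n)) d,
    ((monomial (Finsupp.equivFunOnFinite.symm κ) : k →ₗ[k] _).comp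
      ((Nat.multinomial Finset.univ κ : k) •
        Module.Dual.eval k _ (monomial (Finsupp.equivFunOnFinite.symm κ) 1)))

theorem dualPoly_apply (d : ℕ) (φ : Module.Dual k (MvPolynomial (Fin n × Fin n) k)) :
    dualPoly d φ = ∑ κ ∈ Finset.piAntidiag (Finset.univ : Finset (Fin n × Fin n)) d,
      monomial (Finsupp.equivFunOnFinite.symm κ) ((Nat.multinomial Finset.univ κ : k) *
        φ (monomial (Finsupp.equivFunOnFinite.symm κ) 1)) := by
  simp [dualPoly]

theorem evalAt_dualPoly (d : ℕ) (φ : Module.Dual k (MvPolynomial (Fin n × Fin n) k))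
    (a : Matrix (Fin n) (Fin n) k) : evalAt a (dualPoly d φ) = φ (linForm a ^ d) := by
  rw [dualPoly_apply, linForm, Finset.sum_pow_eq_sum_piAntidiag, map_sum, map_sum]
  refine Finset.sum_congr rfl fun κ _ => ?_
  have h : (Nat.multinomial Finset.univ κ : MvPolynomial (Fin n × Fin n) k) *
      ∏ ij, (C (a ij.1 ij.2) * X ij) ^ κ ij =
        ((Nat.multinomial Finset.univ κ : k) * ∏ ij : Fin n × Fin n, a ij.1 ij.2 ^ κ ij) •
          monomial (Finsupp.equivFunOnFinite.symm κ) 1 := by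
    rw [← C_mul', monomial_eq, C_1, one_mul, Finsupp.prod_fintype _ _ (by simp), map_mul,
      map_natCast, map_prod, mul_assoc, ← Finset.prod_mul_distrib]
    simp [mul_pow]
  rw [h, map_smul, smul_eq_mul, evalAt, eval_monomial, Finsupp.prod_fintype _ _ (by simp)]
  simp only [Finsupp.equivFunOnFinite_symm_apply_apply]
  ring

/-- Two-sided translates of a dual polynomial are dual polynomials of translated functionals. -/
theorem evalAt_dualPoly_translate (d : ℕ)
    (φ : Module.Dual k (MvPolynomial (Fin n × Fin n) k)) (g x h : GL (Fin n) k) :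
    polyFun (dualPoly d φ) (g * x * h) =
      polyFun (dualPoly d (φ ∘ₗ (rightTranslate h.1.transpose).toLinearMap ∘ₗ
        (leftTranslate g.1.transpose).toLinearMap)) x := by
  rw [polyFun_apply, polyFun_apply, evalAt_dualPoly, evalAt_dualPoly, Units.val_mul,
    Units.val_mul, linForm_mul, linForm_mul', ← map_pow, ← map_pow]
  rfl

theorem coeff_dualPoly (d : ℕ) (φ : Module.Dual k (MvPolynomial (Fin n × Fin n) k))
    (m : Fin n × Fin n →₀ ℕ) (hm : ∑ ij, m ij = d) : coeff m (dualPoly d φ) =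
      (Nat.multinomial Finset.univ m : k) * φ (monomial m 1) := by
  classical
  rw [dualPoly_apply, coeff_sum, Finset.sum_eq_single (m : Fin n × Fin n → ℕ)]
  · have : Finsupp.equivFunOnFinite.symm (m : Fin n × Fin n → ℕ) = m := by ext; simp
    rw [this, coeff_monomial, if_pos rfl]
  · intro κ _ hκ
    rw [coeff_monomial, if_neg]
    rintro rfl
    exact hκ (by ext; simp)
  · intro h
    exact absurd (Finset.mem_piAntidiag.2 ⟨hm, by simp⟩) h

theorem sum_eq_of_coeff_dualPoly_ne_zero (d : ℕ)
    (φ : Module.Dual k (MvPolynomial (Fin n × Fin n) k)) (m : Fin n × Fin n →₀ ℕ)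
    (hm : coeff m (dualPoly d φ) ≠ 0) : ∑ ij, m ij = d := by
  classical
  rw [dualPoly_apply, coeff_sum] at hm
  obtain ⟨κ, hκ, h⟩ := Finset.exists_ne_zero_of_sum_ne_zero hm
  rw [coeff_monomial] at h
  split_ifs at h with e
  · rw [← e, ← (Finset.mem_piAntidiag.1 hκ).1]
    simp
  · exact absurd rfl h

variable (k n) in
/-- The space spanned by the two-sided translates of the functions `∏ᵢ Δᵢ ^ (αᵢ - αᵢ₊₁)`, for
dominant `α`. -/
def translateSpan : Submodule k (GL (Fin n) k → k) :=
  Submodule.span k {f | ∃ α : Fin n → ℤ, Antitone α ∧ ∃ g h : GL (Fin n) k,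
    f = fun x => highestWeightFunction α (g * x * h)}

theorem translateSpan_right {f : GL (Fin n) k → k} (hf : f ∈ translateSpan k n)
    (b : GL (Fin n) k) : (fun x => f (x * b)) ∈ translateSpan k n := by
  induction hf using Submodule.span_induction with
  | mem y hy =>
    obtain ⟨α, hα, g, h, rfl⟩ := hy
    exact Submodule.subset_span ⟨α, hα, g, b * h, by simp only [mul_assoc]⟩
  | zero => exact zero_mem _
  | add y z _ _ hy hz => exact add_mem hy hz
  | smul c y _ hy => exact Submodule.smul_mem _ c hy

theorem translateSpan_left {f : GL (Fin n) k → k} (hf : f ∈ translateSpan k n)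
    (b : GL (Fin n) k) : (fun x => f (b * x)) ∈ translateSpan k n := by
  induction hf using Submodule.span_induction with
  | mem y hy =>
    obtain ⟨α, hα, g, h, rfl⟩ := hy
    exact Submodule.subset_span ⟨α, hα, g * b, h, by simp only [mul_assoc]⟩
  | zero => exact zero_mem _
  | add y z _ _ hy hz => exact add_mem hy hz
  | smul c y _ hy => exact Submodule.smul_mem _ c hy

theorem polyFun_translate_mem (g h : GL (Fin n) k) {Q : MvPolynomial (Fin n × Fin n) k}
    (hQ : polyFun Q ∈ translateSpan k n) :
    polyFun (rightTranslate h.1.transpose (leftTranslate g.1.transpose Q)) ∈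
      translateSpan k n := by
  convert translateSpan_right (translateSpan_left hQ (transposeGL g)) (transposeGL h) using 1
  funext x
  rw [polyFun_apply, evalAt_rightTranslate, evalAt_leftTranslate]
  rfl

theorem translateSpan_det {f : GL (Fin n) k → k} (hf : f ∈ translateSpan k n) (m : ℤ) :
    (fun x => x.1.det ^ m * f x) ∈ translateSpan k n := by
  induction hf using Submodule.span_induction with
  | mem y hy =>
    obtain ⟨α, hα, g, h, rfl⟩ := hy
    have e : (fun x : GL (Fin n) k => x.1.det ^ m * highestWeightFunction α (g * x * h)) =
        ((g.1.det ^ m)⁻¹ * (h.1.det ^ m)⁻¹) •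
          fun x => highestWeightFunction (fun i => α i + m) (g * x * h) := by
      funext x
      have h1 := zpow_ne_zero m g.det_ne_zero
      have h2 := zpow_ne_zero m h.det_ne_zero
      rw [Pi.smul_apply, highestWeightFunction_add_const, smul_eq_mul, Units.val_mul,
        Units.val_mul, Matrix.det_mul, Matrix.det_mul, mul_zpow, mul_zpow]
      field_simp
    rw [e]
    exact Submodule.smul_mem _ _ (Submodule.subset_span
      ⟨_, fun i j hij => add_le_add_left (hα hij) m, g, h, rfl⟩)
  | zero =>
    convert zero_mem (translateSpan k n) using 1
    funext x
    simp
  | add y z _ _ hy hz =>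
    convert add_mem hy hz using 1
    funext x
    simp [mul_add]
  | smul c y _ hy =>
    convert Submodule.smul_mem _ c hy using 1
    funext x
    simp only [Pi.smul_apply, smul_eq_mul]
    ring

variable [CharZero k]

theorem polyFun_injective : Function.Injective (polyFun (k := k) (n := n)) :=
  (injective_iff_map_eq_zero _).2 fun _ h => eq_zero_of_evalAt_GL fun x => congrFun h x

/-- A space of functions stable under both left and right translations, containing a nonzero regular
function, contains a function `∏ᵢ Δᵢ ^ (αᵢ - αᵢ₊₁)`. -/
theorem exists_highestWeightFunction_mem (Y : Submodule k (GL (Fin n) k → k))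
    (hY : ∀ g h : GL (Fin n) k, ∀ f ∈ Y, (fun x => f (g * x * h)) ∈ Y)
    {f : GL (Fin n) k → k} (hf : f ∈ Y) (hr : IsRegular f) (h0 : f ≠ 0) :
    ∃ α : Fin n → ℤ, Antitone α ∧ highestWeightFunction α ∈ Y := by
  obtain ⟨f₁, hf₁, h0₁, hr₁, α, hα⟩ := exists_isHighestWeight Y
    (fun b _ f hf => by
      have := hY 1 b f hf
      simp only [one_mul] at this
      exact this) hf hr h0
  -- the highest weight vectors of weight `α` in `Y` are stable under left translations
  let Y' : Submodule k (GL (Fin n) k → k) :=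
    { carrier := {f | f ∈ Y ∧ IsHighestWeight (functionsRep k n) α f}
      zero_mem' := ⟨zero_mem _, fun b _ => by simp⟩
      add_mem' := fun hf hg => ⟨add_mem hf.1 hg.1, fun b hb => by
        rw [map_add, hf.2 b hb, hg.2 b hb, smul_add]⟩
      smul_mem' := fun c f hf => ⟨Submodule.smul_mem _ c hf.1, fun b hb => by
        rw [map_smul, hf.2 b hb, smul_comm]⟩ }
  obtain ⟨f₂, hf₂, h0₂, hr₂, μ, hμ⟩ := exists_isLeftSemiinvariant Y'
    (fun b _ f hf => ⟨by simpa using hY b 1 f hf.1, isHighestWeight_functionsRep.2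
      fun x c hc => by
        rw [← mul_assoc]
        exact isHighestWeight_functionsRep.1 hf.2 (b * x) c hc⟩) ⟨hf₁, hα⟩ hr₁ h0₁
  obtain rfl := weight_eq_of_bigCell hr₂ h0₂ hf₂.2 hμ
  have ha := antitone_of_bigCell hr₂ h0₂ hf₂.2 hμ
  have h1 := ne_zero_of_bigCell hr₂ h0₂ hf₂.2 hμ
  refine ⟨μ, ha, ?_⟩
  have h2 := Y.smul_mem (f₂ 1)⁻¹ hf₂.1
  rwa [eq_smul_highestWeightFunction hr₂ ha hf₂.2 hμ, Pi.smul_apply, highestWeightFunction_one,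
    smul_eq_mul, mul_one, inv_smul_smul₀ h1] at h2

/-- If `∏ᵢ Δᵢ ^ (αᵢ - αᵢ₊₁)` is a polynomial function, then the weight `α` is nonnegative. -/
theorem nonneg_of_polyFun_eq {α : Fin n → ℤ} {P : MvPolynomial (Fin n × Fin n) k}
    (h : polyFun P = highestWeightFunction α) (i : Fin n) : 0 ≤ α i := by
  refine evalAt_exponent_nonneg P (Matrix.diagonal (Function.update 1 i 0))
    (Matrix.diagonal (Pi.single i 1)) (one_ne_zero (α := k)) (α i) fun s hs => ?_
  have ht : ∀ j, Function.update (1 : Fin n → k) i s j ≠ 0 := fun j => by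
    by_cases h : j = i
    · subst h; simpa
    · simp [h]
  have h1 := congrFun h (diagGL _ ht)
  have h2 := highestWeightFunction_lower_mul α (diagGL _ ht) 1 (Matrix.blockTriangular_diagonal _)
  rw [mul_one, highestWeightFunction_one, mul_one, Finset.prod_eq_single i] at h2
  · rw [h2, polyFun_apply, diagGL_val, Matrix.diagonal_apply_eq, Function.update_self] at h1
    rw [one_mul, ← h1]
    congr 2
    ext a b
    rw [Matrix.add_apply, Matrix.smul_apply]
    by_cases hab : a = b
    · subst hab
      by_cases hai : a = i
      · subst hai; simp
      · simp [hai]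
    · simp [hab]
  · intro j _ hj
    simp [diagGL_val, hj]
  · simp

/-- A functional that vanishes on a nonzero polynomial `F` with integer coefficients cannot have `F`
as its dual polynomial: its value at `F` would be a sum of squares of integers with positive rational
weights. -/
theorem dualPoly_ne_smul_map {d : ℕ} {φ : Module.Dual k (MvPolynomial (Fin n × Fin n) k)}
    {F : MvPolynomial (Fin n × Fin n) ℤ} (hF : F ≠ 0)
    (hφ : φ (map (Int.castRingHom k) F) = 0) :
    dualPoly d φ ≠ map (Int.castRingHom k) F := by
  intro h
  have hval : φ (map (Int.castRingHom k) F) = ((∑ m ∈ F.support,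
      (((coeff m F : ℤ) : ℚ) ^ 2 / (Nat.multinomial Finset.univ m : ℚ)) : ℚ) : k) := by
    conv_lhs => rw [F.as_sum]
    rw [map_sum, map_sum, Rat.cast_sum]
    refine Finset.sum_congr rfl fun m hm => ?_
    have hc : coeff m (dualPoly d φ) = ((coeff m F : ℤ) : k) := by rw [h, coeff_map]; rfl
    have hc0 : ((coeff m F : ℤ) : k) ≠ 0 := Int.cast_ne_zero.2 (mem_support_iff.1 hm)
    have hd := sum_eq_of_coeff_dualPoly_ne_zero d φ m (by rwa [hc])
    rw [coeff_dualPoly d φ m hd] at hc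
    have hm0 : (Nat.multinomial Finset.univ m : k) ≠ 0 :=
      Nat.cast_ne_zero.2 (Nat.multinomial_pos _ _).ne'
    have e : map (Int.castRingHom k) (monomial m (coeff m F)) = ((coeff m F : ℤ) : k) • monomial m 1 := by
      rw [map_monomial, smul_monomial, smul_eq_mul, mul_one]
      rfl
    rw [e, map_smul, smul_eq_mul]
    push_cast
    rw [eq_div_iff hm0, ← hc]
    ring
  rw [hval, Rat.cast_eq_zero] at hφ
  refine (Finset.sum_pos (fun m hm => ?_) ?_).ne' hφ
  · have h1 : ((coeff m F : ℤ) : ℚ) ≠ 0 := Int.cast_ne_zero.2 (mem_support_iff.1 hm)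
    have h2 : (0 : ℚ) < Nat.multinomial Finset.univ m := Nat.cast_pos.2 (Nat.multinomial_pos _ _)
    positivity
  · exact support_nonempty.2 hF

theorem highestWeightPoly_ne_zero {α : Fin n → ℤ} (hα : Antitone α) (h0 : ∀ i, 0 ≤ α i) :
    highestWeightPoly α ≠ 0 := fun h => by
  have := evalAt_highestWeightPoly (k := ℚ) hα h0 1
  rw [h, map_zero, map_zero, highestWeightFunction_one] at this
  exact zero_ne_one this

/-- A functional with zero dual polynomial vanishes on the homogeneous polynomials of degree `d`. -/
theorem eq_zero_of_dualPoly_eq_zero {d : ℕ}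
    {φ : Module.Dual k (MvPolynomial (Fin n × Fin n) k)} (h : dualPoly d φ = 0)
    {P : MvPolynomial (Fin n × Fin n) k} (hP : P.IsHomogeneous d) : φ P = 0 := by
  rw [P.as_sum, map_sum]
  refine Finset.sum_eq_zero fun m hm => ?_
  have hm' : ∑ ij, m ij = d := by
    simp [← hP (mem_support_iff.1 hm), Finsupp.weight_apply, Finsupp.sum_fintype]
  have h2 := coeff_dualPoly d φ m hm'
  rw [h, coeff_zero] at h2
  have hm0 : (Nat.multinomial Finset.univ m : k) ≠ 0 :=
    Nat.cast_ne_zero.2 (Nat.multinomial_pos _ _).ne'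
  have h3 := (mul_eq_zero.1 h2.symm).resolve_left hm0
  have e : monomial m (coeff m P) = coeff m P • monomial m (1 : k) := by
    rw [smul_monomial, smul_eq_mul, mul_one]
  rw [e, map_smul, h3, smul_zero]

variable (k n) in
/-- The polynomials whose functions lie in `translateSpan`. -/
def translatePolys : Submodule k (MvPolynomial (Fin n × Fin n) k) :=
  (translateSpan k n).comap polyFun

/-- The functions of the dual polynomials of the functionals vanishing on `translatePolys`. -/
def dualFunctions (d : ℕ) : Submodule k (GL (Fin n) k → k) :=
  ((translatePolys k n).dualAnnihilator.map (dualPoly d)).map polyFun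

omit [CharZero k] in
theorem mem_dualFunctions {d : ℕ} {f : GL (Fin n) k → k} : f ∈ dualFunctions d ↔
    ∃ ψ ∈ (translatePolys k n).dualAnnihilator, polyFun (dualPoly d ψ) = f := by
  rw [dualFunctions, Submodule.mem_map]
  simp only [Submodule.mem_map, exists_exists_and_eq_and]

omit [CharZero k] in
theorem dualFunctions_translate {d : ℕ} (g h : GL (Fin n) k) {f : GL (Fin n) k → k}
    (hf : f ∈ dualFunctions d) : (fun x => f (g * x * h)) ∈ dualFunctions d := by
  rw [mem_dualFunctions] at hf ⊢
  obtain ⟨ψ, hψ, hf⟩ := hf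
  refine ⟨ψ ∘ₗ (rightTranslate h.1.transpose).toLinearMap ∘ₗ
    (leftTranslate g.1.transpose).toLinearMap, ?_, ?_⟩
  · rw [Submodule.mem_dualAnnihilator] at hψ ⊢
    intro Q hQ
    exact hψ _ (polyFun_translate_mem g h hQ)
  · funext x
    rw [← hf, evalAt_dualPoly_translate]

omit [CharZero k] in
theorem highestWeightFunction_mem_translateSpan {α : Fin n → ℤ} (hα : Antitone α) :
    highestWeightFunction α ∈ translateSpan k n := by
  refine Submodule.subset_span ⟨α, hα, 1, 1, ?_⟩
  funext x
  rw [one_mul, mul_one]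

omit [CharZero k] in
theorem polyFun_highestWeightPoly {α : Fin n → ℤ} (hα : Antitone α) (h0 : ∀ i, 0 ≤ α i) :
    polyFun (map (Int.castRingHom k) (highestWeightPoly α)) = highestWeightFunction α := by
  funext x
  rw [polyFun_apply, evalAt_highestWeightPoly hα h0]

omit [CharZero k] in
theorem apply_eq_zero_of_mem_dualAnnihilator {ψ : Module.Dual k (MvPolynomial (Fin n × Fin n) k)}
    (hψ : ψ ∈ (translatePolys k n).dualAnnihilator) {Q : MvPolynomial (Fin n × Fin n) k}
    (hQ : polyFun Q ∈ translateSpan k n) : ψ Q = 0 :=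
  (Submodule.mem_dualAnnihilator _).1 hψ Q hQ

theorem dualPoly_eq_zero {d : ℕ} {φ : Module.Dual k (MvPolynomial (Fin n × Fin n) k)}
    (hφ : φ ∈ (translatePolys k n).dualAnnihilator) : dualPoly d φ = 0 := by
  by_contra h0
  obtain ⟨α, hα, hαY⟩ := exists_highestWeightFunction_mem (dualFunctions d)
    (fun g h f hf => dualFunctions_translate g h hf)
    (mem_dualFunctions.2 ⟨φ, hφ, rfl⟩) (isRegular_polyFun (dualPoly d φ))
    (fun h => h0 (polyFun_injective (h.trans (map_zero _).symm)))
  obtain ⟨ψ, hψ, hψα⟩ := mem_dualFunctions.1 hαY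
  have hnn := nonneg_of_polyFun_eq hψα
  have hF := polyFun_highestWeightPoly (k := k) hα hnn
  have h1 := highestWeightFunction_mem_translateSpan (k := k) hα
  rw [← hF] at h1
  have h2 := apply_eq_zero_of_mem_dualAnnihilator hψ h1
  have h3 := polyFun_injective (hψα.trans hF.symm)
  exact dualPoly_ne_smul_map (highestWeightPoly_ne_zero hα hnn) h2 h3

theorem polyFun_mem_translateSpan (P : MvPolynomial (Fin n × Fin n) k) :
    polyFun P ∈ translateSpan k n := by
  have key : ∀ d (P : MvPolynomial (Fin n × Fin n) k), P.IsHomogeneous d →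
      P ∈ translatePolys k n := by
    intro d P hP
    by_contra hPM
    obtain ⟨φ, hφ, hφM⟩ := Submodule.exists_le_ker_of_notMem hPM
    refine hφ (eq_zero_of_dualPoly_eq_zero (d := d) (dualPoly_eq_zero ?_) hP)
    rw [Submodule.mem_dualAnnihilator]
    exact fun Q hQ => LinearMap.mem_ker.1 (hφM hQ)
  have h : P ∈ translatePolys k n := by
    rw [← sum_homogeneousComponent P]
    exact Submodule.sum_mem _ fun d _ => key d _ (homogeneousComponent_isHomogeneous d P)
  exact h

/-- The Peter–Weyl theorem for `GLₙ`: the regular functions are spanned by the two-sided translates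
of the functions `∏ᵢ Δᵢ ^ (αᵢ - αᵢ₊₁)`. -/
theorem IsRegular.mem_translateSpan {f : GL (Fin n) k → k} (hf : IsRegular f) :
    f ∈ translateSpan k n := by
  obtain ⟨P, m, hP⟩ := hf
  have := translateSpan_det (polyFun_mem_translateSpan P) (-m)
  convert this using 1
  funext x
  have h1 := pow_ne_zero m x.det_ne_zero
  rw [polyFun_apply, ← hP, zpow_neg, zpow_natCast]
  field_simp

end PeterWeyl

/-! ### Contractions of relative differential forms with vector fields -/

/-- If `m = ∑ εᵢ(m) eᵢ` for all `m`, then an element of the exterior power of the module is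
determined by its pairings with the exterior products of the functionals `εᵢ`. -/
theorem exteriorPower_eq_zero {R M : Type*} [CommRing R] [AddCommGroup M] [Module R M] {n : ℕ}
    (ε : Fin n → Module.Dual R M) (e : Fin n → M) (h : ∀ m, ∑ i, ε i m • e i = m) {p : ℕ}
    (w : ⋀[R]^p M)
    (hw : ∀ I : Fin p → Fin n, exteriorPower.alternatingMapToDual R M p (fun a => ε (I a)) w = 0) :
    w = 0 := by
  have hs : Fintype.linearCombination R e ∘ₗ LinearMap.pi ε = LinearMap.id := by
    ext m
    rw [LinearMap.comp_apply, Fintype.linearCombination_apply]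
    exact h m
  have hnat : ∀ I : Fin p → Fin n,
      (exteriorPower.alternatingMapToDual R (Fin n → R) p (fun a => LinearMap.proj (I a))) ∘ₗ
        exteriorPower.map p (LinearMap.pi ε) =
          exteriorPower.alternatingMapToDual R M p (fun a => ε (I a)) := fun I => by
    ext m
    simp
  have h0 : exteriorPower.map p (LinearMap.pi ε) w = 0 := by
    rw [← LinearEquiv.map_eq_zero_iff ((Pi.basisFun R (Fin n)).exteriorPower p).repr]
    ext s
    rw [exteriorPower.basis_repr_apply, exteriorPower.ιMultiDual, exteriorPower.ιMulti_family,
      exteriorPower.pairingDual, exteriorPower.alternatingMapLinearEquiv_apply_ιMulti]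
    have h1 := hw (Set.powersetCard.ofFinEmbEquiv.symm s)
    rw [← hnat, LinearMap.comp_apply] at h1
    rw [Finsupp.zero_apply, ← h1]
    congr 2
  have := LinearMap.congr_fun (exteriorPower.map_comp (n := p) (LinearMap.pi ε)
    (Fintype.linearCombination R e)) w
  rw [hs, exteriorPower.map_id, LinearMap.id_apply, LinearMap.comp_apply, h0, map_zero] at this
  exact this

section Contraction

variable {S R : Type*} [CommRing S] [CommRing R] [Algebra S R] {n : ℕ}

variable (S R n) in
/-- The relative vector fields on the Jouanolou torsor, axiomatically: an `S`-algebra `R` generated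
by elements `z*_j`, with elements `z_j` of `S` such that `∑ z_j z*_j = 1`, and derivations of `R`
over `S` that behave as `∂/∂z*_i - z_i ∑ z*_j ∂/∂z*_j`. -/
structure Frame where
  /-- The elements `z_i`, seen in `R`. -/
  z : Fin n → R
  /-- The elements `z*_i`. -/
  dual : Fin n → R
  /-- The derivations `∂/∂z*_i - z_i ∑ z*_j ∂/∂z*_j`. -/
  field : Fin n → Derivation S R R
  z_mem : ∀ i, z i ∈ Set.range (algebraMap S R)
  sum_eq_one : ∑ i, z i * dual i = 1
  adjoin_eq_top : Algebra.adjoin S (Set.range dual) = ⊤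
  field_dual : ∀ i j, field i (dual j) = (if i = j then 1 else 0) - dual j * z i

namespace Frame

variable (T : Frame S R n)

/-- The relative differential `dz*_j`. -/
def d (j : Fin n) : Ω[R⁄S] := KaehlerDifferential.D S R (T.dual j)

/-- Semilinear maps on relative `1`-forms are determined by their values at the `dz*_j`. -/
theorem ext_d {σ : R →+* R} {N : Type*} [AddCommGroup N] [Module R N]
    {f g : Ω[R⁄S] →ₛₗ[σ] N} (h : ∀ j, f (T.d j) = g (T.d j)) : f = g := by
  refine LinearMap.ext_on_range (KaehlerDifferential.span_range_derivation S R) fun r => ?_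
  have hr : r ∈ Algebra.adjoin S (Set.range T.dual) := by rw [T.adjoin_eq_top]; trivial
  induction hr using Algebra.adjoin_induction with
  | mem x hx => obtain ⟨j, rfl⟩ := hx; exact h j
  | algebraMap s => rw [Derivation.map_algebraMap, map_zero, map_zero]
  | add p q _ _ hp hq => rw [map_add, map_add, map_add, hp, hq]
  | mul p q _ _ hp hq =>
    rw [Derivation.leibniz, map_add, map_add, map_smulₛₗ, map_smulₛₗ, map_smulₛₗ, map_smulₛₗ, hp,
      hq]

theorem sum_z_smul_d : ∑ i, T.z i • T.d i = 0 := by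
  have h := congrArg (KaehlerDifferential.D S R) T.sum_eq_one
  rw [map_sum, Derivation.map_one_eq_zero] at h
  rw [← h]
  refine Finset.sum_congr rfl fun i _ => ?_
  obtain ⟨s, hs⟩ := T.z_mem i
  rw [Derivation.leibniz, ← hs, Derivation.map_algebraMap, smul_zero, add_zero]
  rfl

/-- The contraction with the vector field `∑ v_i field i`. -/
def contract : (Fin n → R) →ₗ[R] Module.Dual R Ω[R⁄S] :=
  Fintype.linearCombination R fun i => (T.field i).liftKaehlerDifferential

theorem contract_d (v : Fin n → R) (j : Fin n) :
    T.contract v (T.d j) = v j - T.dual j * ∑ i, v i * T.z i := by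
  simp only [contract, d, Fintype.linearCombination_apply, LinearMap.sum_apply,
    LinearMap.smul_apply, Derivation.liftKaehlerDifferential_comp_D, field_dual, smul_eq_mul,
    mul_sub, Finset.sum_sub_distrib, mul_ite, mul_one, mul_zero, Finset.mul_sum]
  rw [Finset.sum_ite_eq', if_pos (Finset.mem_univ j)]
  congr 1
  exact Finset.sum_congr rfl fun i _ => by ring

theorem sum_contract_smul_d (w : Ω[R⁄S]) :
    ∑ i, T.contract (Pi.single i 1) w • T.d i = w := by
  have h : ∑ i, (T.contract (Pi.single i 1)).smulRight (T.d i) = LinearMap.id := by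
    refine T.ext_d fun j => ?_
    have e : ∀ i, ∑ l, (Pi.single i 1 : Fin n → R) l * T.z l = T.z i := fun i => by
      rw [Finset.sum_eq_single i (fun l _ hl => by simp [hl]) (by simp), Pi.single_eq_same,
        one_mul]
    simp only [LinearMap.sum_apply, LinearMap.smulRight_apply, contract_d, sub_smul, e, mul_smul]
    rw [Finset.sum_sub_distrib, ← Finset.smul_sum, T.sum_z_smul_d, smul_zero, sub_zero,
      Finset.sum_eq_single j (fun l _ hl => by simp [hl.symm]) (by simp), Pi.single_eq_same,
      one_smul, LinearMap.id_apply]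
  have h2 := LinearMap.congr_fun h w
  simpa only [LinearMap.sum_apply, LinearMap.smulRight_apply, LinearMap.id_apply] using h2

/-- The field `∑ z*_i field i` vanishes. -/
theorem contract_dual : T.contract T.dual = 0 := by
  refine T.ext_d fun j => ?_
  have : ∑ i, T.dual i * T.z i = 1 := by
    rw [← T.sum_eq_one]
    exact Finset.sum_congr rfl fun i _ => mul_comm _ _
  rw [contract_d, this, mul_one, sub_self, LinearMap.zero_apply]

/-- The contraction of relative `p`-forms with `p` vectors. -/
def contractForm (p : ℕ) : (Fin n → R) [⋀^Fin p]→ₗ[R] Module.Dual R (⋀[R]^p Ω[R⁄S]) :=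
  (exteriorPower.alternatingMapToDual R Ω[R⁄S] p).compLinearMap T.contract

theorem contractForm_ιMulti (p : ℕ) (v : Fin p → Fin n → R) (w : Fin p → Ω[R⁄S]) :
    T.contractForm p v (exteriorPower.ιMulti _ p w) =
      (Matrix.of fun a b => T.contract (v b) (w a)).det :=
  exteriorPower.alternatingMapToDual_apply_ιMulti _ _

theorem forms_eq_zero {p : ℕ} {w : ⋀[R]^p Ω[R⁄S]}
    (h : ∀ I : Fin p → Fin n, T.contractForm p (fun a => Pi.single (I a) 1) w = 0) : w = 0 :=
  exteriorPower_eq_zero (fun i => T.contract (Pi.single i 1)) T.d T.sum_contract_smul_d w h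

/-- The contraction vanishes if one of the vectors is `z*`. -/
theorem contractForm_eq_zero {p : ℕ} (v : Fin p → Fin n → R) (a : Fin p) (h : v a = T.dual) :
    T.contractForm p v = 0 := by
  rw [contractForm, AlternatingMap.compLinearMap_apply]
  exact AlternatingMap.map_coord_zero _ a (by rw [h, contract_dual])

section Equivariance

variable {τ : S →+* S} {σ : R →+* R} (h : ∀ s, σ (algebraMap S R s) = algebraMap S R (τ s))
  {g g' : Matrix (Fin n) (Fin n) R}

/-- The contraction is equivariant: the automorphism `σ` acts on vectors through the matrix `g`. -/
theorem contract_kaehlerMap (hg : g' * g = 1)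
    (hz : ∀ i, σ (T.z i) = ∑ j, g j i * T.z j) (hd : ∀ i, σ (T.dual i) = ∑ j, g' i j * T.dual j)
    (hgS : ∀ i j, ∃ c, g' i j = algebraMap S R c)
    {u v : Fin n → R} (hv : v = g.mulVec (fun i => σ (u i))) (w : Ω[R⁄S]) :
    T.contract v (kaehlerMap τ σ h w) = σ (T.contract u w) := by
  let f₁ : Ω[R⁄S] →ₛₗ[σ] R :=
    { toFun := fun w => T.contract v (kaehlerMap τ σ h w)
      map_add' := fun x y => by rw [map_add, map_add]
      map_smul' := fun c x => by rw [map_smulₛₗ, map_smul] }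
  let f₂ : Ω[R⁄S] →ₛₗ[σ] R :=
    { toFun := fun w => σ (T.contract u w)
      map_add' := fun x y => by rw [map_add, map_add]
      map_smul' := fun c x => by rw [map_smul, smul_eq_mul, map_mul]; rfl }
  suffices f₁ = f₂ from LinearMap.congr_fun this w
  refine T.ext_d fun j => ?_
  change T.contract v (kaehlerMap τ σ h (T.d j)) = σ (T.contract u (T.d j))
  have e1 : kaehlerMap τ σ h (T.d j) = ∑ l, g' j l • T.d l := by
    rw [d, kaehlerMap_D, hd, map_sum]
    refine Finset.sum_congr rfl fun l _ => ?_
    obtain ⟨c, hc⟩ := hgS j l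
    rw [Derivation.leibniz, hc, Derivation.map_algebraMap, smul_zero, add_zero, d]
  have e2 : ∑ l, g' j l * v l = σ (u j) := by
    have := congrFun (Matrix.mulVec_mulVec (fun i => σ (u i)) g' g) j
    rw [hg, Matrix.one_mulVec, ← hv] at this
    exact this
  have e3 : ∑ i, v i * T.z i = ∑ i, σ (u i) * σ (T.z i) := by
    simp only [hz, hv, Matrix.mulVec, dotProduct, Finset.sum_mul, Finset.mul_sum]
    rw [Finset.sum_comm]
    exact Finset.sum_congr rfl fun i _ => Finset.sum_congr rfl fun j _ => by ring
  simp only [e1, map_sum, map_smul, contract_d, smul_eq_mul, mul_sub, Finset.sum_sub_distrib,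
    map_sub, map_mul, e2, hd, Finset.sum_mul, map_sum, e3]
  congr 1
  exact Finset.sum_congr rfl fun i _ => by ring

theorem contractForm_formsMap (hg : g' * g = 1)
    (hz : ∀ i, σ (T.z i) = ∑ j, g j i * T.z j) (hd : ∀ i, σ (T.dual i) = ∑ j, g' i j * T.dual j)
    (hgS : ∀ i j, ∃ c, g' i j = algebraMap S R c) {p : ℕ}
    {u v : Fin p → Fin n → R} (hv : ∀ a, v a = g.mulVec (fun i => σ (u a i)))
    (w : ⋀[R]^p Ω[R⁄S]) :
    T.contractForm p v (formsMap p τ σ h w) = σ (T.contractForm p u w) := by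
  induction w using forms_induction with
  | zero => simp only [map_zero]
  | add x y hx hy => simp only [map_add, hx, hy]
  | smul r x hx => rw [map_smulₛₗ, map_smul, map_smul, smul_eq_mul, smul_eq_mul, map_mul, hx]
  | d b =>
    rw [formsMap, exteriorMap_ιMulti, contractForm_ιMulti, contractForm_ιMulti, RingHom.map_det]
    congr 1
    ext a b'
    simp only [Matrix.of_apply, RingHom.mapMatrix_apply, Matrix.map_apply]
    exact T.contract_kaehlerMap h hg hz hd hgS (hv b') _

end Equivariance

/-- A linear change of the contracting vectors multiplies the contraction by a determinant. -/
theorem contractForm_mul {p : ℕ} (v : Fin p → Fin n → R) (M : Matrix (Fin p) (Fin p) R)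
    (w : ⋀[R]^p Ω[R⁄S]) :
    T.contractForm p (fun b => ∑ c, M c b • v c) w = M.det * T.contractForm p v w := by
  induction w using forms_induction with
  | zero => simp only [map_zero, mul_zero]
  | add x y hx hy => simp only [map_add, hx, hy, mul_add]
  | smul r x hx => rw [map_smul, map_smul, hx, smul_eq_mul, smul_eq_mul]; ring
  | d b =>
    rw [contractForm_ιMulti, contractForm_ιMulti, mul_comm, ← Matrix.det_mul]
    congr 1
    ext a c
    simp only [Matrix.of_apply, Matrix.mul_apply, map_sum, map_smul, LinearMap.sum_apply,
      LinearMap.smul_apply, smul_eq_mul]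
    exact Finset.sum_congr rfl fun i _ => mul_comm _ _

section Evaluation

variable {k : Type*} [Field k] [Algebra k R] (ev : R →ₐ[k] k)

/-- The value of a contraction at a point depends only on the values of the vectors there. -/
theorem ev_contractForm_congr {p : ℕ} {u v : Fin p → Fin n → R}
    (huv : ∀ a i, ev (u a i) = ev (v a i)) (w : ⋀[R]^p Ω[R⁄S]) :
    ev (T.contractForm p u w) = ev (T.contractForm p v w) := by
  induction w using forms_induction with
  | zero => simp only [map_zero]
  | add x y hx hy => simp only [map_add, hx, hy]
  | smul r x hx =>
    rw [LinearMap.map_smul, LinearMap.map_smul, smul_eq_mul, smul_eq_mul, map_mul, map_mul, hx]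
  | d b =>
    rw [contractForm_ιMulti, contractForm_ιMulti, AlgHom.map_det, AlgHom.map_det]
    congr 1
    ext a c
    simp only [AlgHom.mapMatrix_apply, Matrix.map_apply, Matrix.of_apply, contract,
      Fintype.linearCombination_apply, LinearMap.sum_apply, LinearMap.smul_apply, map_sum,
      smul_eq_mul, map_mul, huv]

/-- The value at a point of the contraction of a `p`-form, as an alternating function of the
contracting vectors. -/
def evalForm (p : ℕ) (w : ⋀[R]^p Ω[R⁄S]) : (Fin n → k) [⋀^Fin p]→ₗ[k] k where
  toFun v := ev (T.contractForm p (fun a i => algebraMap k R (v a i)) w)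
  map_update_add' v a x y := by
    have e : ∀ x, (fun b i => algebraMap k R (Function.update v a x b i)) =
        Function.update (fun b i => algebraMap k R (v b i)) a fun i => algebraMap k R (x i) :=
      fun x => by
        funext b
        by_cases hb : b = a
        · subst hb; simp
        · simp [hb]
    have e2 : (fun i => algebraMap k R ((x + y) i)) =
        (fun i => algebraMap k R (x i)) + fun i => algebraMap k R (y i) := by
      funext i
      simp
    rw [e, e, e, e2, AlternatingMap.map_update_add, LinearMap.add_apply, map_add]
  map_update_smul' v a c x := by
    have e : ∀ x, (fun b i => algebraMap k R (Function.update v a x b i)) =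
        Function.update (fun b i => algebraMap k R (v b i)) a fun i => algebraMap k R (x i) :=
      fun x => by
        funext b
        by_cases hb : b = a
        · subst hb; simp
        · simp [hb]
    have e2 : (fun i => algebraMap k R ((c • x) i)) =
        algebraMap k R c • fun i => algebraMap k R (x i) := by
      funext i
      simp
    rw [e, e, e2, AlternatingMap.map_update_smul, LinearMap.smul_apply, smul_eq_mul, map_mul,
      AlgHom.commutes, smul_eq_mul]
    rfl
  map_eq_zero_of_eq' v a b h hab := by
    rw [AlternatingMap.map_eq_zero_of_eq _ _ (by simp [h]) hab, LinearMap.zero_apply, map_zero]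

theorem evalForm_apply (p : ℕ) (w : ⋀[R]^p Ω[R⁄S]) (v : Fin p → Fin n → k) :
    T.evalForm ev p w v = ev (T.contractForm p (fun a i => algebraMap k R (v a i)) w) := rfl

theorem evalForm_eq {p : ℕ} (w : ⋀[R]^p Ω[R⁄S]) (v : Fin p → Fin n → k) (u : Fin p → Fin n → R)
    (h : ∀ a i, v a i = ev (u a i)) : T.evalForm ev p w v = ev (T.contractForm p u w) :=
  T.ev_contractForm_congr ev (fun a i => by rw [AlgHom.commutes, h]; rfl) w

theorem evalForm_eq_zero {p : ℕ} (w : ⋀[R]^p Ω[R⁄S]) (v : Fin p → Fin n → k) (a : Fin p)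
    (h : ∀ i, v a i = ev (T.dual i)) : T.evalForm ev p w v = 0 := by
  rw [T.evalForm_eq ev w v (Function.update (fun b i => algebraMap k R (v b i)) a T.dual),
    T.contractForm_eq_zero _ a (Function.update_self _ _ _), LinearMap.zero_apply, map_zero]
  intro b i
  by_cases hb : b = a
  · subst hb; simp [h]
  · simp [hb]

theorem evalForm_mul {p : ℕ} (w : ⋀[R]^p Ω[R⁄S]) (v : Fin p → Fin n → k)
    (M : Matrix (Fin p) (Fin p) k) :
    T.evalForm ev p w (fun b => ∑ c, M c b • v c) = M.det * T.evalForm ev p w v := by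
  have h := T.contractForm_mul (fun c i => algebraMap k R (v c i)) (M.map (algebraMap k R)) w
  rw [T.evalForm_eq ev w _ fun b => ∑ c, M.map (algebraMap k R) c b • fun i =>
    algebraMap k R (v c i), h, map_mul, evalForm_apply, ← RingHom.mapMatrix_apply,
    ← RingHom.map_det, AlgHom.commutes]
  · rfl
  · intro b i
    simp only [Finset.sum_apply, Pi.smul_apply, smul_eq_mul, Matrix.map_apply, map_sum, map_mul,
      AlgHom.commutes]
    rfl

theorem evalForm_ιMulti {p : ℕ} (w : Fin p → Ω[R⁄S]) (v : Fin p → Fin n → k) :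
    T.evalForm ev p (exteriorPower.ιMulti R p w) v =
      (Matrix.of fun a b => ∑ i, v b i * ev ((T.field i).liftKaehlerDifferential (w a))).det := by
  rw [evalForm_apply, contractForm_ιMulti, AlgHom.map_det]
  congr 1
  ext a b
  simp only [contract, Fintype.linearCombination_apply, AlgHom.mapMatrix_apply, Matrix.map_apply,
    Matrix.of_apply, LinearMap.sum_apply, LinearMap.smul_apply, map_sum, smul_eq_mul, map_mul,
    AlgHom.commutes]
  rfl

/-- The value of a contraction of `r dz*_{j₁} ∧ ⋯ ∧ dz*_{j_p}`. -/
theorem evalForm_smul_ιMulti_d {p : ℕ} (r : R) (j : Fin p → Fin n) (v : Fin p → Fin n → k)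
    (hv : ∀ a, ∑ i, v a i * ev (T.z i) = 0) :
    T.evalForm ev p (r • exteriorPower.ιMulti R p (fun a => T.d (j a))) v =
      ev r * (Matrix.of fun a b => v b (j a)).det := by
  rw [evalForm_apply, map_smul, smul_eq_mul, map_mul, contractForm_ιMulti, AlgHom.map_det]
  congr 2
  ext a b
  have := hv b
  simp [contract_d, this]

end Evaluation

end Frame

end Contraction

/-! ### Functions on the Jouanolou torsor as functions on `GLₙ` -/

/-- If the `z a` generate the unit ideal, then an element killed by powers of all of them is zero. -/
theorem eq_zero_of_pow_mul_eq_zero {R : Type*} [CommRing R] {n : ℕ} {z u : Fin n → R}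
    (hzu : ∑ i, z i * u i = 1) {r : R} (h : ∀ a, ∃ N : ℕ, z a ^ N * r = 0) : r = 0 := by
  choose N hN using h
  have hspan : Ideal.span (Set.range z) = ⊤ := by
    rw [Ideal.eq_top_iff_one, ← hzu]
    exact Ideal.sum_mem _ fun i _ => Ideal.mul_mem_right _ _ (Ideal.subset_span ⟨i, rfl⟩)
  have h1 := Ideal.span_pow_eq_top _ hspan (∑ a, N a)
  have h2 : (1 : R) ∈ Ideal.span ((fun x => x ^ (∑ a, N a)) '' Set.range z) := by
    rw [h1]; trivial
  have h3 : Ideal.span ((fun x => x ^ (∑ a, N a)) '' Set.range z) ≤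
      LinearMap.ker (LinearMap.toSpanSingleton R R r) := by
    rw [Ideal.span, Submodule.span_le]
    rintro _ ⟨_, ⟨a, rfl⟩, rfl⟩
    have : N a ≤ ∑ a, N a := Finset.single_le_sum (fun _ _ => Nat.zero_le _) (Finset.mem_univ a)
    obtain ⟨c, hc⟩ := Nat.exists_eq_add_of_le this
    rw [SetLike.mem_coe, LinearMap.mem_ker, LinearMap.toSpanSingleton_apply, smul_eq_mul]
    simp only []
    rw [hc, pow_add, mul_right_comm, hN, zero_mul]
  have := h3 h2
  rwa [LinearMap.mem_ker, LinearMap.toSpanSingleton_apply, one_smul] at this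

section TorsorFunctions

open MvPolynomial

variable {k : Type*} [Field k] {n : ℕ}

/-- The function `z_i` on the Jouanolou torsor. -/
def coord (i : Fin n) : TorsorRing k n := algebraMap (BaseRing k n) _ (X i)

/-- The function `z*_i` on the Jouanolou torsor. -/
def dualCoord (i : Fin n) : TorsorRing k n := Ideal.Quotient.mk _ (X i)

theorem mk_C (s : BaseRing k n) :
    (Ideal.Quotient.mk (Ideal.span {equation k n}) (C s)) = algebraMap _ (TorsorRing k n) s := rfl

theorem sum_coord_mul_dualCoord :
    ∑ i, (coord i * dualCoord i : TorsorRing k n) = 1 := by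
  have h : Ideal.Quotient.mk (Ideal.span {equation k n}) (equation k n) = 0 :=
    Ideal.Quotient.eq_zero_iff_mem.2 (Ideal.subset_span rfl)
  conv_lhs at h => arg 2; rw [equation]
  rw [map_sub, map_sum, map_one, sub_eq_zero] at h
  rw [← h]
  exact Finset.sum_congr rfl fun i _ =>
    (map_mul (Ideal.Quotient.mk (Ideal.span {equation k n})) (C (X i)) (X i)).symm

/-- The derivation `∂/∂z*_i - z_i E` of `k[z, z*]`, where `E = ∑ z*_j ∂/∂z*_j`. -/
def fieldBig (i : Fin n) : Derivation (BaseRing k n) (BigRing k n) (BigRing k n) :=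
  mkDerivation _ fun j => (if i = j then 1 else 0) - X j * C (X i)

/-- The derivation `fieldBig i` preserves the ideal of the Jouanolou torsor. -/
theorem fieldBig_equation (i : Fin n) :
    fieldBig i (equation k n) = -C (X i) * equation k n := by
  have h : ∀ j, fieldBig i (C (X j) * X j : BigRing k n) =
      (if i = j then C (X j) else 0) - C (X i) * (C (X j) * X j) := fun j => by
    rw [Derivation.leibniz, derivation_C, smul_zero, add_zero, fieldBig, mkDerivation_X,
      smul_eq_mul, mul_sub]
    split_ifs <;> ring
  rw [equation, map_sub, map_sum, Derivation.map_one_eq_zero, sub_zero]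
  simp only [h]
  rw [Finset.sum_sub_distrib, Finset.sum_ite_eq, if_pos (Finset.mem_univ i), ← Finset.mul_sum]
  ring

theorem fieldBig_mem (i : Fin n) (x : BigRing k n)
    (hx : Ideal.Quotient.mkₐ (BaseRing k n) (Ideal.span {equation k n}) x = 0) :
    Ideal.Quotient.mkₐ (BaseRing k n) (Ideal.span {equation k n}) (fieldBig i x) = 0 := by
  rw [Ideal.Quotient.mkₐ_eq_mk, Ideal.Quotient.eq_zero_iff_mem,
    Ideal.mem_span_singleton] at hx ⊢
  obtain ⟨y, rfl⟩ := hx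
  rw [Derivation.leibniz, fieldBig_equation, smul_eq_mul, smul_eq_mul]
  exact dvd_add (dvd_mul_right _ _) (Dvd.intro (y * -C (X i)) (by ring))

/-- The relative vector field `∂/∂z*_i - z_i ∑ z*_j ∂/∂z*_j` on the Jouanolou torsor. -/
def field (i : Fin n) : Derivation (BaseRing k n) (TorsorRing k n) (TorsorRing k n) :=
  Derivation.liftOfSurjective (f := Ideal.Quotient.mkₐ (BaseRing k n) (Ideal.span {equation k n}))
    (d := fieldBig i) Ideal.Quotient.mk_surjective (fieldBig_mem i)

theorem field_dualCoord (i j : Fin n) : field i (dualCoord j : TorsorRing k n) =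
    (if i = j then 1 else 0) - dualCoord j * coord i := by
  refine (Derivation.liftOfSurjective_apply
    (f := Ideal.Quotient.mkₐ (BaseRing k n) (Ideal.span {equation k n}))
    (d := fieldBig i) Ideal.Quotient.mk_surjective (fieldBig_mem i) (X j)).trans ?_
  rw [fieldBig, mkDerivation_X, map_sub, map_mul]
  congr 1
  split_ifs <;> simp

theorem adjoin_dualCoord :
    Algebra.adjoin (BaseRing k n) (Set.range (dualCoord (k := k) (n := n))) = ⊤ := by
  have h := congrArg (Subalgebra.map (Ideal.Quotient.mkₐ (BaseRing k n)
    (Ideal.span {equation k n}))) (adjoin_range_X (R := BaseRing k n) (σ := Fin n))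
  rw [AlgHom.map_adjoin, ← Set.range_comp, Algebra.map_top,
    (AlgHom.range_eq_top _).2 (Ideal.Quotient.mkₐ_surjective _ _)] at h
  exact h

variable (k n) in
/-- The relative vector fields on the Jouanolou torsor. -/
def torsorFrame : Frame (BaseRing k n) (TorsorRing k n) n where
  z := coord
  dual := dualCoord
  field := field
  z_mem i := ⟨X i, rfl⟩
  sum_eq_one := sum_coord_mul_dualCoord
  adjoin_eq_top := adjoin_dualCoord
  field_dual := field_dualCoord

/-- The evaluation of elements of `k[z, z*]` at a point. -/
def evBig (z u : Fin n → k) : BigRing k n →ₐ[k] k where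
  toRingHom := eval₂Hom (aeval z : BaseRing k n →ₐ[k] k).toRingHom u
  commutes' c := by
    have : algebraMap k (BigRing k n) c = C (C c) := rfl
    rw [this]
    simp

theorem evBig_C (z u : Fin n → k) (s : BaseRing k n) : evBig z u (C s) = eval z s := by
  change eval₂Hom (aeval z : BaseRing k n →ₐ[k] k).toRingHom u (C s) = _
  simp

theorem evBig_X (z u : Fin n → k) (i : Fin n) : evBig z u (X i) = u i := by
  change eval₂Hom (aeval z : BaseRing k n →ₐ[k] k).toRingHom u (X i) = _
  simp

theorem evBig_equation (z u : Fin n → k) : evBig z u (equation k n) = ∑ i, z i * u i - 1 := by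
  simp only [equation, map_sub, map_sum, map_mul, map_one, evBig_C, evBig_X, eval_X]

/-- The evaluation of functions on the Jouanolou torsor at the point given by the first row of `x`
and the first column of `x⁻¹`. -/
def evTorsor [NeZero n] (x : GL (Fin n) k) : TorsorRing k n →ₐ[k] k :=
  Ideal.Quotient.liftₐ _ (evBig (fun i => x.1 0 i) fun i => (x⁻¹).1 i 0) (by
    intro a ha
    obtain ⟨b, rfl⟩ := Ideal.mem_span_singleton.1 ha
    have h : ∑ i, x.1 0 i * (x⁻¹).1 i 0 = 1 := by
      rw [← Matrix.mul_apply, ← Units.val_mul, mul_inv_cancel, Units.val_one, Matrix.one_apply_eq]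
    rw [map_mul, evBig_equation, h, sub_self, zero_mul])

theorem evTorsor_mk [NeZero n] (x : GL (Fin n) k) (r : BigRing k n) :
    evTorsor x (Ideal.Quotient.mk _ r) =
      evBig (fun i => x.1 0 i) (fun i => (x⁻¹).1 i 0) r := rfl

theorem evTorsor_coord [NeZero n] (x : GL (Fin n) k) (i : Fin n) :
    evTorsor x (coord i) = x.1 0 i := by
  rw [coord, ← mk_C, evTorsor_mk, evBig_C, eval_X]

theorem evTorsor_dualCoord [NeZero n] (x : GL (Fin n) k) (i : Fin n) :
    evTorsor x (dualCoord i) = (x⁻¹).1 i 0 := by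
  rw [dualCoord, evTorsor_mk, evBig_X]

theorem actTorsor_coord (g : GL (Fin n) k) (i : Fin n) :
    actTorsor g (coord i) = ∑ j, algebraMap k _ (g.1 j i) * coord j := by
  rw [coord, actTorsor_algebraMap, actBase_X, map_sum]
  exact Finset.sum_congr rfl fun j _ => map_mul _ _ _

theorem actTorsor_dualCoord (g : GL (Fin n) k) (i : Fin n) :
    actTorsor g (dualCoord i) = ∑ j, algebraMap k _ ((g⁻¹).1 i j) * dualCoord j := by
  rw [dualCoord, actTorsor_mk, actBig_X, map_sum]
  exact Finset.sum_congr rfl fun j _ => map_mul _ _ _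

theorem evTorsor_actTorsor [NeZero n] (x g : GL (Fin n) k) (r : TorsorRing k n) :
    evTorsor x (actTorsor g r) = evTorsor (x * g) r := by
  obtain ⟨r, rfl⟩ := Ideal.Quotient.mk_surjective r
  have h : ((evBig (fun i => x.1 0 i) fun i => (x⁻¹).1 i 0).toRingHom.comp (actBig g)) =
      (evBig (fun i => (x * g).1 0 i) fun i => ((x * g)⁻¹).1 i 0).toRingHom := by
    refine MvPolynomial.ringHom_ext' ?_ fun i => ?_
    · refine MvPolynomial.ringHom_ext (fun c => ?_) fun i => ?_
      · simp [actBig_C, evBig_C, algHom_C]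
      · simp [actBig_C, evBig_C, actBase_X, Matrix.mul_apply, mul_comm]
    · simp [actBig_X, evBig_C, evBig_X, Matrix.mul_apply, mul_inv_rev]
  rw [actTorsor_mk, evTorsor_mk, evTorsor_mk]
  exact RingHom.congr_fun h r

theorem isRegular_evTorsor [NeZero n] (r : TorsorRing k n) :
    IsRegular fun x : GL (Fin n) k => evTorsor x r := by
  obtain ⟨r, rfl⟩ := Ideal.Quotient.mk_surjective r
  simp only [evTorsor_mk]
  induction r using MvPolynomial.induction_on with
  | C s =>
    simp only [evBig_C]
    induction s using MvPolynomial.induction_on with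
    | C c => simpa only [eval_C] using isRegular_const c
    | add p q hp hq =>
      simp only [map_add]
      exact hp.add hq
    | mul_X p i hp =>
      simp only [map_mul, eval_X]
      exact hp.mul (isRegular_entry 0 i)
  | add p q hp hq =>
    simp only [map_add]
    exact hp.add hq
  | mul_X p i hp =>
    simp only [map_mul, evBig_X]
    exact hp.mul (isRegular_inv_entry i 0)

/-- A pair `(z, u)` with `∑ zᵢ uᵢ = 1` and `z_a ≠ 0` consists of the first row of an invertible matrix
and the first column of its inverse: the other rows may be taken to be `e_l - u_l z` for `l ≠ a`, up
to their order. -/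
theorem exists_row_col [NeZero n] (z u : Fin n → k) (h : ∑ i, z i * u i = 1) (a : Fin n)
    (ha : z a ≠ 0) :
    ∃ x : GL (Fin n) k, (∀ i, x.1 0 i = z i) ∧ ∀ i, (x⁻¹).1 i 0 = u i := by
  let M : Matrix (Fin n) (Fin n) k := Matrix.of fun l j =>
    if l = a then z j else (if l = j then 1 else 0) - u l * z j
  let N : Matrix (Fin n) (Fin n) k := Matrix.of fun j l =>
    if l = a then u j else (if j = l then 1 else 0) - (if j = a then z l / z a else 0)
  have hMN : M * N = 1 := by
    ext l m
    rw [Matrix.mul_apply, Matrix.one_apply]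
    simp only [M, N, Matrix.of_apply]
    have e1 : ∑ j, z j * ((if j = m then 1 else 0) - (if j = a then z m / z a else 0)) = 0 := by
      simp only [mul_sub, mul_ite, mul_one, mul_zero, Finset.sum_sub_distrib, Finset.sum_ite_eq',
        Finset.mem_univ, if_true]
      field_simp
      ring
    by_cases hl : l = a <;> by_cases hm : m = a
    · simp [hl, hm, h]
    · simp only [hl, hm, if_true, if_false]
      rw [e1, if_neg (Ne.symm hm)]
    · simp only [hl, hm, if_true, if_false, sub_mul, Finset.sum_sub_distrib, mul_assoc,
        ← Finset.mul_sum, h]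
      simp
    · simp only [hl, hm, if_false, sub_mul, Finset.sum_sub_distrib, mul_assoc, ← Finset.mul_sum,
        e1]
      simp [hl]
  have hNM : N * M = 1 := mul_eq_one_comm.1 hMN
  let s := Equiv.swap 0 a
  refine ⟨⟨M.submatrix s id, N.submatrix id s, ?_, ?_⟩, fun i => ?_, fun i => ?_⟩
  · have := Matrix.submatrix_mul_equiv M N s (Equiv.refl _) s
    rw [hMN, Matrix.submatrix_one_equiv] at this
    exact this
  · have := Matrix.submatrix_mul_equiv N M (id : Fin n → Fin n) s (id : Fin n → Fin n)
    rw [this, hNM, Matrix.submatrix_one _ Function.injective_id]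
  · simp [M, s]
  · change N i (s 0) = u i
    simp [N, s]

variable [CharZero k]

theorem eq_zero_of_evBig {q : BigRing k n} (h : ∀ z u, evBig z u q = 0) : q = 0 := by
  have h1 : ∀ z : Fin n → k, map (eval z) q = 0 := fun z => by
    refine MvPolynomial.funext fun u => ?_
    rw [map_zero, ← h z u, eval_map]
    rfl
  ext m : 1
  refine MvPolynomial.funext fun z => ?_
  have := congrArg (coeff m) (h1 z)
  rwa [coeff_map] at this

/-- A function on the Jouanolou torsor is determined by its values at the points defined by
invertible matrices. Where `z_a ≠ 0`, the coordinate `z*_a` can be eliminated. -/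
theorem eq_zero_of_evTorsor [NeZero n] {r : TorsorRing k n}
    (h : ∀ x : GL (Fin n) k, evTorsor x r = 0) : r = 0 := by
  classical
  have key : ∀ a : Fin n, ∃ N : ℕ, coord a ^ N * r = 0 := fun a => by
    -- the substitution `z*_a = 0`
    let θ : BigRing k n →ₐ[BaseRing k n] BigRing k n :=
      aeval fun j => if j = a then 0 else X j
    -- up to powers of `z_a`, every function is the class of a polynomial free of `z*_a`
    have helim : ∀ r : BigRing k n, ∃ (N : ℕ) (q : BigRing k n),
        coord a ^ N * Ideal.Quotient.mk (Ideal.span {equation k n}) r =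
          Ideal.Quotient.mk (Ideal.span {equation k n}) (θ q) := fun r => by
      induction r using MvPolynomial.induction_on with
      | C s => exact ⟨0, C s, by rw [pow_zero, one_mul]; simp [θ]⟩
      | add p q hp hq =>
        obtain ⟨N₁, q₁, h₁⟩ := hp
        obtain ⟨N₂, q₂, h₂⟩ := hq
        refine ⟨N₁ + N₂, C (X a) ^ N₂ * q₁ + C (X a) ^ N₁ * q₂, ?_⟩
        have hθ : ∀ N, Ideal.Quotient.mk (Ideal.span {equation k n}) (θ (C (X a) ^ N)) =
            coord a ^ N := fun N => by simp [θ, coord, mk_C]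
        rw [map_add, map_add, map_add, map_mul, map_mul, map_mul, map_mul, hθ, hθ, ← h₁, ← h₂]
        ring
      | mul_X p j hp =>
        obtain ⟨N, q, hq⟩ := hp
        have hdual : ∀ j ≠ a, Ideal.Quotient.mk (Ideal.span {equation k n}) (θ (X j)) =
            dualCoord j := fun j hj => by simp [θ, hj, dualCoord]
        by_cases hj : j = a
        · subst hj
          refine ⟨N + 1, q * (1 - ∑ i ∈ Finset.univ.erase j, C (X i) * X i), ?_⟩
          have e : Ideal.Quotient.mk (Ideal.span {equation k n})
              (θ (1 - ∑ i ∈ Finset.univ.erase j, C (X i) * X i)) =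
                coord j * dualCoord j := by
            have h1 := sum_coord_mul_dualCoord (k := k) (n := n)
            rw [← Finset.add_sum_erase _ _ (Finset.mem_univ j)] at h1
            rw [map_sub, map_sub, map_one, map_one, map_sum, map_sum, ← h1]
            rw [add_sub_assoc, add_eq_left, sub_eq_zero]
            refine Finset.sum_congr rfl fun i hi => ?_
            rw [map_mul, map_mul, hdual i (Finset.ne_of_mem_erase hi)]
            simp [θ, coord, mk_C]
          rw [map_mul, map_mul, map_mul, e, ← hq, pow_succ, dualCoord]
          ring
        · refine ⟨N, q * X j, ?_⟩
          rw [map_mul, map_mul, map_mul, hdual j hj, ← hq, dualCoord]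
          ring
    obtain ⟨r, rfl⟩ := Ideal.Quotient.mk_surjective r
    obtain ⟨N, q, hq⟩ := helim r
    refine ⟨N, ?_⟩
    rw [hq]
    have hθev : ∀ z u, evBig z u (θ q) = evBig z (Function.update u a 0) q := fun z u => by
      have : ((evBig z u).toRingHom.comp θ.toRingHom) =
          (evBig z (Function.update u a 0)).toRingHom := by
        refine MvPolynomial.ringHom_ext (fun s => ?_) fun i => ?_
        · simp [θ, evBig_C]
        · by_cases hi : i = a
          · subst hi; simp [θ, evBig_X]
          · simp [θ, evBig_X, hi]
      exact RingHom.congr_fun this q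
    -- where `z_a ≠ 0`, the value of `z*_a` can be chosen so that the point lies on the torsor
    have h0 : C (X a) * θ q = 0 := eq_zero_of_evBig fun z u => by
      rw [map_mul, evBig_C, eval_X, mul_eq_zero, or_iff_not_imp_left]
      intro hza
      let u' := Function.update u a ((1 - ∑ i ∈ Finset.univ.erase a, z i * u i) / z a)
      have hu' : ∑ i, z i * u' i = 1 := by
        rw [← Finset.add_sum_erase _ _ (Finset.mem_univ a)]
        have : ∑ i ∈ Finset.univ.erase a, z i * u' i = ∑ i ∈ Finset.univ.erase a, z i * u i :=
          Finset.sum_congr rfl fun i hi => by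
            simp only [u', Function.update_of_ne (Finset.ne_of_mem_erase hi)]
        rw [this]
        simp only [u', Function.update_self]
        field_simp
        ring
      obtain ⟨x, hx1, hx2⟩ := exists_row_col z u' hu' a hza
      have h1 := congrArg (evTorsor x) hq
      rw [map_mul, h x, mul_zero, evTorsor_mk] at h1
      simp only [hx1, hx2] at h1
      rw [hθev] at h1 ⊢
      refine Eq.trans ?_ h1.symm
      congr 2
      simp [u']
    rw [mul_eq_zero] at h0
    have h2 : θ q = 0 := h0.resolve_left fun hC => X_ne_zero a
      (C_injective _ _ (hC.trans C_0.symm))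
    rw [h2, map_zero]
  have h1 := torsorFrame k n |>.sum_eq_one
  refine eq_zero_of_pow_mul_eq_zero (R := TorsorRing k n) h1 fun a => ?_
  obtain ⟨N, hN⟩ := key a
  exact ⟨N, hN⟩

end TorsorFunctions

/-! ### Relative differential forms as regular functions on `GLₙ` -/

section FormFunctions

variable {k : Type*} [Field k] {n : ℕ}

/-- The index `n - p + a`, that is, the `a`-th of the last `p` indices. -/
def lastIdx {p : ℕ} (hp : p ≤ n) (a : Fin p) : Fin n := ⟨n - p + a, by omega⟩

theorem lastIdx_injective {p : ℕ} (hp : p ≤ n) : Function.Injective (lastIdx hp) := fun a b h => by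
  have := congrArg Fin.val h
  simp only [lastIdx] at this
  ext
  omega

theorem lastIdx_strictMono {p : ℕ} (hp : p ≤ n) : StrictMono (lastIdx hp) := fun a b h => by
  simp only [lastIdx, Fin.lt_def] at h ⊢
  omega

theorem mem_range_lastIdx {p : ℕ} (hp : p ≤ n) (i : Fin n) (hi : n - p ≤ i) :
    ∃ a, lastIdx hp a = i :=
  ⟨⟨i - (n - p), by omega⟩, by ext; simp only [lastIdx]; omega⟩

theorem IsRegular.sum_apply {ι : Type*} (s : Finset ι) {f : ι → GL (Fin n) k → k}
    (hf : ∀ i ∈ s, IsRegular (f i)) : IsRegular fun x => ∑ i ∈ s, f i x := by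
  have := IsRegular.sum s hf
  rwa [Finset.sum_fn] at this

theorem isRegular_det {p : ℕ} {M : GL (Fin n) k → Matrix (Fin p) (Fin p) k}
    (hM : ∀ a b, IsRegular fun x => M x a b) : IsRegular fun x => (M x).det := by
  simp only [Matrix.det_apply']
  refine IsRegular.sum_apply _ fun σ _ => (isRegular_const _).mul ?_
  have := IsRegular.prod Finset.univ fun i (_ : i ∈ Finset.univ) => hM (σ i) i
  rwa [Finset.prod_fn] at this

variable [NeZero n]

theorem lastIdx_ne_zero {p : ℕ} (hp : p < n) (a : Fin p) : lastIdx hp.le a ≠ 0 := fun h => by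
  have := congrArg Fin.val h
  simp only [lastIdx, Fin.val_zero] at this
  omega

/-- The value at `x` of the contraction of a `p`-form with constant vectors. -/
def formEval (p : ℕ) (w : Forms k n p) (x : GL (Fin n) k) : (Fin n → k) [⋀^Fin p]→ₗ[k] k :=
  (torsorFrame k n).evalForm (evTorsor x) p w

/-- The function on `GLₙ` attached to a relative `p`-form: its value at `x` is that of the
contraction with the last `p` columns of `x⁻¹`, at the point of the Jouanolou torsor given by the
first row of `x` and the first column of `x⁻¹`. -/
def formFun {p : ℕ} (hp : p < n) : Forms k n p →ₗ[k] (GL (Fin n) k → k) where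
  toFun w x := formEval p w x fun a i => (x⁻¹).1 i (lastIdx hp.le a)
  map_add' w w' := by
    funext x
    simp only [formEval, Frame.evalForm_apply, map_add, Pi.add_apply]
  map_smul' c w := by
    funext x
    rw [← algebraMap_smul (TorsorRing k n) c w]
    simp only [formEval, Frame.evalForm_apply, LinearMap.map_smul, smul_eq_mul, map_mul,
      AlgHom.commutes, Pi.smul_apply, RingHom.id_apply]
    rfl

theorem formFun_apply {p : ℕ} (hp : p < n) (w : Forms k n p) (x : GL (Fin n) k) :
    formFun hp w x = formEval p w x fun a i => (x⁻¹).1 i (lastIdx hp.le a) := rfl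

theorem formFun_formsRep {p : ℕ} (hp : p < n) (g : GL (Fin n) k) (w : Forms k n p) :
    formFun hp (formsRep k n p g w) = functionsRep k n g (formFun hp w) := by
  funext x
  change (torsorFrame k n).evalForm (evTorsor x) p (actForms p g w)
    (fun a i => (x⁻¹).1 i (lastIdx hp.le a)) = (torsorFrame k n).evalForm (evTorsor (x * g)) p w
    (fun a i => ((x * g)⁻¹).1 i (lastIdx hp.le a))
  rw [Frame.evalForm_apply, Frame.evalForm_apply, ← evTorsor_actTorsor]
  congr 1
  refine (torsorFrame k n).contractForm_formsMap (actTorsor_algebraMap g)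
    (g := g.1.map (algebraMap k (TorsorRing k n)))
    (g' := (g⁻¹).1.map (algebraMap k (TorsorRing k n))) ?_ (actTorsor_coord g)
    (actTorsor_dualCoord g) (fun i j => ⟨MvPolynomial.C ((g⁻¹).1 i j), rfl⟩) (fun a => ?_) w
  · rw [← Matrix.map_mul, ← Units.val_mul, inv_mul_cancel, Units.val_one, Matrix.map_one _
      (map_zero _) (map_one _)]
  · funext i
    simp only [actTorsor_scalar, Matrix.mulVec, dotProduct, Matrix.map_apply]
    simp only [← map_mul, ← map_sum]
    congr 1
    rw [← Matrix.mul_apply, ← Units.val_mul, mul_inv_rev, mul_inv_cancel_left]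

theorem isRegular_formFun {p : ℕ} (hp : p < n) (w : Forms k n p) : IsRegular (formFun hp w) := by
  suffices H : IsRegular fun x : GL (Fin n) k =>
      (torsorFrame k n).evalForm (evTorsor x) p w fun a i => (x⁻¹).1 i (lastIdx hp.le a) from H
  induction w using forms_induction with
  | zero =>
    simp only [Frame.evalForm_apply, map_zero]
    exact isRegular_zero
  | add x y hx hy =>
    simp only [Frame.evalForm_apply, map_add] at hx hy ⊢
    exact hx.add hy
  | smul r x hx =>
    simp only [Frame.evalForm_apply, LinearMap.map_smul, smul_eq_mul, map_mul] at hx ⊢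
    exact (isRegular_evTorsor r).mul hx
  | d b =>
    simp only [Frame.evalForm_ιMulti]
    refine isRegular_det fun a b => ?_
    simp only [Matrix.of_apply]
    exact IsRegular.sum_apply _ fun i _ =>
      (isRegular_inv_entry i (lastIdx hp.le b)).mul (isRegular_evTorsor _)

/-- Permuting the columns of `x⁻¹` without moving the first one does not change the point of the
Jouanolou torsor. -/
theorem exists_perm_GL (x : GL (Fin n) k) (π : Equiv.Perm (Fin n)) (h0 : π 0 = 0) :
    ∃ y : GL (Fin n) k, evTorsor y = evTorsor x ∧ ∀ i j, (y⁻¹).1 i j = (x⁻¹).1 i (π j) := by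
  have h1 : x.1 * (x⁻¹).1 = 1 := by rw [← Units.val_mul, mul_inv_cancel, Units.val_one]
  have h2 : (x⁻¹).1 * x.1 = 1 := by rw [← Units.val_mul, inv_mul_cancel, Units.val_one]
  refine ⟨⟨x.1.submatrix π id, (x⁻¹).1.submatrix id π, ?_, ?_⟩, ?_, fun i j => rfl⟩
  · have := Matrix.submatrix_mul_equiv x.1 (x⁻¹).1 π (Equiv.refl _) π
    rw [h1, Matrix.submatrix_one_equiv] at this
    exact this
  · have := Matrix.submatrix_mul_equiv (x⁻¹).1 x.1 (id : Fin n → Fin n) π (id : Fin n → Fin n)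
    rw [h2, Matrix.submatrix_one _ Function.injective_id] at this
    exact this
  · ext r
    obtain ⟨r, rfl⟩ := Ideal.Quotient.mk_surjective r
    rw [evTorsor_mk, evTorsor_mk]
    congr 2
    · funext i
      change x.1 (π 0) i = x.1 0 i
      rw [h0]
    · funext i
      change (x⁻¹).1 i (π 0) = (x⁻¹).1 i 0
      rw [h0]

theorem exists_perm_extend {p : ℕ} (hp : p < n) (v : Fin p → Fin n) (hv : Function.Injective v)
    (h0 : ∀ a, v a ≠ 0) : ∃ π : Equiv.Perm (Fin n), π 0 = 0 ∧ ∀ a, π (lastIdx hp.le a) = v a := by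
  have := Equiv.Perm.isMultiplyPretransitive (Fin n) (p + 1)
  let e₁ : Fin (p + 1) ↪ Fin n := ⟨Fin.cons 0 (lastIdx hp.le), Fin.cons_injective_iff.2
    ⟨fun ⟨a, ha⟩ => lastIdx_ne_zero hp a ha, lastIdx_injective hp.le⟩⟩
  let e₂ : Fin (p + 1) ↪ Fin n := ⟨Fin.cons 0 v, Fin.cons_injective_iff.2
    ⟨fun ⟨a, ha⟩ => h0 a ha, hv⟩⟩
  obtain ⟨π, hπ⟩ := MulAction.exists_smul_eq (Equiv.Perm (Fin n)) e₁ e₂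
  have h : ∀ a, π (e₁ a) = e₂ a := fun a => DFunLike.congr_fun hπ a
  exact ⟨π, by simpa [e₁, e₂] using h 0, fun a => by simpa [e₁, e₂] using h a.succ⟩

/-- An alternating form on `kⁿ` is determined by its values at the columns of `x⁻¹`. The value is zero
if the first column occurs, and the other columns can be moved to the last places. -/
theorem formEval_eq_zero {p : ℕ} (hp : p < n) {w : Forms k n p} (h : formFun hp w = 0)
    (x : GL (Fin n) k) : formEval p w x = 0 := by
  have h2 : x.1 * (x⁻¹).1 = 1 := by rw [← Units.val_mul, mul_inv_cancel, Units.val_one]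
  have h3 : (x⁻¹).1 * x.1 = 1 := by rw [← Units.val_mul, inv_mul_cancel, Units.val_one]
  let e : Module.Basis (Fin n) k (Fin n → k) := (Pi.basisFun k (Fin n)).map
    (Matrix.toLin'OfInv h2 h3)
  have he : ∀ j, e j = fun i => (x⁻¹).1 i j := fun j => by
    funext i
    simp only [e, Module.Basis.map_apply, Pi.basisFun_apply]
    change Matrix.toLin' (x⁻¹).1 (Pi.single j 1) i = _
    rw [Matrix.toLin'_apply, Matrix.mulVec_single_one]
    rfl
  refine Module.Basis.ext_alternating e fun v hv => ?_
  simp only [he, AlternatingMap.zero_apply]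
  by_cases h0 : ∃ a, v a = 0
  · obtain ⟨a, ha⟩ := h0
    refine (torsorFrame k n).evalForm_eq_zero (evTorsor x) w _ a fun i => ?_
    rw [ha]
    exact (evTorsor_dualCoord x i).symm
  · push Not at h0
    obtain ⟨π, hπ0, hπ⟩ := exists_perm_extend hp v hv h0
    obtain ⟨y, hy1, hy2⟩ := exists_perm_GL x π hπ0
    have := congrFun h y
    rw [formFun_apply, formEval, hy1] at this
    simp only [hy2, hπ] at this
    exact this

/-- The contractions of a form with all coordinate vectors vanish on the torsor as soon as the
contractions with the last columns of `x⁻¹` do. -/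
theorem formFun_injective [CharZero k] {p : ℕ} (hp : p < n) :
    Function.Injective (formFun (k := k) hp) := by
  refine (injective_iff_map_eq_zero _).2 fun w hw => ?_
  refine (torsorFrame k n).forms_eq_zero fun I => eq_zero_of_evTorsor fun x => ?_
  have h := DFunLike.congr_fun (formEval_eq_zero hp hw x) fun a => Pi.single (I a) 1
  rw [formEval, Frame.evalForm_eq _ _ w _ fun a => Pi.single (I a) 1] at h
  · exact h
  · intro a i
    by_cases hi : i = I a
    · subst hi; simp
    · simp [hi]

/-- The lower triangular matrices whose first column is that of the identity matrix. They fix the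
point `(e₁, e₁*)` of the Jouanolou torsor. -/
def IsLowerStabilizer (h : GL (Fin n) k) : Prop :=
  h.1.BlockTriangular OrderDual.toDual ∧ ∀ i, h.1 i 0 = if i = 0 then 1 else 0

omit [NeZero n] in
theorem inv_lower {h : GL (Fin n) k} (hh : h.1.BlockTriangular OrderDual.toDual) :
    (h⁻¹).1.BlockTriangular OrderDual.toDual := by
  have : (h⁻¹).1 = h.1⁻¹ := Matrix.coe_units_inv h
  rw [this]
  have : Invertible h.1 := h.invertible
  exact Matrix.blockTriangular_inv_of_blockTriangular hh

omit [NeZero n] in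
theorem inv_lower_diag {h : GL (Fin n) k} (hh : h.1.BlockTriangular OrderDual.toDual)
    (i : Fin n) : (h⁻¹).1 i i = (h.1 i i)⁻¹ := by
  have h1 : ((h⁻¹).1 * h.1) i i = 1 := by
    rw [← Units.val_mul, inv_mul_cancel, Units.val_one, Matrix.one_apply_eq]
  rw [Matrix.mul_apply, Finset.sum_eq_single i] at h1
  · exact eq_inv_of_mul_eq_one_left h1
  · intro j _ hj
    rcases lt_or_gt_of_ne hj with hj | hj
    · rw [hh (OrderDual.toDual_lt_toDual.2 hj), mul_zero]
    · rw [inv_lower hh (OrderDual.toDual_lt_toDual.2 hj), zero_mul]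
  · simp

theorem evTorsor_lower_mul {h : GL (Fin n) k} (hh : IsLowerStabilizer h) (x : GL (Fin n) k) :
    evTorsor (h * x) = evTorsor x := by
  have h00 : h.1 0 0 = 1 := by rw [hh.2]; simp
  have hrow : ∀ j, h.1 0 j = if j = 0 then 1 else 0 := fun j => by
    by_cases hj : j = 0
    · subst hj; simp [h00]
    · rw [if_neg hj]
      exact hh.1 (OrderDual.toDual_lt_toDual.2 (Fin.pos_iff_ne_zero.2 hj))
  have hcol : ∀ j, (h⁻¹).1 j 0 = if j = 0 then 1 else 0 := fun j => by
    have h1 : ((h⁻¹).1 * h.1) j 0 = if j = 0 then 1 else 0 := by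
      rw [← Units.val_mul, inv_mul_cancel, Units.val_one, Matrix.one_apply]
    rw [Matrix.mul_apply] at h1
    simpa [hh.2] using h1
  ext r
  obtain ⟨r, rfl⟩ := Ideal.Quotient.mk_surjective r
  rw [evTorsor_mk, evTorsor_mk]
  congr 2
  · funext i
    rw [Units.val_mul, Matrix.mul_apply]
    simp [hrow]
  · funext i
    rw [mul_inv_rev, Units.val_mul, Matrix.mul_apply]
    simp [hcol]

/-- The matrix `h` fixes the base point and acts on the last `p` columns of `x⁻¹` through a triangular
matrix. -/
theorem formFun_lower_mul {p : ℕ} (hp : p < n) (w : Forms k n p) {h : GL (Fin n) k}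
    (hh : IsLowerStabilizer h) (x : GL (Fin n) k) :
    formFun hp w (h * x) = (∏ a, (h.1 (lastIdx hp.le a) (lastIdx hp.le a))⁻¹) * formFun hp w x := by
  rw [formFun_apply, formFun_apply, formEval, evTorsor_lower_mul hh]
  let M : Matrix (Fin p) (Fin p) k := Matrix.of fun c b => (h⁻¹).1 (lastIdx hp.le c) (lastIdx hp.le b)
  have hM : M.det = ∏ a, (h.1 (lastIdx hp.le a) (lastIdx hp.le a))⁻¹ := by
    rw [Matrix.det_of_isLowerTriangular M fun i j hij => inv_lower hh.1
      (OrderDual.toDual_lt_toDual.2 (lastIdx_strictMono hp.le (OrderDual.toDual_lt_toDual.1 hij)))]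
    exact Finset.prod_congr rfl fun a _ => inv_lower_diag hh.1 _
  have hcols : (fun (b : Fin p) i => ((h * x)⁻¹).1 i (lastIdx hp.le b)) =
      fun b => ∑ c, M c b • fun i => (x⁻¹).1 i (lastIdx hp.le c) := by
    funext b i
    rw [mul_inv_rev, Units.val_mul, Matrix.mul_apply, Finset.sum_apply]
    symm
    refine Finset.sum_of_injOn (lastIdx hp.le) (lastIdx_injective hp.le).injOn
      (fun _ _ => Finset.mem_univ _) (fun j _ hj => ?_) fun c _ => ?_
    · rw [inv_lower hh.1, mul_zero]
      rw [OrderDual.toDual_lt_toDual]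
      by_contra hlt
      refine hj ?_
      obtain ⟨a, ha⟩ := mem_range_lastIdx hp.le j (by
        have : n - p ≤ (lastIdx hp.le b : ℕ) := by simp [lastIdx]
        have h2 : (lastIdx hp.le b : ℕ) ≤ j := Fin.le_def.1 (not_lt.1 hlt)
        omega)
      exact ⟨a, by simp, ha⟩
    · simp only [M, Matrix.of_apply, Pi.smul_apply, smul_eq_mul]
      ring
  rw [hcols, ← hM]
  exact Frame.evalForm_mul _ _ _ _ _

end FormFunctions

/-! ### The branching inequalities -/

section Branching

variable {k : Type*} [Field k]

section Charts

variable {n m : ℕ}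

/-- An affine family of invertible matrices with constant determinant. -/
structure IsAffineFamily (y : (Fin m → k) → GL (Fin n) k) : Prop where
  line : ∀ w : Fin m → k, ∃ B : Matrix (Fin n) (Fin n) k, ∀ (v : Fin m → k) (s : k),
    (y (v + s • w)).1 = (y v).1 + s • B
  det : ∀ v, (y v).1.det = (y 0).1.det

variable [CharZero k] {y : (Fin m → k) → GL (Fin n) k} (hy : IsAffineFamily y)
  {f : GL (Fin n) k → k} (hf : IsRegular f)

include hy hf in
/-- A regular function on an affine family that vanishes off the coordinate hyperplanes vanishes: it is
a polynomial on the line through `v` in the direction `(1, …, 1)`. -/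
theorem IsAffineFamily.eq_zero (h : ∀ v, (∀ i, v i ≠ 0) → f (y v) = 0) (v : Fin m → k) :
    f (y v) = 0 := by
  obtain ⟨P, N, hP⟩ := hf
  obtain ⟨B, hB⟩ := hy.line 1
  obtain ⟨p, hp⟩ := exists_eval_line P (fun ij => (y v).1 ij.1 ij.2) fun ij => B ij.1 ij.2
  have hp' : ∀ s, p.eval s = f (y (v + s • 1)) * (y (v + s • 1)).1.det ^ N := fun s => by
    rw [hP, hB]
    exact hp s
  have hp0 : p = 0 := by
    refine eq_zero_of_finite_ne_zero ((Set.finite_range fun i => -v i).subset fun s hs => ?_)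
    by_contra hs'
    refine hs ?_
    rw [hp', h, zero_mul]
    intro i hi
    refine hs' ⟨i, ?_⟩
    simp only [Pi.add_apply, Pi.smul_apply, Pi.one_apply, smul_eq_mul, mul_one] at hi
    exact neg_eq_of_add_eq_zero_right hi
  have h0 := hp' 0
  rw [hp0, Polynomial.eval_zero, zero_smul, add_zero] at h0
  exact (mul_eq_zero.1 h0.symm).resolve_right (pow_ne_zero _ (y v).det_ne_zero)

variable {γ : Fin m → ℤ}
  (hγ : ∀ v t, (∀ i, t i ≠ 0) → f (y (t * v)) = (∏ i, t i ^ γ i) * f (y v))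
  (hdense : (∀ v, f (y v) = 0) → f = 0)

include hy hf hγ hdense in
/-- If a torus scales the coordinates of an affine family that meets a dense set of orbits of a
group, a semi-invariant regular function is determined by its value at the point `1`. -/
theorem IsAffineFamily.apply_one_ne_zero (h0 : f ≠ 0) : f (y 1) ≠ 0 := fun h1 =>
  h0 <| hdense <| hy.eq_zero hf fun v hv => by
    have := hγ 1 v hv
    rwa [mul_one, h1, mul_zero] at this

include hy hf hγ in
/-- A function that is monomial on an affine family has nonnegative exponents. -/
theorem IsAffineFamily.exponent_nonneg (h1 : f (y 1) ≠ 0) (j : Fin m) : 0 ≤ γ j := by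
  obtain ⟨B, hB⟩ := hy.line (Pi.single j 1)
  refine hf.exponent_nonneg (y (Function.update (1 : Fin m → k) j 0)).1 B h1 (y 0).det_ne_zero (γ j)
    fun s hs => ⟨y (Function.update (1 : Fin m → k) j 0 + s • Pi.single j 1), hB _ _, hy.det _, ?_⟩
  have e : Function.update (1 : Fin m → k) j 0 + s • Pi.single j 1 =
      Function.update (1 : Fin m → k) j s * 1 := by
    funext i
    by_cases hi : i = j
    · subst hi; simp
    · simp [hi]
  have ht : ∀ i, Function.update (1 : Fin m → k) j s i ≠ 0 := fun i => by
    by_cases hi : i = j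
    · subst hi; simpa
    · simp [hi]
  rw [e, hγ _ _ ht, mul_comm, Finset.prod_eq_single j]
  · simp
  · intro i _ hi
    simp [hi]
  · simp

end Charts

variable {m : ℕ}

/-- The lower triangular matrices with first column `e₁` act on `f` by left translations through the
character `β`. -/
def IsStabilizerSemiinvariant (β : Fin m → ℤ) (f : GL (Fin (m + 1)) k → k) : Prop :=
  ∀ h x : GL (Fin (m + 1)) k, IsLowerStabilizer h →
    f (h * x) = (∏ j : Fin m, h.1 j.succ j.succ ^ β j) * f x

theorem blockTriangular_toDual_cons {M : Matrix (Fin (m + 1)) (Fin (m + 1)) k}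
    (h0 : ∀ j : Fin m, M 0 j.succ = 0) (h1 : ∀ i j : Fin m, i < j → M i.succ j.succ = 0) :
    M.BlockTriangular OrderDual.toDual := fun i j hij => by
  have hij' : i < j := hij
  induction j using Fin.cases with
  | zero => exact absurd hij' (Fin.not_lt_zero _)
  | succ j =>
    induction i using Fin.cases with
    | zero => exact h0 j
    | succ i => exact h1 i j (Fin.succ_lt_succ_iff.1 hij')

/-- The matrix `diag(1, L)`, for a lower triangular matrix `L`. -/
theorem exists_lowerStabilizer (L : Matrix (Fin m) (Fin m) k) (hL : ∀ i j, i < j → L i j = 0)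
    (hd : ∀ i, L i i ≠ 0) : ∃ h : GL (Fin (m + 1)) k, IsLowerStabilizer h ∧ h.1 0 0 = 1 ∧
      (∀ j : Fin m, h.1 0 j.succ = 0) ∧ (∀ i : Fin m, h.1 i.succ 0 = 0) ∧
        ∀ i j : Fin m, h.1 i.succ j.succ = L i j := by
  let M : Matrix (Fin (m + 1)) (Fin (m + 1)) k :=
    Matrix.of (Fin.cons (Pi.single 0 1) fun i => Fin.cons 0 (L i))
  have hM : M.BlockTriangular OrderDual.toDual := blockTriangular_toDual_cons
    (fun j => by simp [M]) fun i j hij => by simpa [M] using hL i j hij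
  have hdet : M.det ≠ 0 := by
    rw [Matrix.det_of_isLowerTriangular M hM, Finset.prod_ne_zero_iff]
    intro i _
    induction i using Fin.cases with
    | zero => simp [M]
    | succ i => simpa [M] using hd i
  refine ⟨Matrix.GeneralLinearGroup.mkOfDetNeZero M hdet, ⟨hM, fun i => ?_⟩, ?_, fun j => ?_,
    fun i => ?_, fun i j => ?_⟩ <;> change M _ _ = _
  · induction i using Fin.cases with
    | zero => simp [M]
    | succ i => simp [M]
  all_goals simp [M]

/-- The matrix with the first column `(1, v)` and the other columns those of the identity matrix. -/
def columnMatrix (v : Fin m → k) : Matrix (Fin (m + 1)) (Fin (m + 1)) k :=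
  Matrix.of (Fin.cons (Pi.single 0 1) fun j => Fin.cons (v j) (Pi.single j 1))

theorem columnMatrix_det (v : Fin m → k) : (columnMatrix v).det = 1 := by
  rw [Matrix.det_of_isLowerTriangular _ (blockTriangular_toDual_cons (fun j => ?_)
    fun i j hij => ?_), Fin.prod_univ_succ]
  · simp [columnMatrix]
  · simp [columnMatrix]
  · simp [columnMatrix, hij.ne']

/-- The matrix `columnMatrix v` as an element of the general linear group. -/
def columnGL (v : Fin m → k) : GL (Fin (m + 1)) k :=
  Matrix.GeneralLinearGroup.mkOfDetNeZero (columnMatrix v) (by simp [columnMatrix_det])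

theorem columnGL_val (v : Fin m → k) : (columnGL v).1 = columnMatrix v := rfl

/-- The matrix with the first row `(w, 1)`, followed by the rows of the identity matrix except for
the last one. -/
def rowMatrix (w : Fin m → k) : Matrix (Fin (m + 1)) (Fin (m + 1)) k :=
  Matrix.of (Fin.cons (Fin.snoc w 1) fun j => Pi.single j.castSucc 1)

theorem rowMatrix_det (w : Fin m → k) : (rowMatrix w).det = (-1) ^ m := by
  rw [Matrix.det_succ_column _ (Fin.last m), Finset.sum_eq_single 0]
  · have : (rowMatrix w).submatrix (Fin.succAbove 0) (Fin.succAbove (Fin.last m)) = 1 := by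
      ext i j
      simp [rowMatrix, Matrix.one_apply, Pi.single_apply, eq_comm]
    rw [this]
    simp [rowMatrix]
  · intro i _ hi
    obtain ⟨j, rfl⟩ := Fin.exists_succ_eq.2 hi
    simp [rowMatrix]
  · simp

/-- The matrix `rowMatrix w` as an element of the general linear group. -/
def rowGL (w : Fin m → k) : GL (Fin (m + 1)) k :=
  Matrix.GeneralLinearGroup.mkOfDetNeZero (rowMatrix w) (by simp [rowMatrix_det])

theorem rowGL_val (w : Fin m → k) : (rowGL w).1 = rowMatrix w := rfl

theorem isAffineFamily_columnGL : IsAffineFamily (columnGL (k := k) (m := m)) where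
  line w := ⟨Matrix.of (Fin.cons 0 fun j => Fin.cons (w j) 0), fun v s => by
    ext i j
    rw [Matrix.add_apply, Matrix.smul_apply, columnGL_val, columnGL_val]
    refine Fin.cases ?_ (fun i => ?_) i <;> refine Fin.cases ?_ (fun j => ?_) j <;>
      simp [columnMatrix]⟩
  det v := by rw [columnGL_val, columnGL_val, columnMatrix_det, columnMatrix_det]

theorem isAffineFamily_rowGL : IsAffineFamily (rowGL (k := k) (m := m)) where
  line w := ⟨Matrix.of (Fin.cons (Fin.snoc w 0) fun j => 0), fun v s => by
    ext i j
    rw [Matrix.add_apply, Matrix.smul_apply, rowGL_val, rowGL_val]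
    refine Fin.cases ?_ (fun i => ?_) i <;> refine Fin.lastCases ?_ (fun j => ?_) j <;>
      simp [rowMatrix]⟩
  det v := by rw [rowGL_val, rowGL_val, rowMatrix_det, rowMatrix_det]

variable {f : GL (Fin (m + 1)) k → k} {α : Fin (m + 1) → ℤ} {β : Fin m → ℤ}
  (hα : IsHighestWeight (functionsRep k (m + 1)) α f) (hβ : IsStabilizerSemiinvariant β f)

theorem isLowerStabilizer_diagGL (t : Fin m → k) (ht : ∀ i, (Fin.cons 1 t : Fin (m + 1) → k) i ≠ 0) :
    IsLowerStabilizer (diagGL _ ht) :=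
  ⟨Matrix.blockTriangular_diagonal _, fun i => by
    rw [diagGL_val]
    refine Fin.cases ?_ (fun i => ?_) i <;> simp⟩

include hα hβ in
/-- Conjugation by `diag(1, t)` scales the parameter `v` of `columnGL v`. -/
theorem columnGL_mul (v t : Fin m → k) (ht : ∀ i, t i ≠ 0) :
    f (columnGL (t * v)) = (∏ j, t j ^ (β j - α j.succ)) * f (columnGL v) := by
  have ht' : ∀ i, (Fin.cons 1 t : Fin (m + 1) → k) i ≠ 0 :=
    Fin.cases (by simp) fun i => by simpa using ht i
  have e : diagGL _ ht' * columnGL v = columnGL (t * v) * diagGL _ ht' := by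
    ext i j
    rw [Units.val_mul, Units.val_mul, diagGL_val, Matrix.diagonal_mul, Matrix.mul_diagonal,
      columnGL_val, columnGL_val]
    refine Fin.cases ?_ (fun i => ?_) i <;> refine Fin.cases ?_ (fun j => ?_) j <;>
      simp [columnMatrix, Pi.single_apply]
    grind
  have h1 := hβ _ (columnGL v) (isLowerStabilizer_diagGL t ht')
  have h2 := isHighestWeight_functionsRep.1 hα (columnGL (t * v)) (diagGL _ ht')
    (by rw [diagGL_val]; exact Matrix.blockTriangular_diagonal _)
  rw [e, h2] at h1
  simp only [diagGL_val, Matrix.diagonal_apply_eq, Fin.prod_univ_succ, Fin.cons_zero,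
    Fin.cons_succ, one_zpow, one_mul] at h1
  simp only [zpow_sub₀ (ht _), Finset.prod_div_distrib]
  have h3 : ∏ j, t j ^ α j.succ ≠ 0 := Finset.prod_ne_zero_iff.2 fun j _ => zpow_ne_zero _ (ht j)
  rw [div_mul_eq_mul_div, eq_div_iff h3, ← h1]
  ring

include hα hβ in
/-- Multiplication by `diag(1, t)⁻¹` on the left and `diag(t, 1)` on the right scales the parameter `w`
of `rowGL w`. -/
theorem rowGL_mul (w t : Fin m → k) (ht : ∀ i, t i ≠ 0) :
    f (rowGL (t * w)) = (∏ j, t j ^ (α j.castSucc - β j)) * f (rowGL w) := by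
  have ht' : ∀ i, (Fin.cons 1 t : Fin (m + 1) → k) i ≠ 0 :=
    Fin.cases (by simp) fun i => by simpa using ht i
  have ht'' : ∀ i, (Fin.snoc t 1 : Fin (m + 1) → k) i ≠ 0 :=
    Fin.lastCases (by simp) fun i => by simpa using ht i
  have e : rowGL w * diagGL _ ht'' = diagGL _ ht' * rowGL (t * w) := by
    ext i j
    rw [Units.val_mul, Units.val_mul, diagGL_val, diagGL_val, Matrix.diagonal_mul,
      Matrix.mul_diagonal, rowGL_val, rowGL_val]
    refine Fin.cases ?_ (fun i => ?_) i <;> refine Fin.lastCases ?_ (fun j => ?_) j <;>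
      simp [rowMatrix, Pi.single_apply, mul_comm]
    grind
  have h1 := hβ _ (rowGL (t * w)) (isLowerStabilizer_diagGL t ht')
  have h2 := isHighestWeight_functionsRep.1 hα (rowGL w) (diagGL _ ht'')
    (by rw [diagGL_val]; exact Matrix.blockTriangular_diagonal _)
  rw [← e, h2] at h1
  simp only [diagGL_val, Matrix.diagonal_apply_eq, Fin.prod_univ_castSucc, Fin.snoc_last,
    Fin.snoc_castSucc, Fin.cons_succ, one_zpow, mul_one] at h1
  simp only [zpow_sub₀ (ht _), Finset.prod_div_distrib]
  have h3 : ∏ j, t j ^ β j ≠ 0 := Finset.prod_ne_zero_iff.2 fun j _ => zpow_ne_zero _ (ht j)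
  rw [div_mul_eq_mul_div, eq_div_iff h3, h1]
  ring

variable [CharZero k]

include hα hβ in
/-- A lower triangular matrix is the product of one that fixes the base point, some `columnGL v`, and a
diagonal matrix. -/
theorem eq_zero_of_columnGL (hf : IsRegular f) (h0 : ∀ v, f (columnGL v) = 0) : f = 0 :=
  hf.eq_zero_of_bigCell fun l u hl hu => by
    rw [isHighestWeight_functionsRep.1 hα l u hu]
    refine mul_eq_zero_of_right _ ?_
    have hl0 : ∀ i j, i < j → l.1 i j = 0 := fun i j hij => hl hij
    obtain ⟨h, hs, h00, h0s, hs0, hss⟩ := exists_lowerStabilizer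
      (fun i j : Fin m => l.1 i.succ j.succ) (fun i j hij => hl0 _ _ (Fin.succ_lt_succ_iff.2 hij))
      fun i => GL_diag_ne_zero_of_lower l hl _
    have hd : ∀ i, (Fin.cons (l.1 0 0) 1 : Fin (m + 1) → k) i ≠ 0 :=
      Fin.cases (by simpa using GL_diag_ne_zero_of_lower l hl 0) fun i => by simp
    have hl00 := GL_diag_ne_zero_of_lower l hl 0
    obtain ⟨q, hq', hq⟩ : ∃ q, h⁻¹ * l = q ∧ h * q = l := ⟨_, rfl, mul_inv_cancel_left h l⟩
    have hq1 : ∀ a (j : Fin m), q.1 a j.succ = if a = j.succ then 1 else 0 := fun a j => by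
      have : ((h⁻¹).1 * h.1) a j.succ = if a = j.succ then 1 else 0 := by
        rw [← Units.val_mul, inv_mul_cancel, Units.val_one, Matrix.one_apply]
      rw [← this, ← hq', Units.val_mul, Matrix.mul_apply, Matrix.mul_apply]
      refine Finset.sum_congr rfl fun c _ => ?_
      congr 1
      refine Fin.cases ?_ (fun c => ?_) c
      · rw [h0s, hl0 _ _ (Fin.succ_pos j)]
      · rw [hss]
    have hq0 : q.1 0 0 = l.1 0 0 := by
      rw [← hq, Units.val_mul, Matrix.mul_apply, Fin.sum_univ_succ, h00]
      simp [h0s]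
    have e : q = columnGL (fun j => q.1 j.succ 0 / l.1 0 0) * diagGL _ hd := by
      ext i j
      rw [Units.val_mul, diagGL_val, Matrix.mul_diagonal, columnGL_val]
      refine Fin.cases ?_ (fun j => ?_) j
      · refine Fin.cases ?_ (fun i => ?_) i
        · simp [columnMatrix, hq0]
        · simp [columnMatrix, hl00]
      · rw [hq1]
        refine Fin.cases ?_ (fun i => ?_) i
        · simp [columnMatrix, (Fin.succ_ne_zero j).symm]
        · simp [columnMatrix, Pi.single_apply]
          grind
    rw [← hq, hβ h q hs, e, isHighestWeight_functionsRep.1 hα _ _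
      (by rw [diagGL_val]; exact Matrix.blockTriangular_diagonal _), h0, mul_zero, mul_zero]

include hα hβ in
/-- The product of `rowGL 0` and a lower triangular matrix is the product of a matrix that fixes the
base point, some `rowGL w`, and a diagonal matrix. -/
theorem eq_zero_of_rowGL (hf : IsRegular f) (h0 : ∀ w, f (rowGL w) = 0) : f = 0 := by
  suffices H : (fun x => f (rowGL 0 * x)) = 0 by
    funext x
    have := congrFun H ((rowGL 0)⁻¹ * x)
    rwa [mul_inv_cancel_left] at this
  refine (hf.leftTranslate (rowGL 0)).eq_zero_of_bigCell fun l u hl hu => ?_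
  rw [← mul_assoc, isHighestWeight_functionsRep.1 hα _ u hu]
  refine mul_eq_zero_of_right _ ?_
  have hl0 : ∀ i j, i < j → l.1 i j = 0 := fun i j hij => hl hij
  obtain ⟨h, hs, h00, h0s, hs0, hss⟩ := exists_lowerStabilizer
    (fun i j : Fin m => l.1 i.castSucc j.castSucc)
    (fun i j hij => hl0 _ _ (Fin.castSucc_lt_castSucc_iff.2 hij))
    fun i => GL_diag_ne_zero_of_lower l hl _
  have hd : ∀ i, (Fin.snoc 1 (l.1 (Fin.last m) (Fin.last m)) : Fin (m + 1) → k) i ≠ 0 :=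
    Fin.lastCases (by simpa using GL_diag_ne_zero_of_lower l hl _) fun i => by simp
  have e : rowGL 0 * l = h * (rowGL (fun j => l.1 (Fin.last m) j.castSucc) * diagGL _ hd) := by
    ext i j
    rw [Units.val_mul, Units.val_mul, Matrix.mul_apply, Matrix.mul_apply]
    simp only [Units.val_mul, diagGL_val, Matrix.mul_diagonal, rowGL_val]
    refine Fin.cases ?_ (fun i => ?_) i
    · rw [Fin.sum_univ_castSucc, Fin.sum_univ_succ, h00]
      simp only [h0s]
      refine Fin.lastCases ?_ (fun j => ?_) j <;> simp [rowMatrix]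
    · rw [Fin.sum_univ_succ (n := m) (f := fun x => h.1 i.succ x * _), hs0]
      simp only [hss]
      refine Fin.lastCases ?_ (fun j => ?_) j
      · simp [rowMatrix, Pi.single_apply, hl0 _ _ (Fin.castSucc_lt_last i)]
      · simp [rowMatrix, Pi.single_apply]
  rw [e, hβ h _ hs, isHighestWeight_functionsRep.1 hα _ _
      (by rw [diagGL_val]; exact Matrix.blockTriangular_diagonal _), h0, mul_zero, mul_zero]

include hα hβ in
theorem apply_columnGL_ne_zero (hf : IsRegular f) (h0 : f ≠ 0) : f (columnGL 1) ≠ 0 :=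
  isAffineFamily_columnGL.apply_one_ne_zero hf (columnGL_mul hα hβ) (eq_zero_of_columnGL hα hβ hf)
    h0

include hα hβ in
/-- The branching rule for `GLₘ ⊂ GLₘ₊₁`: the weight `β` interlaces with the highest weight `α`. -/
theorem interlaces_of_isStabilizerSemiinvariant (hf : IsRegular f) (h0 : f ≠ 0) (j : Fin m) :
    β j ≤ α j.castSucc ∧ α j.succ ≤ β j := by
  have h1 := isAffineFamily_columnGL.exponent_nonneg hf (columnGL_mul hα hβ)
    (apply_columnGL_ne_zero hα hβ hf h0) j
  have h2 := isAffineFamily_rowGL.exponent_nonneg hf (rowGL_mul hα hβ)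
    (isAffineFamily_rowGL.apply_one_ne_zero hf (rowGL_mul hα hβ) (eq_zero_of_rowGL hα hβ hf) h0) j
  omega

end Branching

/-! ### Highest weight vectors among the forms -/

section HighestWeightForms

variable {k : Type*} [Field k] {m p : ℕ}

theorem inv_upper {n : ℕ} {b : GL (Fin n) k} (hb : b.1.BlockTriangular id) :
    (b⁻¹).1.BlockTriangular id := by
  have : (b⁻¹).1 = b.1⁻¹ := Matrix.coe_units_inv b
  rw [this]
  have : Invertible b.1 := b.invertible
  exact Matrix.blockTriangular_inv_of_blockTriangular hb

theorem inv_upper_diag {n : ℕ} {b : GL (Fin n) k} (hb : b.1.BlockTriangular id)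
    (i : Fin n) : (b⁻¹).1 i i = (b.1 i i)⁻¹ := by
  have h1 : ((b⁻¹).1 * b.1) i i = 1 := by
    rw [← Units.val_mul, inv_mul_cancel, Units.val_one, Matrix.one_apply_eq]
  rw [Matrix.mul_apply, Finset.sum_eq_single i] at h1
  · exact eq_inv_of_mul_eq_one_left h1
  · intro j _ hj
    rcases lt_or_gt_of_ne hj with hj | hj
    · rw [inv_upper hb hj, zero_mul]
    · rw [hb hj, mul_zero]
  · simp

/-- The minor of `x⁻¹` with the last `q` rows and the columns `κ`. -/
def lastRowsMinor {n q : ℕ} (hq : q ≤ n) (κ : Fin q → Fin n) (x : GL (Fin n) k) : k :=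
  (Matrix.of fun s t => (x⁻¹).1 (lastIdx hq s) (κ t)).det

theorem lastRowsMinor_mul_upper {n q : ℕ} (hq : q ≤ n) (κ : Fin q → Fin n) (x : GL (Fin n) k)
    {b : GL (Fin n) k} (hb : b.1.BlockTriangular id) : lastRowsMinor hq κ (x * b) =
      (∏ s, (b.1 (lastIdx hq s) (lastIdx hq s))⁻¹) * lastRowsMinor hq κ x := by
  let M : Matrix (Fin q) (Fin q) k := Matrix.of fun c b' => (b⁻¹).1 (lastIdx hq c) (lastIdx hq b')
  have hM : M.det = ∏ s, (b.1 (lastIdx hq s) (lastIdx hq s))⁻¹ := by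
    rw [Matrix.det_of_isUpperTriangular (M := M) fun i j hij =>
      inv_upper hb (lastIdx_strictMono hq hij)]
    exact Finset.prod_congr rfl fun a _ => inv_upper_diag hb _
  rw [lastRowsMinor, lastRowsMinor, ← hM, ← Matrix.det_mul]
  congr 1
  ext s t
  rw [Matrix.of_apply, mul_inv_rev, Units.val_mul, Matrix.mul_apply, Matrix.mul_apply]
  symm
  refine Finset.sum_of_injOn (lastIdx hq) (lastIdx_injective hq).injOn
    (fun _ _ => Finset.mem_univ _) (fun j _ hj => ?_) fun c _ => rfl
  rw [inv_upper hb, zero_mul]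
  by_contra hlt
  refine hj ?_
  obtain ⟨a, ha⟩ := mem_range_lastIdx hq j (by
    have : n - q ≤ (lastIdx hq s : ℕ) := by simp [lastIdx]
    have h2 : (lastIdx hq s : ℕ) ≤ j := Fin.le_def.1 (not_lt.1 hlt)
    omega)
  exact ⟨a, by simp, ha⟩

theorem prod_lastIdx {n q : ℕ} (hq : q ≤ n) (d : Fin n → k) :
    ∏ s, (d (lastIdx hq s))⁻¹ = ∏ i : Fin n, d i ^ (if n - q ≤ (i : ℕ) then (-1 : ℤ) else 0) := by
  refine Finset.prod_of_injOn (lastIdx hq) (lastIdx_injective hq).injOn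
    (fun _ _ => Finset.mem_univ _) (fun j _ hj => ?_) fun c _ => ?_
  · rw [if_neg, zpow_zero]
    intro hle
    obtain ⟨a, ha⟩ := mem_range_lastIdx hq j hle
    exact hj ⟨a, by simp, ha⟩
  · rw [if_pos (by simp [lastIdx]), zpow_neg_one]

/-- The weight of `z₁ ^ a (z*ₙ) ^ b τ`, where `τ` has weight `-1` at the last `q` places. -/
def cornerWeight (m q a b : ℕ) (i : Fin (m + 1)) : ℤ :=
  (if i = 0 then (a : ℤ) else 0) - (if i = Fin.last m then (b : ℤ) else 0) +
    if m + 1 - q ≤ (i : ℕ) then -1 else 0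

theorem prod_zpow_cornerWeight (q a b : ℕ) (d : Fin (m + 1) → k) (hd : ∀ i, d i ≠ 0) :
    ∏ i, d i ^ cornerWeight m q a b i = d 0 ^ a * ((d (Fin.last m))⁻¹) ^ b *
      ∏ i, d i ^ (if m + 1 - q ≤ (i : ℕ) then (-1 : ℤ) else 0) := by
  simp only [cornerWeight, zpow_add₀ (hd _), zpow_sub₀ (hd _), Finset.prod_mul_distrib,
    Finset.prod_div_distrib]
  congr 1
  rw [Finset.prod_eq_single 0, Finset.prod_eq_single (Fin.last m)]
  · simp [div_eq_mul_inv]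
  · intro i _ hi
    simp [hi]
  · simp
  · intro i _ hi
    simp [hi]
  · simp

/-- A product of powers of `x₁₁` and of a corner entry of `x⁻¹` with a minor of the last rows of `x⁻¹` is
a weight vector for right translations by upper triangular matrices. -/
theorem isHighestWeight_of_lastRowsMinor [CharZero k] {q : ℕ} (hp : p < m + 1) (hq : q ≤ m + 1)
    (κ : Fin q → Fin (m + 1)) (a b : ℕ) {w : Forms k (m + 1) p}
    (hw : ∀ x, formFun hp w x =
      x.1 0 0 ^ a * (x⁻¹).1 (Fin.last m) 0 ^ b * lastRowsMinor hq κ x) :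
    IsHighestWeight (formsRep k (m + 1) p) (cornerWeight m q a b) w := by
  intro u hu
  refine formFun_injective hp ?_
  rw [formFun_formsRep, map_smul]
  funext x
  have h0 : (x * u).1 0 0 = x.1 0 0 * u.1 0 0 := by
    rw [Units.val_mul, Matrix.mul_apply, Finset.sum_eq_single 0]
    · intro j _ hj
      rw [hu (Fin.pos_iff_ne_zero.2 hj), mul_zero]
    · simp
  have h1 : ((x * u)⁻¹).1 (Fin.last m) 0 =
      (u.1 (Fin.last m) (Fin.last m))⁻¹ * (x⁻¹).1 (Fin.last m) 0 := by
    rw [mul_inv_rev, Units.val_mul, Matrix.mul_apply, Finset.sum_eq_single (Fin.last m),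
      inv_upper_diag hu]
    · intro j _ hj
      rw [inv_upper hu (show id j < id (Fin.last m) from Fin.lt_last_iff_ne_last.2 hj), zero_mul]
    · simp
  change formFun hp w (x * u) = _ * formFun hp w x
  rw [hw, hw, h0, h1, lastRowsMinor_mul_upper hq κ x hu,
    prod_zpow_cornerWeight q a b (fun i => u.1 i i) (GL_diag_ne_zero_of_upper u hu),
    ← prod_lastIdx hq]
  ring

theorem columnMatrix_one_apply (i j : Fin (m + 1)) :
    columnMatrix (1 : Fin m → k) i j = if j = 0 ∨ i = j then 1 else 0 := by
  refine Fin.cases ?_ (fun i => ?_) i <;> refine Fin.cases ?_ (fun j => ?_) j <;>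
    simp [columnMatrix, Pi.single_apply, eq_comm]

/-- A form whose function is `x₁₁ ^ a` times a power of a corner entry of `x⁻¹` times a minor of `x⁻¹`
does not vanish if the minor does not vanish at `columnMatrix 1`. -/
theorem ne_zero_of_lastRowsMinor {q : ℕ} (hp : p < m + 1) (hq : q ≤ m + 1)
    (κ : Fin q → Fin (m + 1)) (a b : ℕ) {w : Forms k (m + 1) p}
    (hw : ∀ x, formFun hp w x =
      x.1 0 0 ^ a * (x⁻¹).1 (Fin.last m) 0 ^ b * lastRowsMinor hq κ x)
    (h : (Matrix.of fun s t =>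
      columnMatrix (1 : Fin m → k) (lastIdx hq s) (κ t)).det = 1) : w ≠ 0 := by
  rintro rfl
  have h1 := hw (columnGL (1 : Fin m → k))⁻¹
  have hl : (columnGL (1 : Fin m → k)).1.BlockTriangular OrderDual.toDual := fun i j hij => by
    have hij' : i < j := hij
    rw [columnGL_val, columnMatrix_one_apply, if_neg]
    rintro (rfl | rfl)
    · exact Fin.not_lt_zero _ hij'
    · exact lt_irrefl _ hij'
  have h2 : lastRowsMinor hq κ (columnGL (1 : Fin m → k))⁻¹ = 1 := by
    rw [lastRowsMinor, inv_inv]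
    exact h
  rw [h2, inv_lower_diag hl, inv_inv, columnGL_val, columnMatrix_one_apply,
    columnMatrix_one_apply, map_zero] at h1
  simp at h1

theorem formFun_smul_ιMulti_d (hp : p < m + 1) (r : TorsorRing k (m + 1))
    (j : Fin p → Fin (m + 1)) (x : GL (Fin (m + 1)) k) :
    formFun hp (r • exteriorPower.ιMulti _ p fun a => (torsorFrame k (m + 1)).d (j a)) x =
      evTorsor x r * (Matrix.of fun a b => (x⁻¹).1 (j a) (lastIdx hp.le b)).det := by
  refine (torsorFrame k (m + 1)).evalForm_smul_ιMulti_d (evTorsor x) r j _ fun a => ?_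
  have h : ∑ i, x.1 0 i * (x⁻¹).1 i (lastIdx hp.le a) = 0 := by
    rw [← Matrix.mul_apply, ← Units.val_mul, mul_inv_cancel, Units.val_one,
      Matrix.one_apply_ne (lastIdx_ne_zero hp a).symm]
  rw [← h]
  exact Finset.sum_congr rfl fun i _ => by
    rw [mul_comm]
    congr 1
    exact evTorsor_coord x i

/-- The forms `z₁ ^ a (z*ₙ) ^ b dz*_{n-p+1} ∧ ⋯ ∧ dz*ₙ` are highest weight vectors. -/
theorem exists_highestWeight_form [CharZero k] (hp : p < m + 1) (a b : ℕ) :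
    ∃ w : Forms k (m + 1) p, w ≠ 0 ∧
      IsHighestWeight (formsRep k (m + 1) p) (cornerWeight m p a b) w := by
  let w : Forms k (m + 1) p := (coord 0 ^ a * dualCoord (Fin.last m) ^ b : TorsorRing k (m + 1)) •
    exteriorPower.ιMulti _ p fun s => (torsorFrame k (m + 1)).d (lastIdx hp.le s)
  have hw : ∀ x, formFun hp w x = x.1 0 0 ^ a * (x⁻¹).1 (Fin.last m) 0 ^ b *
      lastRowsMinor hp.le (lastIdx hp.le) x := fun x => by
    rw [formFun_smul_ιMulti_d, map_mul, map_pow, map_pow, evTorsor_coord, evTorsor_dualCoord]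
    rfl
  refine ⟨w, fun h => ?_, isHighestWeight_of_lastRowsMinor hp hp.le _ a b hw⟩
  refine ne_zero_of_lastRowsMinor hp hp.le _ a b hw ?_ h
  refine Eq.trans (congrArg Matrix.det ?_) Matrix.det_one
  ext s t
  rw [Matrix.of_apply, columnMatrix_one_apply, Matrix.one_apply]
  simp only [lastIdx_ne_zero hp, (lastIdx_injective hp.le).eq_iff, false_or]

/-- The forms `z₁ ^ a (z*ₙ) ^ b τ` are highest weight vectors, where `τ` is the alternating sum of the
forms `z*_j dz*_{n-p} ∧ ⋯ ∧ dz*ₙ` with `dz*_j` omitted. -/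
theorem exists_highestWeight_form_succ [CharZero k] (hp : p < m + 1) (a b : ℕ) :
    ∃ w : Forms k (m + 1) p, w ≠ 0 ∧
      IsHighestWeight (formsRep k (m + 1) p) (cornerWeight m (p + 1) a b) w := by
  have hp' : p + 1 ≤ m + 1 := hp
  let w : Forms k (m + 1) p := ∑ j : Fin (p + 1),
    ((-1) ^ (j : ℕ) * (coord 0 ^ a * dualCoord (Fin.last m) ^ b * dualCoord (lastIdx hp' j)) :
      TorsorRing k (m + 1)) • exteriorPower.ιMulti _ p fun a =>
        (torsorFrame k (m + 1)).d (lastIdx hp' (j.succAbove a))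
  let κ : Fin (p + 1) → Fin (m + 1) := Fin.cons 0 (lastIdx hp.le)
  have hw : ∀ x, formFun hp w x = x.1 0 0 ^ a * (x⁻¹).1 (Fin.last m) 0 ^ b *
      lastRowsMinor hp' κ x := fun x => by
    rw [map_sum, Finset.sum_apply, lastRowsMinor, Matrix.det_succ_column_zero, Finset.mul_sum]
    refine Finset.sum_congr rfl fun j _ => ?_
    rw [formFun_smul_ιMulti_d, map_mul, map_mul, map_mul, map_pow, map_pow, map_pow, map_neg,
      map_one, evTorsor_coord, evTorsor_dualCoord, evTorsor_dualCoord]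
    have : (Matrix.of fun s t => (x⁻¹).1 (lastIdx hp' s) (κ t)).submatrix j.succAbove Fin.succ =
        Matrix.of fun a b => (x⁻¹).1 (lastIdx hp' (j.succAbove a)) (lastIdx hp.le b) := by
      ext s t
      simp [κ]
    rw [this, Matrix.of_apply]
    simp only [κ, Fin.cons_zero]
    ring
  refine ⟨w, fun h => ?_, isHighestWeight_of_lastRowsMinor hp hp' κ a b hw⟩
  refine ne_zero_of_lastRowsMinor hp hp' κ a b hw ?_ h
  rw [← columnMatrix_det (1 : Fin p → k)]
  congr 1
  ext s t
  rw [Matrix.of_apply, columnMatrix_one_apply, columnMatrix_one_apply]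
  refine Fin.cases ?_ (fun t => ?_) t
  · simp [κ]
  · have : lastIdx hp' s = lastIdx hp.le t ↔ s = t.succ := by
      simp only [lastIdx, Fin.ext_iff, Fin.val_succ]
      omega
    simp only [κ, Fin.cons_succ, lastIdx_ne_zero hp, this, Fin.succ_ne_zero]

/-- Each weight with the interlacing property is the weight of one of the two families of highest
weight vectors. -/
theorem Interlaces.exists_cornerWeight {α : Fin (m + 1) → ℤ} (hp : p < m + 1)
    (h : Interlaces p α) : ∃ q a b : ℕ, (q = p ∨ q = p + 1) ∧ α = cornerWeight m q a b := by
  obtain ⟨A, hA⟩ : ∃ A : ℕ → ℤ, ∀ i : Fin (m + 1), α i = A i :=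
    ⟨fun i => if hi : i < m + 1 then α ⟨i, hi⟩ else 0, fun i => by
      simp only [i.isLt, dif_pos, Fin.eta]⟩
  have hI : ∀ i, i + 1 < m + 1 → (if i + 1 < m + 1 - p then (0 : ℤ) else -1) ≤ A i ∧
      A (i + 1) ≤ (if i + 1 < m + 1 - p then (0 : ℤ) else -1) := fun i hi => by
    have := h i hi
    rwa [hA, hA] at this
  suffices H : ∃ q a b : ℕ, (q = p ∨ q = p + 1) ∧ ∀ i : ℕ, i < m + 1 → A i =
      (if i = 0 then (a : ℤ) else 0) - (if i = m then (b : ℤ) else 0) +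
        if m + 1 - q ≤ i then -1 else 0 by
    obtain ⟨q, a, b, hq, H⟩ := H
    refine ⟨q, a, b, hq, funext fun i => ?_⟩
    rw [hA, H i i.isLt, cornerWeight]
    simp only [Fin.ext_iff, Fin.val_zero, Fin.val_last]
  rcases Nat.eq_zero_or_pos m with rfl | hm
  · refine ⟨p, (A 0).toNat, (-A 0).toNat, Or.inl rfl, fun i hi => ?_⟩
    split_ifs <;> first | omega | (have : i = 0 := by omega
                                   subst this
                                   omega)
  have h0 := (hI 0 (by omega)).1
  have hm1 := (hI (m - 1) (by omega)).2
  rw [Nat.sub_add_cancel hm] at hm1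
  have hint : ∀ i, 0 < i → i < m → (i + 1 < m + 1 - p → A i = 0) ∧ (m + 1 - p ≤ i → A i = -1) ∧
      -1 ≤ A i ∧ A i ≤ 0 := fun i hi him => by
    have h1 := (hI i (by omega)).1
    have h2 := (hI (i - 1) (by omega)).2
    rw [Nat.sub_add_cancel hi] at h2
    refine ⟨fun h => ?_, fun h => ?_, ?_, ?_⟩ <;> split_ifs at h1 h2 <;> omega
  have key : ∀ q, (q = p ∨ q = p + 1) → (∀ i, 0 < i → i < m → A i = if m + 1 - q ≤ i then -1 else 0) →
      (0 ≤ A 0 + if m + 1 - q ≤ 0 then 1 else 0) → (A m + (if m + 1 - q ≤ m then 1 else 0) ≤ 0) →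
      ∃ q a b : ℕ, (q = p ∨ q = p + 1) ∧ ∀ i : ℕ, i < m + 1 → A i =
        (if i = 0 then (a : ℤ) else 0) - (if i = m then (b : ℤ) else 0) +
          if m + 1 - q ≤ i then -1 else 0 := fun q hq h1 h2 h3 => by
    refine ⟨q, (A 0 + if m + 1 - q ≤ 0 then 1 else 0).toNat,
      (-(A m + (if m + 1 - q ≤ m then 1 else 0))).toNat, hq, fun i hi => ?_⟩
    by_cases hi0 : i = 0
    · subst hi0
      split_ifs at h2 ⊢ <;> omega
    by_cases him : i = m
    · subst him
      split_ifs at h3 ⊢ <;> omega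
    rw [h1 i (by omega) (by omega)]
    split_ifs <;> omega
  -- the only entry that is not determined away from both ends has the index `m - p`
  by_cases hmid : p = m ∨ (0 < p ∧ A (m - p) = -1)
  · refine key (p + 1) (Or.inr rfl) (fun i hi him => ?_) ?_ ?_
    · obtain ⟨h1, h2, h3, h4⟩ := hint i hi him
      by_cases him' : i = m - p
      · subst him'
        split_ifs <;> omega
      · split_ifs <;> omega
    · split_ifs at h0 ⊢ <;> omega
    · split_ifs at hm1 ⊢ <;> omega
  · refine key p (Or.inl rfl) (fun i hi him => ?_) ?_ ?_
    · obtain ⟨h1, h2, h3, h4⟩ := hint i hi him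
      by_cases him' : i = m - p
      · subst him'
        split_ifs <;> omega
      · split_ifs <;> omega
    · split_ifs at h0 ⊢ <;> omega
    · split_ifs at hm1 ⊢ <;> omega

theorem exists_highestWeight_of_interlaces [CharZero k] {α : Fin (m + 1) → ℤ} (hp : p < m + 1)
    (h : Interlaces p α) : ∃ w : Forms k (m + 1) p, w ≠ 0 ∧
      IsHighestWeight (formsRep k (m + 1) p) α w := by
  obtain ⟨q, a, b, rfl | rfl, rfl⟩ := h.exists_cornerWeight hp
  · exact exists_highestWeight_form hp a b
  · exact exists_highestWeight_form_succ hp a b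

end HighestWeightForms

/-! ### Complete reducibility -/

section Semisimple

variable {k : Type*} [Field k] {n : ℕ}

/-- An intertwining map, as a homomorphism of modules over the group algebra. -/
abbrev groupAlgebraHom {G V W : Type*} [Monoid G] [AddCommGroup V] [Module k V] [AddCommGroup W]
    [Module k W] {ρ : Representation k G V} {σ : Representation k G W}
    (f : ρ.IntertwiningMap σ) : ρ.asModule →ₗ[MonoidAlgebra k G] σ.asModule :=
  Representation.IntertwiningMap.equivLinearMapAsModule ρ σ f

/-- Left translation by `g`, from `Σ^α(V)` to the functions on the group. -/
def translateHom (α : Fin n → ℤ) (g : GL (Fin n) k) :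
    (schurRep k α).IntertwiningMap (functionsRep k n) where
  toFun f x := f.1 (g * x)
  map_add' _ _ := rfl
  map_smul' _ _ := rfl
  isIntertwining' h := by
    ext f x
    change f.1 (g * x * h) = f.1 (g * (x * h))
    rw [mul_assoc]

theorem translateHom_injective (α : Fin n → ℤ) (g : GL (Fin n) k) :
    Function.Injective (translateHom α g) := fun f f' h => by
  ext x
  have := congrFun h (g⁻¹ * x)
  change f.1 (g * (g⁻¹ * x)) = f'.1 (g * (g⁻¹ * x)) at this
  rwa [mul_inv_cancel_left] at this

variable (k n) in
/-- The set of the submodules of functions on the group that are left translates of some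
`Σ^α(V)`, with `α` dominant. -/
def translateSubmodules : Set (Submodule (MonoidAlgebra k (GL (Fin n) k))
    (functionsRep k n).asModule) :=
  {N | ∃ α : Fin n → ℤ, Antitone α ∧ ∃ g, N = LinearMap.range (groupAlgebraHom (translateHom α g))}

theorem exists_linearEquiv_of_mem_translateSubmodules
    {N : Submodule (MonoidAlgebra k (GL (Fin n) k)) (functionsRep k n).asModule}
    (hN : N ∈ translateSubmodules k n) : ∃ α : Fin n → ℤ, Antitone α ∧
      Nonempty (N ≃ₗ[MonoidAlgebra k (GL (Fin n) k)] (schurRep k α).asModule) := by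
  obtain ⟨α, hα, g, rfl⟩ := hN
  exact ⟨α, hα, ⟨(LinearEquiv.ofInjective (groupAlgebraHom (translateHom α g))
    (translateHom_injective α g)).symm⟩⟩

variable [CharZero k]

theorem isSimpleModule_schur {α : Fin n → ℤ} (hα : Antitone α) :
    IsSimpleModule (MonoidAlgebra k (GL (Fin n) k)) (schurRep k α).asModule :=
  (Representation.irreducible_iff_isSimpleModule_asModule _).1 (schurRep_isIrreducible hα)

theorem isSimpleModule_of_mem_translateSubmodules
    {N : Submodule (MonoidAlgebra k (GL (Fin n) k)) (functionsRep k n).asModule}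
    (hN : N ∈ translateSubmodules k n) : IsSimpleModule (MonoidAlgebra k (GL (Fin n) k)) N := by
  obtain ⟨α, hα, ⟨e⟩⟩ := exists_linearEquiv_of_mem_translateSubmodules hN
  have := isSimpleModule_schur (k := k) hα
  exact IsSimpleModule.congr (N := (schurRep k α).asModule) e

theorem IsRegular.mem_sSup_translateSubmodules {f : GL (Fin n) k → k} (hf : IsRegular f) :
    (show (functionsRep k n).asModule from f) ∈ sSup (translateSubmodules k n) := by
  have h := hf.mem_translateSpan
  clear hf
  induction h using Submodule.span_induction with
  | mem f hf =>
    obtain ⟨α, hα, g, h, rfl⟩ := hf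
    have hle : LinearMap.range (groupAlgebraHom (translateHom α g)) ≤
        sSup (translateSubmodules k n) := le_sSup ⟨α, hα, g, rfl⟩
    exact hle (LinearMap.mem_range.2 ⟨schurRep k α h (schurVec k α), rfl⟩)
  | zero => exact zero_mem _
  | add f g _ _ hf hg => exact add_mem hf hg
  | smul c f _ hf =>
    exact (sSup (translateSubmodules k n)).smul_of_tower_mem c hf

variable {V : Type*} [AddCommGroup V] [Module k V] {ρ : Representation k (GL (Fin n) k) V}
  {Φ : ρ.IntertwiningMap (functionsRep k n)} (hΦ : Function.Injective Φ)
  (hreg : ∀ v, IsRegular (Φ v))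

include hΦ hreg in
/-- A representation that embeds into the regular functions on the group is semisimple. -/
theorem isSemisimpleModule_of_embedding :
    IsSemisimpleModule (MonoidAlgebra k (GL (Fin n) k)) ρ.asModule := by
  have h : IsSemisimpleModule (MonoidAlgebra k (GL (Fin n) k))
      (⨆ N ∈ translateSubmodules k n, N : Submodule (MonoidAlgebra k (GL (Fin n) k))
        (functionsRep k n).asModule) :=
    isSemisimpleModule_biSup_of_isSemisimpleModule_submodule fun N hN => by
      have := isSimpleModule_of_mem_translateSubmodules hN
      infer_instance
  refine IsSemisimpleModule.of_injective (M := ↥(⨆ N ∈ translateSubmodules k n, N))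
    ((groupAlgebraHom Φ).codRestrict (⨆ N ∈ translateSubmodules k n, N) fun v => ?_) ?_
  · rw [← sSup_eq_iSup]
    exact (hreg v).mem_sSup_translateSubmodules
  · exact fun v w h => hΦ (congrArg Subtype.val h)

include hΦ hreg in
/-- The irreducible constituents of a representation that embeds into the regular functions are
the `Σ^γ(V)`. -/
theorem exists_linearEquiv_schur (N : Submodule (MonoidAlgebra k (GL (Fin n) k)) ρ.asModule)
    [IsSimpleModule (MonoidAlgebra k (GL (Fin n) k)) N] : ∃ γ : Fin n → ℤ, Antitone γ ∧
      Nonempty (N ≃ₗ[MonoidAlgebra k (GL (Fin n) k)] (schurRep k γ).asModule) := by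
  have hs : ∀ S : translateSubmodules k n, IsSimpleModule (MonoidAlgebra k (GL (Fin n) k)) S.1 :=
    fun S => isSimpleModule_of_mem_translateSubmodules S.2
  let e := Submodule.equivMapOfInjective (groupAlgebraHom Φ) hΦ N
  have : IsSimpleModule (MonoidAlgebra k (GL (Fin n) k)) (N.map (groupAlgebraHom Φ)) :=
    .congr e.symm
  obtain ⟨S, hS, ⟨e'⟩⟩ := (N.map (groupAlgebraHom Φ)).linearEquiv_of_le_sSup
    (translateSubmodules k n) (by
      rintro _ ⟨v, _, rfl⟩
      exact (hreg v).mem_sSup_translateSubmodules)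
  obtain ⟨γ, hγ, ⟨e''⟩⟩ := exists_linearEquiv_of_mem_translateSubmodules hS
  exact ⟨γ, hγ, ⟨(e.trans e').trans e''⟩⟩

omit [CharZero k] in
theorem IsHighestWeight.map {W : Type*} [AddCommGroup W] [Module k W]
    {σ : Representation k (GL (Fin n) k) W} {α : Fin n → ℤ} {v : V} (hv : IsHighestWeight ρ α v)
    (f : ρ.IntertwiningMap σ) : IsHighestWeight σ α (f v) := fun b hb => by
  rw [← f.isIntertwining, hv b hb, map_smul]

include hΦ hreg in
/-- In a representation that embeds into the regular functions, a nonzero highest weight vector of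
weight `α` forces `α` to be dominant and `Σ^α(V)` to be a subrepresentation: its projection to some
irreducible constituent is nonzero. -/
theorem exists_injective_of_isHighestWeight {α : Fin n → ℤ} {v : V} (h0 : v ≠ 0)
    (hv : IsHighestWeight ρ α v) : Antitone α ∧
      ∃ f : (schurRep k α).IntertwiningMap ρ, Function.Injective f := by
  have := isSemisimpleModule_of_embedding hΦ hreg
  obtain ⟨s, e, -, hs⟩ := IsSemisimpleModule.exists_linearEquiv_dfinsupp
    (MonoidAlgebra k (GL (Fin n) k)) ρ.asModule
  have h1 : e v ≠ 0 := fun h => h0 (e.map_eq_zero_iff.1 h)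
  obtain ⟨N, hN⟩ := DFunLike.ne_iff.1 h1
  have := hs N
  obtain ⟨γ, hγ, ⟨e'⟩⟩ := exists_linearEquiv_schur hΦ hreg N.1
  let q : ρ.asModule →ₗ[MonoidAlgebra k (GL (Fin n) k)] (schurRep k γ).asModule :=
    e'.toLinearMap ∘ₗ DFinsupp.lapply N ∘ₗ e.toLinearMap
  have hq : q v ≠ 0 := fun h => hN (e'.map_eq_zero_iff.1 h)
  have := hv.map ((Representation.IntertwiningMap.equivLinearMapAsModule ρ (schurRep k γ)).symm q)
  obtain ⟨rfl, -⟩ := schur_highestWeight hγ hq this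
  refine ⟨hγ, (Representation.IntertwiningMap.equivLinearMapAsModule _ _).symm
    (N.1.subtype ∘ₗ e'.symm.toLinearMap), fun x y h => ?_⟩
  exact e'.symm.injective (Subtype.ext h)

end Semisimple

/-! ### Decomposition by highest weights -/

section Decomposition

/-- A semisimple module is the direct sum of pairwise nonisomorphic simple submodules `f i (S i)`
as soon as every simple submodule is contained in one of these. -/
theorem bijective_toModule_of_simple {Λ A ι : Type*} [Ring Λ] [AddCommGroup A] [Module Λ A]
    [IsSemisimpleModule Λ A] [DecidableEq ι] {S : ι → Type*} [∀ i, AddCommGroup (S i)]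
    [∀ i, Module Λ (S i)] [∀ i, IsSimpleModule Λ (S i)] (f : ∀ i, S i →ₗ[Λ] A)
    (hf : ∀ i, Function.Injective (f i)) (hS : ∀ i j, Nonempty (S i ≃ₗ[Λ] S j) → i = j)
    (hN : ∀ N : Submodule Λ A, IsSimpleModule Λ N → ∃ i, N ≤ LinearMap.range (f i)) :
    Function.Bijective (DirectSum.toModule Λ ι A f) := by
  let e i : S i ≃ₗ[Λ] LinearMap.range (f i) := LinearEquiv.ofInjective (f i) (hf i)
  have hsimple : ∀ i, IsSimpleModule Λ (LinearMap.range (f i)) := fun i => .congr (e i).symm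
  have hind : iSupIndep fun i => LinearMap.range (f i) := fun i => by
    have hatom : IsAtom (LinearMap.range (f i)) := isSimpleModule_iff_isAtom.1 (hsimple i)
    rw [← hatom.not_le_iff_disjoint, iSup_subtype', ← sSup_range]
    intro hle
    have : ∀ N : Set.range fun j : {j // j ≠ i} => LinearMap.range (f j.1),
        IsSimpleModule Λ N.1 := by
      rintro ⟨_, j, rfl⟩
      exact hsimple j.1
    obtain ⟨_, ⟨j, rfl⟩, ⟨e'⟩⟩ := Submodule.linearEquiv_of_le_sSup _ _ hle
    exact j.2 (hS _ _ ⟨((e i).trans (e'.trans (e j.1).symm)).symm⟩)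
  constructor
  · have h : DirectSum.toModule Λ ι A f = DFinsupp.lsum ℕ (fun i => (LinearMap.range (f i)).subtype)
        ∘ₗ DFinsupp.mapRange.linearMap fun i => (e i).toLinearMap := by
      refine DirectSum.linearMap_ext Λ fun i => LinearMap.ext fun x => ?_
      rw [LinearMap.comp_apply, DirectSum.toModule_lof, LinearMap.comp_apply, LinearMap.comp_apply,
        DirectSum.lof, DFinsupp.mapRange.linearMap_apply, DFinsupp.lsingle_apply,
        DFinsupp.mapRange_single, DFinsupp.lsum_single]
      rfl
    rw [h, LinearMap.coe_comp]
    exact hind.dfinsupp_lsum_injective.comp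
      ((DFinsupp.mapRange_injective (fun i x => e i x) (fun i => map_zero _)).2
        fun i => (e i).injective)
  · rw [← LinearMap.range_eq_top, eq_top_iff, ← IsSemisimpleModule.sSup_simples_eq_top]
    refine sSup_le fun N hN' => ?_
    obtain ⟨i, hi⟩ := hN N hN'
    refine hi.trans ?_
    rintro _ ⟨x, rfl⟩
    exact ⟨DirectSum.lof Λ ι S i x, DirectSum.toModule_lof Λ i x⟩

variable {k : Type*} [Field k] {n : ℕ} {V : Type*} [AddCommGroup V] [Module k V]
  {ρ : Representation k (GL (Fin n) k) V}

/-- An intertwining map from `Σ^α(V)` is determined by the image of the highest weight vector. -/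
theorem schur_hom_ext {α : Fin n → ℤ} {f f' : (schurRep k α).IntertwiningMap ρ}
    (h : f (schurVec k α) = f' (schurVec k α)) : f = f' := by
  refine Representation.IntertwiningMap.ext (LinearMap.ext fun w => ?_)
  induction schur_span α w using Submodule.span_induction with
  | mem w hw =>
    obtain ⟨g, rfl⟩ := hw
    exact (f.isIntertwining _ _ g _).trans
      ((congrArg (ρ g) h).trans (f'.isIntertwining _ _ g _).symm)
  | zero => rw [map_zero, map_zero]
  | add x y _ _ hx hy => rw [map_add, map_add, hx, hy]
  | smul c x _ hx => rw [map_smul, map_smul, hx]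

/-- A representation in which highest weight vectors of the same weight are proportional. -/
def HasSimpleSpectrum (ρ : Representation k (GL (Fin n) k) V) : Prop :=
  ∀ (α : Fin n → ℤ) (v w : V), v ≠ 0 → IsHighestWeight ρ α v → IsHighestWeight ρ α w →
    ∃ c : k, c • v = w

theorem HasSimpleSpectrum.rank_le_one (hρ : HasSimpleSpectrum ρ) (α : Fin n → ℤ) :
    Module.rank k ((schurRep k α).IntertwiningMap ρ) ≤ 1 := by
  rw [rank_le_one_iff]
  by_cases h : ∃ f : (schurRep k α).IntertwiningMap ρ, f (schurVec k α) ≠ 0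
  · obtain ⟨f, hf⟩ := h
    refine ⟨f, fun f' => ?_⟩
    obtain ⟨c, hc⟩ := hρ α _ _ hf ((isHighestWeight_schurVec α).map f)
      ((isHighestWeight_schurVec α).map f')
    exact ⟨c, schur_hom_ext hc⟩
  · push Not at h
    exact ⟨0, fun f => ⟨0, schur_hom_ext ((h _).trans (h f).symm)⟩⟩

variable [CharZero k]

theorem weight_eq_of_linearEquiv {α β : Fin n → ℤ} (hβ : Antitone β)
    (e : (schurRep k α).asModule ≃ₗ[MonoidAlgebra k (GL (Fin n) k)] (schurRep k β).asModule) :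
    α = β :=
  (schur_highestWeight hβ (fun h => schurVec_ne_zero α (e.map_eq_zero_iff.1 h))
    ((isHighestWeight_schurVec α).map
      ((Representation.IntertwiningMap.equivLinearMapAsModule _ _).symm e.toLinearMap))).1

/-- A representation with simple spectrum that embeds into the regular functions is the direct sum
of the `Σ^α(V)` over the weights `α` of its nonzero highest weight vectors. -/
theorem HasSimpleSpectrum.equiv_directSum (hρ : HasSimpleSpectrum ρ)
    {Φ : ρ.IntertwiningMap (functionsRep k n)} (hΦ : Function.Injective Φ)
    (hreg : ∀ v, IsRegular (Φ v)) {P : (Fin n → ℤ) → Prop}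
    (hP : ∀ α, P α ↔ ∃ v, v ≠ 0 ∧ IsHighestWeight ρ α v) :
    Nonempty (ρ.Equiv (Representation.directSum fun α : {α : Fin n → ℤ // P α} =>
      schurRep k α.1)) := by
  classical
  have hf : ∀ α : {α : Fin n → ℤ // P α}, Antitone α.1 ∧
      ∃ f : (schurRep k α.1).IntertwiningMap ρ, Function.Injective f := fun α => by
    obtain ⟨v, h0, hv⟩ := (hP α.1).1 α.2
    exact exists_injective_of_isHighestWeight hΦ hreg h0 hv
  choose hanti f hinj using hf
  have := isSemisimpleModule_of_embedding hΦ hreg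
  have hs : ∀ α : {α : Fin n → ℤ // P α},
      IsSimpleModule (MonoidAlgebra k (GL (Fin n) k)) (schurRep k α.1).asModule :=
    fun α => isSimpleModule_schur (hanti α)
  have key := bijective_toModule_of_simple
    (S := fun α : {α : Fin n → ℤ // P α} => (schurRep k α.1).asModule) (fun α => groupAlgebraHom (f α)) hinj
    (fun α β ⟨e⟩ => Subtype.ext (weight_eq_of_linearEquiv (hanti β) e)) fun N hN => by
      obtain ⟨γ, hγ, ⟨e⟩⟩ := exists_linearEquiv_schur hΦ hreg N
      let g := (Representation.IntertwiningMap.equivLinearMapAsModule (schurRep k γ) ρ).symm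
        (N.subtype ∘ₗ e.symm.toLinearMap)
      have hg0 : g (schurVec k γ) ≠ 0 := fun h => schurVec_ne_zero γ
        (e.symm.map_eq_zero_iff.1 (Subtype.ext h))
      have hgw := (isHighestWeight_schurVec γ).map g
      let α : {α : Fin n → ℤ // P α} := ⟨γ, (hP γ).2 ⟨_, hg0, hgw⟩⟩
      have hf0 : f α (schurVec k γ) ≠ 0 := fun h => schurVec_ne_zero γ
        (hinj α (h.trans (map_zero (f α).toLinearMap).symm))
      obtain ⟨c, hc⟩ := hρ γ _ _ hf0 ((isHighestWeight_schurVec γ).map (f α)) hgw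
      have hgc : c • f α = g := schur_hom_ext hc
      refine ⟨α, fun v hv => ⟨c • e ⟨v, hv⟩, ?_⟩⟩
      have h1 := congrArg (fun φ : (schurRep k γ).IntertwiningMap ρ => φ (e ⟨v, hv⟩)) hgc
      refine ((f α).toLinearMap.map_smul c _).trans (h1.trans ?_)
      exact congrArg Subtype.val (e.symm_apply_apply ⟨v, hv⟩)
  -- as functions, the sums over `k` and over the group algebra are the same
  let Ψ : (Representation.directSum fun α : {α : Fin n → ℤ // P α} =>
      schurRep k α.1).IntertwiningMap ρ :=
    { toLinearMap := DirectSum.toModule k _ V fun α => (f α).toLinearMap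
      isIntertwining' := fun g => by
        refine DirectSum.linearMap_ext k fun α => LinearMap.ext fun w => ?_
        simp [Representation.directSum, (f α).isIntertwining _ _] }
  exact ⟨(Ψ.ofBijective key).symm⟩

end Decomposition

/-! ### The spectrum of the space of forms -/

section Spectrum

variable {k : Type*} [Field k] {m p : ℕ}

/-- The action of the scalars of `k` on forms, as a shortcut for instance search. -/
instance formsModule {n : ℕ} : Module k (Forms k n p) := Submodule.module' _

/-- `formFun` as an intertwining map to the functions on the group. -/
def formHom {n : ℕ} [NeZero n] (hp : p < n) :
    (formsRep k n p).IntertwiningMap (functionsRep k n) where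
  toLinearMap := formFun hp
  isIntertwining' g := LinearMap.ext fun w => formFun_formsRep hp g w

theorem isStabilizerSemiinvariant_formFun (hp : p < m + 1) (w : Forms k (m + 1) p) :
    IsStabilizerSemiinvariant (fun j : Fin m => if (j : ℕ) + 1 < m + 1 - p then 0 else -1)
      (formFun hp w) := fun h x hh => by
  rw [formFun_lower_mul hp w hh, prod_lastIdx hp.le fun i => h.1 i i, Fin.prod_univ_succ, hh.2,
    if_pos rfl, one_zpow, one_mul]
  congr 1
  refine Finset.prod_congr rfl fun j _ => ?_
  dsimp only
  rw [Fin.val_succ]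
  by_cases hj : (j : ℕ) + 1 < m + 1 - p
  · rw [if_pos hj, if_neg (by omega)]
  · rw [if_neg hj, if_pos (by omega)]

variable [CharZero k]

/-- In a representation that embeds into the regular functions of fixed left weight under the
stabilizer, highest weight vectors are determined by the weight and by the value of the
corresponding function at one point. -/
theorem hasSimpleSpectrum_of_isStabilizerSemiinvariant {V : Type*} [AddCommGroup V] [Module k V]
    {ρ : Representation k (GL (Fin (m + 1)) k) V}
    {Φ : ρ.IntertwiningMap (functionsRep k (m + 1))} (hΦ : Function.Injective Φ)
    (hreg : ∀ v, IsRegular (Φ v)) {β : Fin m → ℤ}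
    (hβ : ∀ v, IsStabilizerSemiinvariant β (Φ v)) : HasSimpleSpectrum ρ :=
  fun α v w h0 hv hw => by
    have hne : ∀ u, u ≠ 0 → Φ u ≠ 0 := fun u hu h =>
      hu (hΦ (h.trans (map_zero Φ.toLinearMap).symm))
    let a := Φ v (columnGL 1)
    let b := Φ w (columnGL 1)
    have ha : a ≠ 0 := apply_columnGL_ne_zero (hv.map Φ) (hβ v) (hreg v) (hne v h0)
    have hu : IsHighestWeight ρ α ((b / a) • v - w) := fun u hu => by
      rw [map_sub, map_smul, hv u hu, hw u hu, smul_sub, smul_comm]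
    refine ⟨b / a, ?_⟩
    by_contra hvw
    refine apply_columnGL_ne_zero (hu.map Φ) (hβ _) (hreg _) (hne _ (sub_ne_zero.2 hvw)) ?_
    have h : Φ ((b / a) • v - w) = (b / a) • Φ v - Φ w := by
      refine (Φ.toLinearMap.map_sub _ _).trans ?_
      exact congrArg (· - Φ w) (Φ.toLinearMap.map_smul _ _)
    rw [h]
    change b / a * a - b = 0
    rw [div_mul_cancel₀ _ ha, sub_self]

theorem interlaces_of_isHighestWeight (hp : p < m + 1) {α : Fin (m + 1) → ℤ}
    {w : Forms k (m + 1) p} (h0 : w ≠ 0) (hw : IsHighestWeight (formsRep k (m + 1) p) α w) :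
    Interlaces p α := fun i hi =>
  interlaces_of_isStabilizerSemiinvariant (hw.map (formHom hp))
    (isStabilizerSemiinvariant_formFun hp w) (isRegular_formFun hp w)
    (fun h => h0 (formFun_injective hp (h.trans (map_zero (formFun hp)).symm))) ⟨i, by omega⟩

theorem hasSimpleSpectrum_formsRep (hp : p < m + 1) :
    HasSimpleSpectrum (formsRep k (m + 1) p) :=
  hasSimpleSpectrum_of_isStabilizerSemiinvariant (Φ := formHom hp) (formFun_injective hp)
    (isRegular_formFun hp) (isStabilizerSemiinvariant_formFun hp)

theorem interlaces_iff (hp : p < m + 1) (α : Fin (m + 1) → ℤ) :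
    Interlaces p α ↔ ∃ w, w ≠ 0 ∧ IsHighestWeight (formsRep k (m + 1) p) α w :=
  ⟨exists_highestWeight_of_interlaces hp, fun ⟨_, h0, hw⟩ => interlaces_of_isHighestWeight hp h0 hw⟩

end Spectrum

end Jouanolou

end

theorem mainTheorem8 {k : Type*} [Field k] [CharZero k] (n p : ℕ) (hp : p < n) :
    -- for dominant `α`, the representation `Σ^α(V)` is the irreducible one of highest weight `α`
    (∀ α : Fin n → ℤ, Antitone α →
      Jouanolou.IsIrreducibleOfHighestWeight (Jouanolou.schurRep k α) α) ∧
    -- `A^p` is the direct sum of the `Σ^α(V)` over the `α` with the stated inequalities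
    Nonempty ((Jouanolou.formsRep k n p).Equiv (Representation.directSum
      fun α : {α : Fin n → ℤ // Jouanolou.Interlaces p α} => Jouanolou.schurRep k α.1)) ∧
    -- each `Σ^α(V)` enters into `A^p` at most once
    (∀ α : Fin n → ℤ, Antitone α →
      Module.rank k ((Jouanolou.schurRep k α).IntertwiningMap (Jouanolou.formsRep k n p)) ≤ 1) ∧
    -- it enters if and only if the stated inequalities hold
    (∀ α : Fin n → ℤ, Antitone α →
      ((∃ f : (Jouanolou.schurRep k α).IntertwiningMap (Jouanolou.formsRep k n p),
        Function.Injective f) ↔ Jouanolou.Interlaces p α)) := by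
  obtain ⟨m, rfl⟩ : ∃ m, n = m + 1 := ⟨n - 1, by omega⟩
  have hinj : Function.Injective (Jouanolou.formHom (k := k) hp) :=
    Jouanolou.formFun_injective hp
  have hreg : ∀ w, Jouanolou.IsRegular (Jouanolou.formHom (k := k) hp w) :=
    Jouanolou.isRegular_formFun hp
  have hsimple := Jouanolou.hasSimpleSpectrum_formsRep (k := k) hp
  refine ⟨fun α hα => Jouanolou.schurRep_isIrreducibleOfHighestWeight hα,
    hsimple.equiv_directSum hinj hreg (Jouanolou.interlaces_iff hp),
    fun α _ => hsimple.rank_le_one α, fun α _ => ⟨fun ⟨f, hf⟩ => ?_, fun h => ?_⟩⟩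
  · refine Jouanolou.interlaces_of_isHighestWeight hp (fun h => ?_)
      ((Jouanolou.isHighestWeight_schurVec (k := k) α).map f)
    exact Jouanolou.schurVec_ne_zero α (hf (h.trans (map_zero f.toLinearMap).symm))
  · obtain ⟨w, h0, hw⟩ := (Jouanolou.interlaces_iff (k := k) hp α).1 h
    exact (Jouanolou.exists_injective_of_isHighestWeight hinj hreg h0 hw).2
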